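/- **Theorem 4.1.** Let $X$ be a real separable infinite-dimensional Hilbert space and let $A:D(A)\subset X\to X$ be a densely defined linear operator with a bounded inverse $A^{-1}:X\to X$ that is compact, symmetric and positive. Let $\{\phi_n\}_{n\in\mathbb N}\subset D(A)$ be an orthonormal basis of $X$ with $A\phi_n=\lambda_n\phi_n$, $\lambda_n>0$ (such a basis exists). For $\beta\ge 0$ put $$D(A^{\beta})=\Big\{v\in X:\ \|v\|_{D(A^\beta)}^2:=\sum_{n}\lambda_n^{2\beta}(v,\phi_n)_X^2<\infty\Big\},$$ and for $v,w\in D(A^{1/2})$ understand $(Av,w)_X$ as $\sum_n\lambda_n(v,\phi_n)_X(w,\phi_n)_X$. Let $1<\alpha<2$, $T>0$, $\sigma\ge 1$. For $J\in\mathbb N$, $J\ge1$, let $t_j=(j/J)^\sigma T$, $0\le j\le J$. Let $W_\tau$ be the set of $D(A^{1/2})$-valued functions on $(0,T)$ that are constant on each $(t_{j-1},t_j)$, and let $W_\tau^{c}$ be the set of functions in $C([0,T];D(A^{1/2}))$ that are linear on each $(t_{j-1},t_j)$, $1\le j\le J$. For $0<\gamma<1$ let $$(\mathrm D_{0+}^{\gamma}v)(t)=\frac{\mathrm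 d}{\mathrm dt}\,\frac1{\Gamma(1-\gamma)}\int_0^t(t-s)^{-\gamma}v(s)\,\mathrm ds$$ be the Riemann–Liouville derivative. For $u_0\in X$ let $$u(t)=\sum_{n}E_{\alpha,1}(-\lambda_nt^\alpha)\,(u_0,\phi_n)_X\,\phi_n,\qquad E_{\alpha,1}(z)=\sum_{k=0}^\infty\frac{z^k}{\Gamma(k\alpha+1)},\qquad 0\le t\le T,$$ be the solution of $\mathrm D_{0+}^\alpha(u-u_0)+Au=0$ on $(0,T]$. Then there is a constant $C>0$ depending only on $\alpha,\sigma,T$ such that the following holds for all $X$, $A$ and $\{(\phi_n,\lambda_n)\}$ as above. If $1/2<\nu\le1$, $u_0\in D(A^\nu)$ and $$\sigma>\frac{3-\alpha}{\alpha(\nu-1/2)},$$ then for every $J\ge1$ and every $U\in W_\tau^{c}$ with $U(0)=u_0$ and $$\int_0^T\big(\mathrm D_{0+}^{\alpha-1}U'+AU,\,V\big)_X\,\mathrm dt=0\qquad\text{for all }V\in W_\tau,$$ one has $$\max_{1\le m\le J}\|(u-U)(t_m)\|_X\le C\,J^{\alpha-3}\,\|u_0\|_{D(A^\nu)}.$$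 -/

import Mathlib

open scoped InnerProductSpace

noncomputable section

namespace FracWave

variable {X : Type*} [NormedAddCommGroup X] [InnerProductSpace ℝ X]

/-! ### The operator and its spectral decomposition -/

/-- `A : D(A) ⊆ X → X` is densely defined and has a bounded inverse `B = A⁻¹ : X → X` that is
compact, symmetric and positive. -/
structure IsAdmissibleOperator (A : X →ₗ.[ℝ] X) : Prop where
  dense_domain : Dense (A.domain : Set X)
  exists_inverse : ∃ B : X →L[ℝ] X,
    (∀ x : X, ∃ h : B x ∈ A.domain, A ⟨B x, h⟩ = x) ∧
    (∀ x : A.domain, B (A x) = x) ∧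
    IsCompactOperator B ∧ B.IsPositive

/-- `φ` is an orthonormal (Hilbert) basis of `X` that consists of eigenvectors of `A`, with
positive eigenvalues `lam n`. -/
structure IsEigenbasis (A : X →ₗ.[ℝ] X) (φ : HilbertBasis ℕ ℝ X) (lam : ℕ → ℝ) : Prop where
  eigenvector : ∀ n, ∃ h : φ n ∈ A.domain, A ⟨φ n, h⟩ = lam n • φ n
  pos : ∀ n, 0 < lam n

/-- The domain `D(A^ν)`. -/
def powDomain (φ : HilbertBasis ℕ ℝ X) (lam : ℕ → ℝ) (ν : ℝ) : Set X :=
  {v | Summable fun n => lam n ^ (2 * ν) * ⟪φ n, v⟫_ℝ ^ 2}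

/-- The norm of `D(A^ν)`. -/
def powNorm (φ : HilbertBasis ℕ ℝ X) (lam : ℕ → ℝ) (ν : ℝ) (v : X) : ℝ :=
  √(∑' n, lam n ^ (2 * ν) * ⟪φ n, v⟫_ℝ ^ 2)

/-- The pairing `(A v, w)_X` for `v, w ∈ D(A^{1/2})`, that is `(A^{1/2} v, A^{1/2} w)_X`. -/
def energyForm (φ : HilbertBasis ℕ ℝ X) (lam : ℕ → ℝ) (v w : X) : ℝ :=
  ∑' n, lam n * ⟪φ n, v⟫_ℝ * ⟪φ n, w⟫_ℝ

/-! ### The exact solution -/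

/-- The Mittag-Leffler function `E_{α,β}` on the real line. -/
def mittagLeffler (α β x : ℝ) : ℝ :=
  ∑' k : ℕ, x ^ k / Real.Gamma (k * α + β)

/-- The solution `u(t) = ∑ₙ E_{α,1}(-λₙ t^α) (u₀, φₙ) φₙ` of `D_{0+}^α (u - u₀) + A u = 0`. -/
def exactSolution (φ : HilbertBasis ℕ ℝ X) (lam : ℕ → ℝ) (α : ℝ) (u₀ : X) (t : ℝ) : X :=
  ∑' n, (mittagLeffler α 1 (-(lam n) * t ^ α) * ⟪φ n, u₀⟫_ℝ) • φ n

/-! ### Riemann-Liouville operators with base point `0` -/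

/-- The fractional integral `D_{0+}^{-β} v`, for `0 < β`. -/
def fracIntegral (β : ℝ) (v : ℝ → X) (t : ℝ) : X :=
  (Real.Gamma β)⁻¹ • ∫ s in (0 : ℝ)..t, (t - s) ^ (β - 1) • v s

/-- The Riemann-Liouville derivative `D_{0+}^γ v = d/dt D_{0+}^{γ-1} v`, for `0 < γ < 1`. It is
applied below to step functions `v` only; then `D_{0+}^{γ-1} v` is absolutely continuous, so that
its distributional derivative is the integrable function given a.e. by the pointwise one. -/
def fracDeriv (γ : ℝ) (v : ℝ → X) (t : ℝ) : X :=
  deriv (fracIntegral (1 - γ) v) t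

/-! ### The discretization -/

/-- The graded grid `t_j = (j/J)^σ T`. -/
def gridPoint (σ T : ℝ) (J j : ℕ) : ℝ := ((j : ℝ) / J) ^ σ * T

/-- The test space `W_τ`: functions with values in `D(A^{1/2})` that are constant on each open
grid interval. (The finitely many values at the grid points do not matter.) -/
def testSpace (φ : HilbertBasis ℕ ℝ X) (lam : ℕ → ℝ) (σ T : ℝ) (J : ℕ) : Set (ℝ → X) :=
  {V | ∀ j < J, ∃ c ∈ powDomain φ lam (1 / 2),
    ∀ t ∈ Set.Ioo (gridPoint σ T J j) (gridPoint σ T J (j + 1)), V t = c}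

/-- The trial space `W_τ^c`: continuous functions from `[0,T]` to `D(A^{1/2})` that are linear on
each grid interval, i.e. those that have nodal values in `D(A^{1/2})` and coincide on each closed
grid interval with the linear interpolant of the two nodal values. (Values outside `[0,T]` do not
matter.) -/
def trialSpace (φ : HilbertBasis ℕ ℝ X) (lam : ℕ → ℝ) (σ T : ℝ) (J : ℕ) : Set (ℝ → X) :=
  {U | (∀ j ≤ J, U (gridPoint σ T J j) ∈ powDomain φ lam (1 / 2)) ∧
    ∀ j < J, ∀ t ∈ Set.Icc (gridPoint σ T J j) (gridPoint σ T J (j + 1)),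
      U t =
        ((gridPoint σ T J (j + 1) - t) / (gridPoint σ T J (j + 1) - gridPoint σ T J j)) •
            U (gridPoint σ T J j) +
        ((t - gridPoint σ T J j) / (gridPoint σ T J (j + 1) - gridPoint σ T J j)) •
            U (gridPoint σ T J (j + 1))}

/-- `U` is a Petrov-Galerkin approximation: `U ∈ W_τ^c`, `U(0) = u₀` and
`∫₀ᵀ (D_{0+}^{α-1} U' + A U, V)_X dt = 0` for all `V ∈ W_τ`. -/
structure IsPetrovGalerkin (φ : HilbertBasis ℕ ℝ X) (lam : ℕ → ℝ) (α σ T : ℝ) (J : ℕ) (u₀ : X)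
    (U : ℝ → X) : Prop where
  mem_trial : U ∈ trialSpace φ lam σ T J
  initial : U 0 = u₀
  galerkin : ∀ V ∈ testSpace φ lam σ T J,
    ∫ t in (0 : ℝ)..T, (⟪fracDeriv (α - 1) (deriv U) t, V t⟫_ℝ + energyForm φ lam (U t) (V t)) = 0

/-- An orthonormal eigenbasis exists. -/
theorem exists_isEigenbasis [CompleteSpace X] [TopologicalSpace.SeparableSpace X]
    (hX : ¬ FiniteDimensional ℝ X) (A : X →ₗ.[ℝ] X) (hA : IsAdmissibleOperator A) :
    ∃ (φ : HilbertBasis ℕ ℝ X) (lam : ℕ → ℝ), IsEigenbasis A φ lam := by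
  obtain ⟨B, hAB, hBA, hc, hp⟩ := hA.exists_inverse
  have hs : (B : X →ₗ[ℝ] X).IsSymmetric := hp.isSymmetric
  have hfam := hs.orthogonalFamily_eigenspaces
  have hcompl : ∀ μ : ℝ, CompleteSpace (Module.End.eigenspace (B : X →ₗ[ℝ] X) μ) := fun μ => by
    have : IsClosed (Module.End.eigenspace (B : X →ₗ[ℝ] X) μ : Set X) := by
      have h : (Module.End.eigenspace (B : X →ₗ[ℝ] X) μ : Set X) = {x | B x = μ • x} := by
        ext x; simp [Module.End.mem_eigenspace_iff]
      rw [h]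
      exact isClosed_eq B.continuous (continuous_const_smul μ)
    exact this.completeSpace_coe
  choose w b hb using fun μ : ℝ =>
    exists_hilbertBasis ℝ (Module.End.eigenspace (B : X →ₗ[ℝ] X) μ)
  have hon := hfam.orthonormal_sigma_orthonormal (fun μ => (b μ).orthonormal)
  set v : (Σ μ : ℝ, w μ) → X := fun a => ((b a.1 a.2 : _) : X) with hv
  have hon' : Orthonormal ℝ v := hon
  have hbot : (Submodule.span ℝ (Set.range v))ᗮ = ⊥ := by
    rw [eq_bot_iff, ← ContinuousLinearMap.orthogonalComplement_iSup_eigenspaces_eq_bot hc hs]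
    intro x hx
    rw [← Submodule.iInf_orthogonal, Submodule.mem_iInf]
    intro μ y hy
    have hy0 : (b μ).repr ((Module.End.eigenspace (B : X →ₗ[ℝ] X) μ).orthogonalProjectionOnto x)
        = 0 := by
      ext i
      have h1 : ⟪v ⟨μ, i⟩, x⟫_ℝ = 0 :=
        (Submodule.mem_orthogonal _ _).1 hx _ (Submodule.subset_span ⟨_, rfl⟩)
      rw [HilbertBasis.repr_apply_apply]
      simpa [hv] using h1
    have hy1 : (Module.End.eigenspace (B : X →ₗ[ℝ] X) μ).orthogonalProjectionOnto x = 0 := by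
      simpa using hy0
    exact (Submodule.mem_orthogonal _ _).1
      (Submodule.orthogonalProjectionOnto_eq_zero_iff.1 hy1) y hy
  have hcount : Countable (Σ μ : ℝ, w μ) := by
    refine Pairwise.countable_of_isOpen_disjoint (s := fun a => Metric.ball (v a) (1 / 2))
      ?_ (fun _ => Metric.isOpen_ball) (fun a => ⟨v a, by simp⟩)
    intro a c hac
    refine Metric.ball_disjoint_ball ?_
    have h2 : ‖v a - v c‖ ^ 2 = 2 := by
      rw [norm_sub_sq_real, hon'.1 a, hon'.1 c, hon'.2 hac]; norm_num
    rw [dist_eq_norm]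
    nlinarith [norm_nonneg (v a - v c)]
  have hinf : Infinite (Σ μ : ℝ, w μ) := by
    by_contra hfin
    rw [not_infinite_iff_finite] at hfin
    have := Fintype.ofFinite (Σ μ : ℝ, w μ)
    exact hX ((HilbertBasis.mkOfOrthogonalEqBot hon' hbot).toOrthonormalBasis.toBasis
      |>.finiteDimensional_of_finite)
  obtain ⟨e⟩ : Nonempty ((Σ μ : ℝ, w μ) ≃ ℕ) := nonempty_equiv_of_countable
  have hon2 : Orthonormal ℝ (v ∘ e.symm) := hon'.comp _ e.symm.injective
  have hbot2 : (Submodule.span ℝ (Set.range (v ∘ e.symm)))ᗮ = ⊥ := by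
    rw [e.symm.surjective.range_comp]; exact hbot
  have hBv : ∀ a, B (v a) = a.1 • v a := fun a =>
    Module.End.mem_eigenspace_iff.1 (b a.1 a.2).2
  have hvne : ∀ a, v a ≠ 0 := fun a => hon'.ne_zero a
  have hμ : ∀ a : Σ μ : ℝ, w μ, 0 < a.1 := by
    intro a
    have h0 : a.1 ≠ 0 := by
      intro h
      obtain ⟨h1, h2⟩ := hAB (v a)
      have h3 : (⟨B (v a), h1⟩ : A.domain) = 0 := by
        ext; simp [hBv, h]
      rw [h3, LinearPMap.map_zero] at h2
      exact hvne a h2.symm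
    have h1 := hp.inner_nonneg_left (v a)
    rw [hBv, real_inner_smul_left, real_inner_self_eq_norm_sq, hon'.1 a] at h1
    exact lt_of_le_of_ne (by simpa using h1) h0.symm
  refine ⟨HilbertBasis.mkOfOrthogonalEqBot hon2 hbot2, fun n => ((e.symm n).1)⁻¹, ?_, ?_⟩
  · intro n
    rw [HilbertBasis.coe_mkOfOrthogonalEqBot]
    obtain ⟨h1, h2⟩ := hAB ((e.symm n).1⁻¹ • v (e.symm n))
    have h3 : B ((e.symm n).1⁻¹ • v (e.symm n)) = v (e.symm n) := by
      rw [map_smul, hBv, smul_smul, inv_mul_cancel₀ (hμ _).ne', one_smul]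
    have h4 : v (e.symm n) ∈ A.domain := h3 ▸ h1
    refine ⟨h4, ?_⟩
    have h5 : (⟨B ((e.symm n).1⁻¹ • v (e.symm n)), h1⟩ : A.domain) = ⟨v (e.symm n), h4⟩ :=
      Subtype.ext h3
    rw [h5] at h2
    exact h2
  · exact fun n => inv_pos.2 (hμ _)

end FracWave

end

/-! In the eigenbasis everything decouples. Testing with `φ n` on one cell turns the Galerkin
identity into a scalar scheme for `Y j = (φ n, U (t_j))`: the increment over the cell of the
fractional integral of order `2 - α` of the piecewise constant derivative, plus `lam n` times the
trapezoidal rule, is zero (`IsPetrovGalerkin.scalar_scheme`). By Parseval it suffices to bound the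
scalar error by `K J^(α-3) lam^ν |Y 0|` with `K` independent of `lam` (`exists_scalar_error_le`).

Stability. Test the error equation with the difference quotient `w` of the error `θ`. The kernel has
positive, decreasing memory, so the fractional term controls `∑ h_j t_{j+1}^(1-α) w_j²`, and the
trapezoidal term telescopes to `lam θ_m² / 2`. With the defect `δ` and `E = ∑ δ_j² t_{j+1}^(α-1) /
h_j`, both `lam θ_m²` and `θ_m²` are bounded by multiples of `E` (`scheme_stability`).

Consistency. Let `y(t) = E_{α,1}(-lam t^α)`. Integration by parts on each cell shows that its defect
is a multiple of `Z_{j+1} - Z_j`, minus `lam` times the integral of the interpolation error over the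
cell, where `Z_m` integrates `(t_m - s)^(-α)` against the interpolation error on `(0, t_m)`.
Bounding each `Z_m` separately would lose a power of the index. Instead cell `j` seen from node `m`
is paired with cell `j+1` seen from node `m+1`: lengths, distances and `y''` change only by
`O(1/(j+1))` relative to their size or bound. This yields `|δ_j| ≤ K lam t_{j+1} (j+1)^(α-4)`
(`exists_scalar_defect_le`).

Consequently `E` is at most a multiple of `lam² τ^α ∑ (j+1)^(σα+2α-7)` with `τ = T J^(-σ)`. The
grading makes the exponent larger than `-1`, so `E` is of order `lam² J^(2α-6)`. Thus `θ_m²` is of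
order `min(lam, lam²) J^(2α-6)`, and `min(lam, lam²) ≤ lam^(2ν)` for `1/2 ≤ ν ≤ 1`.

The bounds on `y` must be uniform in `lam`. The functions `(t d/dt)^j y`, `j = 1, 2, 3`, are, for
`lam = 1`, combinations of functions with Laplace transform `-z^(-α-1) / (1 + z^(-α))^(i+1)`, `i ≥
1`. These decay quadratically along vertical lines, uniformly up to the imaginary axis, because `α <
2` keeps `z^(-α)` away from `-1` (`mlEuler_bounded`). The boundedness of `y` itself then follows
from its integral equation. -/

noncomputable section

namespace FracWave

open MeasureTheory Filter Topology

/-! ### Discrete stability -/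

/-- Increments of a concave function over translated intervals decrease. -/
theorem ConcaveOn.increment_le {f : ℝ → ℝ} (hf : ConcaveOn ℝ (Set.Ici 0) f) {x y d : ℝ}
    (hx : 0 ≤ x) (hxy : x ≤ y) (hd : 0 ≤ d) : f (y + d) - f y ≤ f (x + d) - f x := by
  rcases eq_or_lt_of_le (by linarith : x ≤ y + d) with h | h
  · have h1 : y = x := by linarith
    have h2 : d = 0 := by linarith
    simp [h1, h2]
  have hD : 0 < y + d - x := by linarith
  have hw : d / (y + d - x) + (y - x) / (y + d - x) = 1 := by
    rw [← add_div, div_eq_one_iff_eq hD.ne']; ring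
  have h1 := hf.2 (x := x) (y := y + d) hx (by simp; linarith)
    (div_nonneg hd hD.le) (div_nonneg (sub_nonneg.2 hxy) hD.le) hw
  have h2 := hf.2 (x := x) (y := y + d) hx (by simp; linarith)
    (div_nonneg (sub_nonneg.2 hxy) hD.le) (div_nonneg hd hD.le) (by rw [add_comm]; exact hw)
  have e1 : (d / (y + d - x)) • x + ((y - x) / (y + d - x)) • (y + d) = y := by
    simp only [smul_eq_mul]; field_simp; ring
  have e2 : ((y - x) / (y + d - x)) • x + (d / (y + d - x)) • (y + d) = x + d := by
    simp only [smul_eq_mul]; field_simp; ring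
  rw [e1] at h1
  rw [e2] at h2
  simp only [smul_eq_mul] at h1 h2
  have h3 : f x + f (y + d) = (d / (y + d - x) + (y - x) / (y + d - x)) * (f x + f (y + d)) := by
    rw [hw, one_mul]
  linarith

/-- The primitive `x ↦ x₊^{1-γ} / Γ(2-γ)` of the kernel `x^{-γ} / Γ(1-γ)`. -/
def kernelPrim (γ x : ℝ) : ℝ := (max x 0) ^ (1 - γ) / Real.Gamma (2 - γ)

theorem kernelPrim_of_nonpos {γ x : ℝ} (hγ : γ < 1) (hx : x ≤ 0) : kernelPrim γ x = 0 := by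
  rw [kernelPrim, max_eq_right hx, Real.zero_rpow (by linarith), zero_div]

theorem kernelPrim_of_nonneg {γ x : ℝ} (hx : 0 ≤ x) :
    kernelPrim γ x = x ^ (1 - γ) / Real.Gamma (2 - γ) := by
  rw [kernelPrim, max_eq_left hx]

theorem concaveOn_kernelPrim {γ : ℝ} (hγ₀ : 0 < γ) (hγ : γ < 1) :
    ConcaveOn ℝ (Set.Ici 0) (kernelPrim γ) := by
  have h := (Real.concaveOn_rpow (p := 1 - γ) (by linarith) (by linarith)).smul
    (inv_nonneg.2 (Real.Gamma_pos_of_pos (by linarith : 0 < 2 - γ)).le)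
  refine h.congr fun x hx => ?_
  simp only [smul_eq_mul]
  rw [kernelPrim_of_nonneg hx, div_eq_inv_mul]

theorem monotone_kernelPrim {γ : ℝ} (hγ : γ < 1) : Monotone (kernelPrim γ) := by
  intro x y hxy
  have := Real.Gamma_pos_of_pos (by linarith : 0 < 2 - γ)
  unfold kernelPrim
  gcongr

/-- The concave power `x ^ (1 - γ)` lies below its tangent at `b`, which is Bernoulli's inequality
for `a / b`. The tangent is taken at the right end so that `a = 0`, the first cell, is included. -/
theorem kernelPrim_sub_ge {γ a b : ℝ} (hγ₀ : 0 < γ) (hγ : γ < 1) (ha : 0 ≤ a) (hab : a < b) :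
    (b - a) * b ^ (-γ) / Real.Gamma (1 - γ) ≤ kernelPrim γ b - kernelPrim γ a := by
  have hb : 0 < b := ha.trans_lt hab
  have hG := Real.Gamma_pos_of_pos (by linarith : 0 < 1 - γ)
  have hG2 : Real.Gamma (2 - γ) = (1 - γ) * Real.Gamma (1 - γ) := by
    rw [← Real.Gamma_add_one (by linarith : (1 - γ) ≠ 0)]; ring_nf
  rw [kernelPrim_of_nonneg ha, kernelPrim_of_nonneg hb.le, hG2, ← sub_div,
    div_le_div_iff₀ hG (mul_pos (by linarith) hG)]
  have h1 : (a / b) ^ (1 - γ) ≤ 1 + (1 - γ) * (a / b - 1) := by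
    have := rpow_one_add_le_one_add_mul_self (s := a / b - 1)
      (by have := div_nonneg ha hb.le; linarith) (p := 1 - γ) (by linarith) (by linarith)
    simpa using this
  rw [Real.div_rpow ha hb.le, div_le_iff₀ (Real.rpow_pos_of_pos hb _)] at h1
  have h2 : b ^ (1 - γ) = b * b ^ (-γ) := by
    rw [sub_eq_add_neg, Real.rpow_add hb, Real.rpow_one]
  have h3 : (1 + (1 - γ) * (a / b - 1)) * b ^ (1 - γ)
      = b ^ (1 - γ) - (1 - γ) * (b - a) * b ^ (-γ) := by
    rw [h2]; field_simp; ring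
  rw [h3] at h1
  nlinarith

/-- The weight of the `i`-th cell in the fractional integral of order `1 - γ` of a step function,
evaluated at the `m`-th node. -/
def cellWeight (γ : ℝ) (t : ℕ → ℝ) (m i : ℕ) : ℝ :=
  kernelPrim γ (t m - t i) - kernelPrim γ (t m - t (i + 1))

/-- The fractional integral of order `1 - γ` at the `m`-th node of the step function with
values `w`. -/
def stepIntegral (γ : ℝ) (t w : ℕ → ℝ) (m : ℕ) : ℝ :=
  ∑ i ∈ Finset.range m, w i * cellWeight γ t m i

section Stability

variable {γ : ℝ} {t : ℕ → ℝ}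

theorem cellWeight_nonneg (hγ : γ < 1) (ht : StrictMono t) (m i : ℕ) :
    0 ≤ cellWeight γ t m i := by
  have : t i < t (i + 1) := ht (Nat.lt_succ_self i)
  exact sub_nonneg.2 (monotone_kernelPrim hγ (by linarith))

/-- The memory of a past cell fades as the node advances, by concavity of the primitive. The current
cell `i = j` has to be excluded: its weight jumps up from zero. -/
theorem cellWeight_succ_le (hγ₀ : 0 < γ) (hγ : γ < 1) (ht : StrictMono t) {j i : ℕ} (hij : i < j) :
    cellWeight γ t (j + 1) i ≤ cellWeight γ t j i := by
  have h1 : t (i + 1) ≤ t j := ht.monotone hij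
  have h2 : t i < t (i + 1) := ht (Nat.lt_succ_self i)
  have h3 : t j < t (j + 1) := ht (Nat.lt_succ_self j)
  have := ConcaveOn.increment_le (concaveOn_kernelPrim hγ₀ hγ) (x := t j - t (i + 1))
    (y := t (j + 1) - t (i + 1)) (d := t (i + 1) - t i) (by linarith) (by linarith) (by linarith)
  simpa [cellWeight] using this

theorem sum_cellWeight (m n : ℕ) :
    ∑ i ∈ Finset.range n, cellWeight γ t m i
      = kernelPrim γ (t m - t 0) - kernelPrim γ (t m - t n) :=
  Finset.sum_range_sub' (fun i => kernelPrim γ (t m - t i)) n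

/-- Discrete form of `v D^γ v ≥ D^γ (v²) / 2`. The weights of past cells have nonpositive
increments, so multiplying `w i * w j ≤ (w i ^ 2 + w j ^ 2) / 2` by them reverses it; the row sums
of the weights telescope to values of the primitive. -/
theorem stepIntegral_mul_self_ge (hγ₀ : 0 < γ) (hγ : γ < 1) (ht : StrictMono t) (ht0 : t 0 = 0)
    (w : ℕ → ℝ) (j : ℕ) :
    (w j ^ 2 * (kernelPrim γ (t (j + 1)) - kernelPrim γ (t j))
      + (stepIntegral γ t (fun i => w i ^ 2) (j + 1) - stepIntegral γ t (fun i => w i ^ 2) j)) / 2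
      ≤ w j * (stepIntegral γ t w (j + 1) - stepIntegral γ t w j) := by
  unfold stepIntegral
  have key : ∀ i ∈ Finset.range j,
      ((w i ^ 2 + w j ^ 2) * (cellWeight γ t (j + 1) i - cellWeight γ t j i)) / 2
        ≤ w j * (w i * cellWeight γ t (j + 1) i - w i * cellWeight γ t j i) := by
    intro i hi
    have := cellWeight_succ_le hγ₀ hγ ht (Finset.mem_range.1 hi)
    nlinarith [mul_nonneg (sub_nonneg.2 this) (sq_nonneg (w i - w j))]
  have hsum := Finset.sum_le_sum key
  have e1 := sum_cellWeight (γ := γ) (t := t) (j + 1) j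
  have e2 := sum_cellWeight (γ := γ) (t := t) j j
  have e3 : cellWeight γ t (j + 1) j = kernelPrim γ (t (j + 1) - t j) := by
    simp [cellWeight, kernelPrim_of_nonpos hγ le_rfl]
  rw [sub_self, kernelPrim_of_nonpos hγ le_rfl, ht0, sub_zero, sub_zero] at e2
  rw [ht0, sub_zero] at e1
  rw [← Finset.sum_div, ← Finset.mul_sum, Finset.sum_sub_distrib] at hsum
  simp only [add_mul, mul_sub, Finset.sum_add_distrib, Finset.sum_sub_distrib, ← Finset.mul_sum,
    e1, e2] at hsum
  rw [Finset.sum_range_succ, Finset.sum_range_succ, e3]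
  linarith

/-- Coercivity. In the sum over `j` the fractional integral of `w²` telescopes to its last value,
which is nonnegative and dropped; the increments of the primitive remain. -/
theorem stepIntegral_energy_ge (hγ₀ : 0 < γ) (hγ : γ < 1) (ht : StrictMono t) (ht0 : t 0 = 0)
    (w : ℕ → ℝ) (m : ℕ) :
    (2 * Real.Gamma (1 - γ))⁻¹ *
        ∑ j ∈ Finset.range m, (t (j + 1) - t j) * t (j + 1) ^ (-γ) * w j ^ 2
      ≤ ∑ j ∈ Finset.range m, w j * (stepIntegral γ t w (j + 1) - stepIntegral γ t w j) := by
  have hG := Real.Gamma_pos_of_pos (by linarith : 0 < 1 - γ)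
  have h1 := Finset.sum_le_sum fun j (_ : j ∈ Finset.range m) =>
    stepIntegral_mul_self_ge hγ₀ hγ ht ht0 w j
  rw [← Finset.sum_div, Finset.sum_add_distrib,
    Finset.sum_range_sub (fun j => stepIntegral γ t (fun i => w i ^ 2) j)] at h1
  have h2 : 0 ≤ stepIntegral γ t (fun i => w i ^ 2) m :=
    Finset.sum_nonneg fun i _ => mul_nonneg (sq_nonneg _) (cellWeight_nonneg hγ ht m i)
  have h3 : stepIntegral γ t (fun i => w i ^ 2) 0 = 0 := by simp [stepIntegral]
  have h4 : ∑ j ∈ Finset.range m, (t (j + 1) - t j) * t (j + 1) ^ (-γ) * w j ^ 2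
      / Real.Gamma (1 - γ)
      ≤ ∑ j ∈ Finset.range m, w j ^ 2 * (kernelPrim γ (t (j + 1)) - kernelPrim γ (t j)) := by
    refine Finset.sum_le_sum fun j _ => ?_
    have h0 : 0 ≤ t j := ht0 ▸ ht.monotone (Nat.zero_le j)
    have := kernelPrim_sub_ge hγ₀ hγ h0 (ht (Nat.lt_succ_self j))
    calc _ = w j ^ 2 * ((t (j + 1) - t j) * t (j + 1) ^ (-γ) / Real.Gamma (1 - γ)) := by ring
      _ ≤ _ := by gcongr
  rw [← Finset.sum_div] at h4
  rw [mul_inv]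
  have h5 : ((2:ℝ)⁻¹ * (Real.Gamma (1 - γ))⁻¹) *
        ∑ j ∈ Finset.range m, (t (j + 1) - t j) * t (j + 1) ^ (-γ) * w j ^ 2
      = (∑ j ∈ Finset.range m, (t (j + 1) - t j) * t (j + 1) ^ (-γ) * w j ^ 2)
        / Real.Gamma (1 - γ) / 2 := by field_simp
  rw [h5]
  linarith

/-- Stability of the scheme with respect to the consistency error `δ`: both with and without the
weight `lam`. -/
theorem scheme_stability (hγ₀ : 0 < γ) (hγ : γ < 1) (ht : StrictMono t) (ht0 : t 0 = 0)
    {lam : ℝ} (hlam : 0 < lam) (θ δ : ℕ → ℝ) (hθ0 : θ 0 = 0) (m : ℕ)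
    (h : ∀ j < m,
      stepIntegral γ t (fun i => (θ (i + 1) - θ i) / (t (i + 1) - t i)) (j + 1)
        - stepIntegral γ t (fun i => (θ (i + 1) - θ i) / (t (i + 1) - t i)) j
        + lam * ((t (j + 1) - t j) * (θ j + θ (j + 1)) / 2) = δ j) :
    lam * θ m ^ 2 ≤ Real.Gamma (1 - γ) *
        ∑ j ∈ Finset.range m, δ j ^ 2 * t (j + 1) ^ γ / (t (j + 1) - t j) ∧
      θ m ^ 2 ≤ (2 * Real.Gamma (1 - γ)) ^ 2 * t m ^ (1 + γ) *
        ∑ j ∈ Finset.range m, δ j ^ 2 * t (j + 1) ^ γ / (t (j + 1) - t j) := by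
  have hG := Real.Gamma_pos_of_pos (by linarith : 0 < 1 - γ)
  set w : ℕ → ℝ := fun i => (θ (i + 1) - θ i) / (t (i + 1) - t i) with hw
  have hh : ∀ j, 0 < t (j + 1) - t j := fun j => sub_pos.2 (ht (Nat.lt_succ_self j))
  have htp : ∀ j, 0 < t (j + 1) := fun j => ht0 ▸ ht (Nat.succ_pos j)
  have hwθ : ∀ j, w j * (t (j + 1) - t j) = θ (j + 1) - θ j := fun j =>
    div_mul_cancel₀ _ (hh j).ne'
  set N := ∑ j ∈ Finset.range m, (t (j + 1) - t j) * t (j + 1) ^ (-γ) * w j ^ 2 with hN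
  set E := ∑ j ∈ Finset.range m, δ j ^ 2 * t (j + 1) ^ γ / (t (j + 1) - t j) with hE
  have hN0 : 0 ≤ N := Finset.sum_nonneg fun j _ =>
    mul_nonneg (mul_nonneg (hh j).le (Real.rpow_nonneg (htp j).le _)) (sq_nonneg _)
  have hE0 : 0 ≤ E := Finset.sum_nonneg fun j _ =>
    div_nonneg (mul_nonneg (sq_nonneg _) (Real.rpow_nonneg (htp j).le _)) (hh j).le
  have hpos := stepIntegral_energy_ge hγ₀ hγ ht ht0 w m
  -- Testing with `w` turns the trapezoidal term into a difference of squares, because `w j` times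
  -- the step is `θ (j + 1) - θ j`.
  have hid : ∑ j ∈ Finset.range m, w j * (stepIntegral γ t w (j + 1) - stepIntegral γ t w j)
      + lam * (θ m ^ 2 / 2) = ∑ j ∈ Finset.range m, w j * δ j := by
    have h1 : ∑ j ∈ Finset.range m, (θ (j + 1) ^ 2 - θ j ^ 2) = θ m ^ 2 := by
      rw [Finset.sum_range_sub (fun j => θ j ^ 2), hθ0]; ring
    rw [← h1, Finset.sum_div, Finset.mul_sum, ← Finset.sum_add_distrib]
    refine Finset.sum_congr rfl fun j hj => ?_
    rw [← h j (Finset.mem_range.1 hj)]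
    have := hwθ j
    linear_combination (-(lam * (θ j + θ (j + 1)) / 2)) * this
  -- Cauchy–Schwarz with the weight of `N` and its reciprocal, which explains the weight in `E`.
  have hcs : (∑ j ∈ Finset.range m, w j * δ j) ^ 2 ≤ N * E := by
    refine Finset.sum_sq_le_sum_mul_sum_of_sq_le_mul _
      (fun j _ => mul_nonneg (mul_nonneg (hh j).le (Real.rpow_nonneg (htp j).le _)) (sq_nonneg _))
      (fun j _ => div_nonneg (mul_nonneg (sq_nonneg _) (Real.rpow_nonneg (htp j).le _)) (hh j).le)
      fun j _ => le_of_eq ?_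
    have h1 : t (j + 1) ^ (-γ) * t (j + 1) ^ γ = 1 := by
      rw [← Real.rpow_add (htp j)]; simp
    have := (hh j).ne'
    field_simp
    linear_combination (-(w j ^ 2 * δ j ^ 2)) * h1
  have hcs2 : θ m ^ 2 ≤ t m ^ (1 + γ) * N := by
    have h1 : θ m = ∑ j ∈ Finset.range m, w j * (t (j + 1) - t j) := by
      rw [Finset.sum_congr rfl fun j _ => hwθ j, Finset.sum_range_sub, hθ0, sub_zero]
    have h2 : (∑ j ∈ Finset.range m, w j * (t (j + 1) - t j)) ^ 2
        ≤ (∑ j ∈ Finset.range m, (t (j + 1) - t j) * t (j + 1) ^ γ) * N := by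
      refine Finset.sum_sq_le_sum_mul_sum_of_sq_le_mul _
        (fun j _ => mul_nonneg (hh j).le (Real.rpow_nonneg (htp j).le _))
        (fun j _ => mul_nonneg (mul_nonneg (hh j).le (Real.rpow_nonneg (htp j).le _))
          (sq_nonneg _)) fun j _ => le_of_eq ?_
      have h1 : t (j + 1) ^ (-γ) * t (j + 1) ^ γ = 1 := by
        rw [← Real.rpow_add (htp j)]; simp
      linear_combination (-(w j ^ 2 * (t (j + 1) - t j) ^ 2)) * h1
    have h3 : ∑ j ∈ Finset.range m, (t (j + 1) - t j) * t (j + 1) ^ γ ≤ t m ^ (1 + γ) := by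
      rcases Nat.eq_zero_or_pos m with rfl | hm
      · simpa using Real.rpow_nonneg (ht0 ▸ le_rfl : 0 ≤ t 0) _
      have htm : 0 < t m := ht0 ▸ ht hm
      calc _ ≤ ∑ j ∈ Finset.range m, (t (j + 1) - t j) * t m ^ γ := by
            refine Finset.sum_le_sum fun j hj => ?_
            have : t (j + 1) ≤ t m := ht.monotone (Finset.mem_range.1 hj)
            have := htp j
            have := (hh j).le
            gcongr
        _ = t m ^ (1 + γ) := by
            rw [← Finset.sum_mul, Finset.sum_range_sub, ht0, sub_zero, Real.rpow_add htm,
              Real.rpow_one]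
    rw [h1]
    exact h2.trans (mul_le_mul_of_nonneg_right h3 hN0)
  set S := ∑ j ∈ Finset.range m, w j * δ j
  have hlθ : 0 ≤ lam * (θ m ^ 2 / 2) := by positivity
  have hSN : (2 * Real.Gamma (1 - γ))⁻¹ * N + lam * (θ m ^ 2 / 2) ≤ S := by linarith
  have hc : (0:ℝ) < (2 * Real.Gamma (1 - γ))⁻¹ := by positivity
  have hNE : N ≤ (2 * Real.Gamma (1 - γ)) ^ 2 * E := by
    rcases eq_or_lt_of_le hN0 with h0 | h0
    · rw [← h0]; positivity
    have h1 : ((2 * Real.Gamma (1 - γ))⁻¹ * N) ^ 2 ≤ N * E :=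
      (pow_le_pow_left₀ (by positivity) (by linarith) 2).trans hcs
    have h2 : (2 * Real.Gamma (1 - γ))⁻¹ ^ 2 * N ≤ E := by
      refine le_of_mul_le_mul_right ?_ h0
      nlinarith
    rw [inv_pow, inv_mul_le_iff₀ (by positivity)] at h2
    exact h2
  constructor
  -- Young's inequality with the coercivity constant as coefficient of `N`, so that `N` cancels. The
  -- product of both coefficients is `1 / 4`, as a bound for `√(N E)` requires.
  · have h1 : S ≤ (2 * Real.Gamma (1 - γ))⁻¹ * N + Real.Gamma (1 - γ) / 2 * E := by
      refine abs_le_of_sq_le_sq' (le_trans hcs ?_) (by positivity) |>.2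
      have h2 : (2 * Real.Gamma (1 - γ))⁻¹ * (Real.Gamma (1 - γ) / 2) = 1 / 4 := by
        field_simp; norm_num
      nlinarith [sq_nonneg ((2 * Real.Gamma (1 - γ))⁻¹ * N - Real.Gamma (1 - γ) / 2 * E)]
    linarith
  · calc θ m ^ 2 ≤ t m ^ (1 + γ) * N := hcs2
      _ ≤ t m ^ (1 + γ) * ((2 * Real.Gamma (1 - γ)) ^ 2 * E) := by
          have : 0 ≤ t m := ht0 ▸ ht.monotone (Nat.zero_le m)
          gcongr
      _ = _ := by ring

end Stability

/-! ### Laplace transforms and their inversion -/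

theorem integrableOn_rpow_mul_cexp_neg_mul {a : ℝ} (ha : 0 < a) {z : ℂ} (hz : 0 < z.re) :
    IntegrableOn (fun t : ℝ => ((t ^ (a - 1) : ℝ) : ℂ) * Complex.exp (-(z * t))) (Set.Ioi 0) := by
  have h1 := integrableOn_rpow_mul_exp_neg_mul_rpow (p := 1) (s := a - 1) (b := z.re) (by linarith)
    one_pos hz
  refine (integrable_norm_iff ?_).1 ?_
  · refine ContinuousOn.aestronglyMeasurable ?_ measurableSet_Ioi
    intro t ht
    have h0 : ContinuousAt (fun t : ℝ => t ^ (a - 1)) t :=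
      Real.continuousAt_rpow_const _ _ (Or.inl (ne_of_gt ht))
    exact ((Complex.continuous_ofReal.continuousAt.comp h0).mul (by fun_prop)).continuousWithinAt
  · refine (integrableOn_congr_fun (fun t ht => ?_) measurableSet_Ioi).1 h1
    rw [norm_mul, Complex.norm_exp, Complex.norm_real, Real.norm_of_nonneg
      (Real.rpow_nonneg (le_of_lt ht) _)]
    simp

/-- Differentiation under the integral sign: on the ball of radius `z.re / 2` all exponentials decay
at least like `exp (-(z.re / 2) t)`. -/
theorem differentiableOn_laplace_rpow {a : ℝ} (ha : 0 < a) :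
    DifferentiableOn ℂ
      (fun z : ℂ => ∫ t in Set.Ioi (0:ℝ), ((t ^ (a - 1) : ℝ) : ℂ) * Complex.exp (-(z * t)))
      {z | 0 < z.re} := by
  intro z hz
  have hz' : 0 < z.re := hz
  set r := z.re / 2 with hr
  have hr0 : 0 < r := by positivity
  refine (hasDerivAt_integral_of_dominated_loc_of_deriv_le (μ := volume.restrict (Set.Ioi 0))
    (F := fun (w : ℂ) (t : ℝ) => ((t ^ (a - 1) : ℝ) : ℂ) * Complex.exp (-(w * t)))
    (F' := fun (w : ℂ) (t : ℝ) => ((t ^ (a - 1) : ℝ) : ℂ) * (Complex.exp (-(w * t)) * (-t)))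
    (bound := fun t : ℝ => t ^ (a + 1 - 1) * Real.exp (-r * t ^ (1:ℝ)))
    (Metric.ball_mem_nhds z hr0) ?_ (integrableOn_rpow_mul_cexp_neg_mul ha hz) ?_ ?_ ?_
    ?_).2.differentiableAt.differentiableWithinAt
  · filter_upwards [(isOpen_lt continuous_const Complex.continuous_re).mem_nhds hz] with w hw
    exact (integrableOn_rpow_mul_cexp_neg_mul ha hw).aestronglyMeasurable
  · have := (integrableOn_rpow_mul_cexp_neg_mul ha hz).aestronglyMeasurable.mul
      (f := fun t : ℝ => ((t ^ (a - 1) : ℝ) : ℂ) * Complex.exp (-(z * t)))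
      (g := fun t : ℝ => (-t : ℂ)) (by fun_prop)
    refine this.congr (ae_of_all _ fun t => ?_)
    simp only [Pi.mul_apply]; ring
  · refine (ae_restrict_iff' measurableSet_Ioi).2 (ae_of_all _ fun t ht w hw => ?_)
    have ht0 : 0 < t := ht
    have hwr : r ≤ w.re := by
      have h1 := Complex.abs_re_le_norm (w - z)
      have h2 : ‖w - z‖ < r := by simpa [dist_eq_norm] using hw
      have h3 := (abs_le.1 (h1.trans h2.le)).1
      simp only [Complex.sub_re] at h3
      linarith
    rw [norm_mul, norm_mul, Complex.norm_exp, Complex.norm_real, norm_neg, Complex.norm_real,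
      Real.norm_of_nonneg (Real.rpow_nonneg ht0.le _), Real.norm_of_nonneg ht0.le,
      Real.rpow_one, show a + 1 - 1 = (a - 1) + 1 by ring, Real.rpow_add_one ht0.ne']
    have : Real.exp (-(w * t)).re ≤ Real.exp (-r * t) := by
      refine Real.exp_le_exp.2 ?_
      simp; nlinarith
    calc _ ≤ t ^ (a - 1) * (Real.exp (-r * t) * t) := by gcongr
      _ = _ := by ring
  · exact integrableOn_rpow_mul_exp_neg_mul_rpow (by linarith) one_pos hr0
  · refine ae_of_all _ fun t w _ => ?_
    have h1 : HasDerivAt (fun w : ℂ => -(w * t)) (-t : ℂ) w := by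
      exact ((hasDerivAt_id w).mul_const (t : ℂ)).neg.congr_deriv (by simp)
    exact h1.cexp.const_mul _

/-- Both sides are analytic in the half plane and agree on the positive reals by the Gamma integral.
The identity theorem is applied at the points `1 + 1 / (n + 1)`, which accumulate at `1`. -/
theorem laplace_rpow {a : ℝ} (ha : 0 < a) {z : ℂ} (hz : 0 < z.re) :
    ∫ t in Set.Ioi (0:ℝ), ((t ^ (a - 1) : ℝ) : ℂ) * Complex.exp (-(z * t))
      = z ^ (-(a : ℂ)) * Real.Gamma a := by
  have hopen : IsOpen {z : ℂ | 0 < z.re} := isOpen_lt continuous_const Complex.continuous_re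
  have hg : DifferentiableOn ℂ (fun z : ℂ => z ^ (-(a : ℂ)) * Real.Gamma a) {z | 0 < z.re} := by
    intro z hz
    have : z ∈ Complex.slitPlane := Or.inl hz
    exact ((differentiableAt_id.cpow_const this).mul_const _).differentiableWithinAt
  refine ((differentiableOn_laplace_rpow ha).analyticOnNhd hopen).eqOn_of_preconnected_of_frequently_eq
    (hg.analyticOnNhd hopen) (convex_halfSpace_re_gt 0).isPreconnected
    (z₀ := 1) (by simp) ?_ hz
  have hfreq : Tendsto (fun n : ℕ => (1 + 1 / ((n:ℂ) + 1) : ℂ)) atTop (𝓝[≠] 1) := by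
    refine tendsto_nhdsWithin_iff.2 ⟨?_, Eventually.of_forall fun n => ?_⟩
    · simpa using (tendsto_one_div_add_atTop_nhds_zero_nat (𝕜 := ℂ)).const_add 1
    · have : (n:ℂ) + 1 ≠ 0 := Nat.cast_add_one_ne_zero n
      simp [this]
  refine hfreq.frequently (Frequently.of_forall fun n => ?_)
  have hr : (0:ℝ) < 1 + 1 / (n + 1) := by positivity
  have := Real.integral_rpow_mul_exp_neg_mul_Ioi ha hr
  have e : (1 + 1 / ((n:ℂ) + 1)) = ((1 + 1 / ((n:ℝ) + 1) : ℝ) : ℂ) := by push_cast; ring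
  rw [e]
  set r : ℝ := 1 + 1 / (n + 1)
  have h2 : ∫ t in Set.Ioi (0:ℝ), ((t ^ (a - 1) : ℝ) : ℂ) * Complex.exp (-(r * t))
      = ((∫ t in Set.Ioi (0:ℝ), t ^ (a - 1) * Real.exp (-(r * t)) : ℝ) : ℂ) := by
    rw [← integral_complex_ofReal]
    refine integral_congr_ae (ae_of_all _ fun t => ?_)
    push_cast; rfl
  rw [h2, this, one_div, Real.inv_rpow hr.le, ← Real.rpow_neg hr.le]
  push_cast
  rw [Complex.ofReal_cpow hr.le]
  push_cast; rfl

/-- By Tonelli the sum of the norms has a finite integral, so it is finite almost everywhere and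
dominates the series. Fourier inversion needs this integrability besides the value of the transform.
-/
theorem integrable_tsum_of_summable_integral_norm {ι α E : Type*} [Countable ι]
    {m : MeasurableSpace α} {μ : Measure α} [NormedAddCommGroup E] [NormedSpace ℝ E]
    [CompleteSpace E] {F : ι → α → E} (hF : ∀ i, Integrable (F i) μ)
    (hs : Summable fun i => ∫ a, ‖F i a‖ ∂μ) : Integrable (fun a => ∑' i, F i a) μ := by
  have hlin : ∀ i, ∫⁻ a, ‖F i a‖ₑ ∂μ = ENNReal.ofReal (∫ a, ‖F i a‖ ∂μ) := fun i =>
    (ofReal_integral_norm_eq_lintegral_enorm (hF i)).symm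
  have htot : ∫⁻ a, ∑' i, ‖F i a‖ₑ ∂μ < ⊤ := by
    rw [lintegral_tsum fun i => (hF i).1.enorm]
    simp only [hlin]
    rw [← ENNReal.ofReal_tsum_of_nonneg (fun i => integral_nonneg fun a => norm_nonneg _) hs]
    exact ENNReal.ofReal_lt_top
  have hae : ∀ᵐ a ∂μ, ∑' i, ‖F i a‖ₑ < ⊤ :=
    ae_lt_top' (AEMeasurable.tsum fun i => (hF i).1.enorm) htot.ne
  have hsum : ∀ᵐ a ∂μ, Summable fun i => ‖F i a‖ := by
    filter_upwards [hae] with a ha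
    have := ENNReal.tsum_coe_ne_top_iff_summable.1 ha.ne
    exact NNReal.summable_coe.2 this
  refine ⟨?_, ?_⟩
  · refine aestronglyMeasurable_of_tendsto_ae (u := (atTop : Filter (Finset ι)))
      (f := fun s a => ∑ i ∈ s, F i a)
      (fun s => Finset.aestronglyMeasurable_fun_sum s fun i _ => (hF i).1) ?_
    filter_upwards [hsum] with a ha
    exact ha.of_norm.hasSum
  · refine lt_of_le_of_lt (lintegral_mono_ae ?_) htot
    filter_upwards [hsum] with a ha
    exact enorm_tsum_le_tsum_enorm

/-- Termwise Laplace transform of a generalized power series. -/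
theorem laplace_tsum_rpow (c b : ℕ → ℝ) (hb : ∀ n, 0 ≤ b n) {x : ℝ} (hx : 0 < x)
    (hs : Summable fun n => |c n| * x ^ (-(b n + 1))) :
    IntegrableOn (fun t : ℝ => ((∑' n, c n * t ^ b n / Real.Gamma (b n + 1) : ℝ) : ℂ)
        * Complex.exp (-(x * t))) (Set.Ioi 0) ∧
      ∀ z : ℂ, z.re = x →
        ∫ t in Set.Ioi (0:ℝ), ((∑' n, c n * t ^ b n / Real.Gamma (b n + 1) : ℝ) : ℂ)
          * Complex.exp (-(z * t)) = ∑' n, c n * z ^ (-((b n + 1 : ℝ) : ℂ)) := by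
  have hG : ∀ n, 0 < Real.Gamma (b n + 1) := fun n =>
    Real.Gamma_pos_of_pos (by linarith [hb n])
  set F : ℂ → ℕ → ℝ → ℂ := fun z n t => ((c n / Real.Gamma (b n + 1) : ℝ) : ℂ) *
    (((t ^ (b n + 1 - 1) : ℝ) : ℂ) * Complex.exp (-(z * t))) with hF
  have hsum : ∀ z t, ∑' n, F z n t = ((∑' n, c n * t ^ b n / Real.Gamma (b n + 1) : ℝ) : ℂ)
        * Complex.exp (-(z * t)) := by
    intro z t
    rw [Complex.ofReal_tsum, ← tsum_mul_right]
    refine tsum_congr fun n => ?_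
    simp only [hF]
    rw [add_sub_cancel_right]
    push_cast; ring
  have hint : ∀ z : ℂ, z.re = x → ∀ n, Integrable (F z n) (volume.restrict (Set.Ioi 0)) :=
    fun z hz n => (integrableOn_rpow_mul_cexp_neg_mul (by linarith [hb n])
      (by rw [hz]; exact hx)).const_mul _
  have hnorm : ∀ z : ℂ, z.re = x → Summable fun n => ∫ t in Set.Ioi (0:ℝ), ‖F z n t‖ := by
    intro z hz
    refine hs.congr fun n => ?_
    have h1 : ∫ t in Set.Ioi (0:ℝ), ‖F z n t‖ = ∫ t in Set.Ioi (0:ℝ),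
        |c n| / Real.Gamma (b n + 1) * (t ^ (b n + 1 - 1) * Real.exp (-(x * t))) := by
      refine setIntegral_congr_fun measurableSet_Ioi fun t ht => ?_
      simp only [hF]
      rw [norm_mul, norm_mul, Complex.norm_exp, Complex.norm_real, Complex.norm_real,
        Real.norm_of_nonneg (Real.rpow_nonneg (le_of_lt ht) _), Real.norm_eq_abs, abs_div,
        abs_of_pos (hG n)]
      simp [hz]
    rw [h1, integral_const_mul, Real.integral_rpow_mul_exp_neg_mul_Ioi (by linarith [hb n]) hx,
      one_div, Real.inv_rpow hx.le, ← Real.rpow_neg hx.le]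
    have := (hG n).ne'
    field_simp
  refine ⟨?_, fun z hz => ?_⟩
  · have := integrable_tsum_of_summable_integral_norm (hint x (by simp)) (hnorm x (by simp))
    exact this.congr (ae_of_all _ fun t => hsum x t)
  · have := hasSum_integral_of_summable_integral_norm (hint z hz) (hnorm z hz)
    simp only [hsum] at this
    rw [← this.tsum_eq]
    refine tsum_congr fun n => ?_
    simp only [hF]
    rw [integral_const_mul, laplace_rpow (by linarith [hb n]) (by rw [hz]; exact hx)]
    have : (Real.Gamma (b n + 1) : ℂ) ≠ 0 := by exact_mod_cast (hG n).ne'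
    push_cast
    field_simp

/-- Shifting the vertical line of integration. -/
theorem integral_vertical_line_eq {G : ℂ → ℂ} {M c d : ℝ} (hc : 0 < c) (hcd : c ≤ d)
    (hG : DifferentiableOn ℂ G {z | 0 < z.re})
    (hM : ∀ z : ℂ, c ≤ z.re → z.re ≤ d → ‖G z‖ ≤ M * (1 + z.im ^ 2)⁻¹) :
    ∫ y : ℝ, G (d + y * Complex.I) = ∫ y : ℝ, G (c + y * Complex.I) := by
  have hcont : ∀ x : ℝ, 0 < x → Continuous fun y : ℝ => G (x + y * Complex.I) := by
    intro x hx
    refine hG.continuousOn.comp_continuous (by fun_prop) fun y => ?_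
    simpa using hx
  have hint : ∀ x : ℝ, c ≤ x → x ≤ d → Integrable fun y : ℝ => G (x + y * Complex.I) := by
    intro x hx hxd
    refine (integrable_inv_one_add_sq.const_mul M).mono'
      (hcont x (hc.trans_le hx)).aestronglyMeasurable (ae_of_all _ fun y => ?_)
    simpa using hM (x + y * Complex.I) (by simpa using hx) (by simpa using hxd)
  have hlim : ∀ x : ℝ, c ≤ x → x ≤ d →
      Tendsto (fun N : ℕ => ∫ y in (-(N:ℝ))..N, G (x + y * Complex.I)) atTop
        (𝓝 (∫ y : ℝ, G (x + y * Complex.I))) := fun x hx hxd =>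
    intervalIntegral_tendsto_integral (hint x hx hxd)
      (tendsto_neg_atBot_iff.2 tendsto_natCast_atTop_atTop) tendsto_natCast_atTop_atTop
  -- The two horizontal edges of the rectangle lie at heights `±N`, where the integrand is at most
  -- `M / (1 + N²)`.
  have hedge : Tendsto (fun N : ℕ => 2 * (|M| * (1 + (N:ℝ) ^ 2)⁻¹ * |d - c|)) atTop (𝓝 0) := by
    have h1 : Tendsto (fun N : ℕ => (1 + (N:ℝ) ^ 2)⁻¹) atTop (𝓝 0) :=
      tendsto_inv_atTop_zero.comp (tendsto_atTop_add_const_left _ _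
        ((tendsto_pow_atTop two_ne_zero).comp tendsto_natCast_atTop_atTop))
    have h2 := ((h1.const_mul |M|).mul_const |d - c|).const_mul 2
    simpa using h2
  have hdiff := (hlim d hcd le_rfl).sub (hlim c le_rfl hcd)
  have hzero : Tendsto (fun N : ℕ => (∫ y in (-(N:ℝ))..N, G (d + y * Complex.I))
      - ∫ y in (-(N:ℝ))..N, G (c + y * Complex.I)) atTop (𝓝 0) := by
    refine squeeze_zero_norm (fun N => ?_) hedge
    have hrect := Complex.integral_boundary_rect_eq_zero_of_differentiableOn G
      ((c:ℂ) + (-(N:ℝ) : ℝ) * Complex.I) ((d:ℂ) + (N:ℝ) * Complex.I) (hG.mono ?_)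
    · simp only [Complex.add_re, Complex.ofReal_re, Complex.mul_re, Complex.I_re, mul_zero,
        Complex.ofReal_im, Complex.I_im, mul_one, sub_self, add_zero, Complex.add_im,
        Complex.mul_im, zero_add] at hrect
      have hb : ∀ s : ℝ, |s| = N → ‖∫ x in c..d, G (x + s * Complex.I)‖
          ≤ |M| * (1 + (N:ℝ) ^ 2)⁻¹ * |d - c| := by
        intro s hs
        refine intervalIntegral.norm_integral_le_of_norm_le_const fun x hx => ?_
        rw [Set.uIoc_of_le hcd] at hx
        have := hM (x + s * Complex.I) (by simpa using hx.1.le) (by simpa using hx.2)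
        have hs2 : s ^ 2 = (N:ℝ) ^ 2 := by rw [← sq_abs, hs]
        simp only [Complex.add_im, Complex.ofReal_im, Complex.mul_im, Complex.ofReal_re,
          Complex.I_im, mul_one, Complex.I_re, mul_zero, add_zero, zero_add, hs2] at this
        refine this.trans ?_
        gcongr
        exact le_abs_self M
      have h1 := hb (-(N:ℝ)) (by simp)
      have h2 := hb N (by simp)
      set A := ∫ x in c..d, G (x + (-(N:ℝ) : ℝ) * Complex.I)
      set B := ∫ x in c..d, G (x + (N:ℝ) * Complex.I)
      set D := ∫ y in (-(N:ℝ))..N, G (d + y * Complex.I)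
      set E := ∫ y in (-(N:ℝ))..N, G (c + y * Complex.I)
      have h3 : D - E = Complex.I * (A - B) := by
        have : Complex.I * (A - B + Complex.I • D - Complex.I • E) = 0 := by
          rw [hrect, mul_zero]
        simp only [smul_eq_mul] at this
        linear_combination -this + (D - E) * Complex.I_mul_I
      rw [h3, norm_mul, Complex.norm_I, one_mul]
      linarith [norm_sub_le A B]
    · intro z hz
      have := hz.1
      simp only [Set.mem_preimage, Complex.add_re, Complex.ofReal_re, Complex.mul_re,
        Complex.I_re, mul_zero, Complex.ofReal_im, Complex.I_im, mul_one, sub_self,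
        add_zero, Set.uIcc_of_le hcd] at this
      exact hc.trans_le this.1
  exact sub_eq_zero.1 (tendsto_nhds_unique hdiff hzero)

/-- A function whose Laplace transform extends to the right half plane with quadratic decay,
uniformly up to the imaginary axis, is bounded. -/
theorem abs_le_of_laplace {f : ℝ → ℝ} {F : ℂ → ℂ} {M : ℝ} (hf : ContinuousOn f (Set.Ioi 0))
    (hint : IntegrableOn (fun t : ℝ => (f t : ℂ) * Complex.exp (-((2:ℝ) * t))) (Set.Ioi 0))
    (hL : ∀ z : ℂ, z.re = 2 →
      ∫ t in Set.Ioi (0:ℝ), (f t : ℂ) * Complex.exp (-(z * t)) = F z)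
    (hF : DifferentiableOn ℂ F {z | 0 < z.re})
    (hM : ∀ z : ℂ, 0 < z.re → z.re ≤ 2 → ‖F z‖ ≤ M * (1 + z.im ^ 2)⁻¹)
    {t : ℝ} (ht : 0 < t) : |f t| ≤ M := by
  have hM0 : 0 ≤ M := by
    have := (norm_nonneg _).trans (hM 1 (by simp) (by norm_num))
    simpa using this
  set g : ℝ → ℂ := Set.indicator (Set.Ioi 0)
    (fun t : ℝ => (f t : ℂ) * Complex.exp (-((2:ℝ) * t))) with hg
  have hgint : Integrable g := (integrable_indicator_iff measurableSet_Ioi).2 hint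
  -- The Fourier transform of `f(t) exp(-2t)` on the half line is the Laplace transform on the line
  -- `Re z = 2`.
  have hfour : ∀ w : ℝ, FourierTransform.fourier g w = F (2 + (2 * Real.pi * w : ℝ) * Complex.I) := by
    intro w
    rw [Real.fourier_eq, ← hL _ (by simp), ← integral_indicator measurableSet_Ioi]
    refine integral_congr_ae (ae_of_all _ fun v => ?_)
    simp only [hg, Set.indicator]
    split_ifs with hv
    · rw [Circle.smul_def, Real.fourierChar_apply, smul_eq_mul, mul_left_comm, ← Complex.exp_add]
      congr 2
      simp only [RCLike.inner_apply, conj_trivial]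
      push_cast
      ring
    · simp
  have hline : Continuous fun y : ℝ => F (2 + y * Complex.I) := by
    refine hF.continuousOn.comp_continuous (by fun_prop) fun y => ?_
    simp
  have hlint : Integrable fun y : ℝ => F (2 + y * Complex.I) := by
    refine (integrable_inv_one_add_sq.const_mul M).mono'
      hline.aestronglyMeasurable (ae_of_all _ fun y => ?_)
    simpa using hM (2 + y * Complex.I) (by simp) (by simp)
  have hfint : Integrable (FourierTransform.fourier g) := by
    have h1 : FourierTransform.fourier g
        = fun w : ℝ => (fun y : ℝ => F (2 + y * Complex.I)) (2 * Real.pi * w) := by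
      ext w; rw [hfour]
    rw [h1]
    exact hlint.comp_mul_left' (by positivity)
  have hct : ContinuousAt g t := by
    have h1 : ContinuousAt (fun t : ℝ => (f t : ℂ) * Complex.exp (-((2:ℝ) * t))) t :=
      (Complex.continuous_ofReal.continuousAt.comp
        (hf.continuousAt (Ioi_mem_nhds ht))).mul (by fun_prop)
    refine h1.congr ?_
    filter_upwards [Ioi_mem_nhds ht] with s hs
    simp only [hg]
    rw [Set.indicator_of_mem hs]
  have hinv := hgint.fourierInv_fourier_eq hfint hct
  rw [Real.fourierInv_eq] at hinv
  have hrep : (f t : ℂ) = (2 * Real.pi : ℝ)⁻¹ *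
      ∫ y : ℝ, Complex.exp ((2 + y * Complex.I) * t) * F (2 + y * Complex.I) := by
    have h1 : g t = (f t : ℂ) * Complex.exp (-((2:ℝ) * t)) := by
      simp only [hg]; rw [Set.indicator_of_mem (Set.mem_Ioi.2 ht)]
    have h2 : (f t : ℂ) = Complex.exp ((2:ℝ) * t) * g t := by
      rw [h1, mul_left_comm, ← Complex.exp_add]; simp
    rw [h2, ← hinv, ← integral_const_mul]
    have h3 := Measure.integral_comp_mul_left
      (fun y : ℝ => Complex.exp ((2 + y * Complex.I) * t) * F (2 + y * Complex.I)) (2 * Real.pi)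
    rw [abs_of_pos (by positivity), Complex.real_smul] at h3
    rw [← h3]
    refine integral_congr_ae (ae_of_all _ fun w => ?_)
    simp only [hfour]
    rw [Circle.smul_def, Real.fourierChar_apply, smul_eq_mul, ← mul_assoc, ← Complex.exp_add]
    congr 2
    simp only [RCLike.inner_apply, conj_trivial]
    push_cast
    ring
  -- Moving the line of integration to `Re z = c` lowers the growth factor to `exp (c t)`, which
  -- tends to `1` with `c → 0`. The integral of `1 / (1 + y²)` is `π`, so the prefactor even leaves
  -- a factor `1 / 2`.
  have hbound : ∀ c : ℝ, 0 < c → c ≤ 2 → |f t| ≤ Real.exp (c * t) * M := by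
    intro c hc hc2
    have hGn : ∀ z : ℂ, ‖Complex.exp (z * t) * F z‖ = Real.exp (z.re * t) * ‖F z‖ := by
      intro z
      rw [norm_mul, Complex.norm_exp]
      simp
    have hshift := integral_vertical_line_eq (G := fun z => Complex.exp (z * t) * F z)
      (M := Real.exp (2 * t) * M) hc hc2
      (DifferentiableOn.mul (by fun_prop) hF) (fun z hz1 hz2 => by
        rw [hGn, mul_assoc]
        gcongr
        exact hM z (hc.trans_le hz1) hz2)
    have h1 : ‖∫ y : ℝ, Complex.exp ((c + y * Complex.I) * t) * F (c + y * Complex.I)‖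
        ≤ ∫ y : ℝ, Real.exp (c * t) * M * (1 + y ^ 2)⁻¹ := by
      refine norm_integral_le_of_norm_le (integrable_inv_one_add_sq.const_mul _)
        (ae_of_all _ fun y => ?_)
      have h2 := hM (c + y * Complex.I) (by simpa using hc) (by simpa using hc2)
      rw [hGn, mul_assoc]
      simp only [Complex.add_re, Complex.ofReal_re, Complex.mul_re, Complex.I_re, mul_zero,
        Complex.ofReal_im, Complex.I_im, mul_one, sub_self, add_zero, Complex.add_im,
        Complex.mul_im, zero_add] at h2 ⊢
      gcongr
    rw [integral_const_mul, integral_univ_inv_one_add_sq] at h1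
    have h3 : |f t| = ‖(f t : ℂ)‖ := by simp
    rw [h3, hrep]
    simp only [Complex.ofReal_ofNat] at hshift
    rw [hshift, norm_mul, Complex.norm_real, Real.norm_of_nonneg (by positivity)]
    calc _ ≤ (2 * Real.pi)⁻¹ * (Real.exp (c * t) * M * Real.pi) := by gcongr
      _ = Real.exp (c * t) * M / 2 := by field_simp
      _ ≤ _ := by
        have : 0 ≤ Real.exp (c * t) * M := by positivity
        linarith
  have hlim : Tendsto (fun c : ℝ => Real.exp (c * t) * M) (𝓝[>] 0) (𝓝 M) := by
    have : Tendsto (fun c : ℝ => Real.exp (c * t) * M) (𝓝 0) (𝓝 (Real.exp (0 * t) * M)) :=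
      Continuous.tendsto (by fun_prop) 0
    simp only [zero_mul, Real.exp_zero, one_mul] at this
    exact this.mono_left nhdsWithin_le_nhds
  refine ge_of_tendsto hlim ?_
  filter_upwards [Ioc_mem_nhdsGT (show (0:ℝ) < 2 by norm_num)] with c hc
  exact hbound c hc.1 hc.2

/-! ### Mittag-Leffler functions -/

/-- The function `∑ₖ (kα)^j x^k / Γ(kα+1)`, obtained from `E_{α,1}` by applying `j` times the
operator `α x d/dx`. -/
def mlEuler (α : ℝ) (j : ℕ) (x : ℝ) : ℝ :=
  ∑' k : ℕ, (k * α) ^ j * x ^ k / Real.Gamma (k * α + 1)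

theorem mlEuler_zero (α x : ℝ) : mlEuler α 0 x = mittagLeffler α 1 x := by
  simp [mlEuler, mittagLeffler]

section

variable {α : ℝ}

theorem Gamma_natCast_mul_add_one_pos (hα : 0 ≤ α) (k : ℕ) : 0 < Real.Gamma (k * α + 1) :=
  Real.Gamma_pos_of_pos (by positivity)

theorem factorial_le_Gamma (hα : 1 ≤ α) (k : ℕ) :
    (k.factorial : ℝ) ≤ Real.Gamma (k * α + 1) := by
  rcases Nat.eq_zero_or_pos k with rfl | hk
  · simp
  have hk1 : (1:ℝ) ≤ k := by exact_mod_cast hk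
  rw [← Real.Gamma_nat_eq_factorial]
  have h : (k:ℝ) + 1 ≤ k * α + 1 := by nlinarith
  exact Real.Gamma_strictMonoOn_Ici.monotoneOn (Set.mem_Ici.2 (by linarith))
    (Set.mem_Ici.2 (by linarith)) h

theorem summable_mlEuler (hα : 1 ≤ α) (j : ℕ) (x : ℝ) :
    Summable fun k : ℕ => (k * α) ^ j * |x| ^ k / Real.Gamma (k * α + 1) := by
  have h0 : 0 ≤ α := by linarith
  have hs := (Real.summable_pow_div_factorial (Real.exp α * |x|)).mul_left (j.factorial : ℝ)
  refine hs.of_nonneg_of_le (fun k => ?_) fun k => ?_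
  · have := Gamma_natCast_mul_add_one_pos h0 k
    positivity
  · have h1 : ((k:ℝ) * α) ^ j ≤ j.factorial * Real.exp α ^ k := by
      have := Real.pow_div_factorial_le_exp (k * α) (by positivity) j
      rw [div_le_iff₀ (by positivity), Real.exp_nat_mul] at this
      linarith
    have h2 := factorial_le_Gamma hα k
    have h3 : (0:ℝ) < k.factorial := by positivity
    calc ((k:ℝ) * α) ^ j * |x| ^ k / Real.Gamma (k * α + 1)
        ≤ (j.factorial * Real.exp α ^ k) * |x| ^ k / k.factorial := by gcongr
      _ = _ := by rw [mul_pow]; ring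

theorem summable_mlEuler' (hα : 1 ≤ α) (j : ℕ) (x : ℝ) :
    Summable fun k : ℕ => (k * α) ^ j * x ^ k / Real.Gamma (k * α + 1) := by
  refine Summable.of_norm ((summable_mlEuler hα j x).congr fun k => ?_)
  have := Gamma_natCast_mul_add_one_pos (by linarith : 0 ≤ α) k
  rw [norm_div, norm_mul, norm_pow, norm_pow, Real.norm_eq_abs, Real.norm_eq_abs,
    Real.norm_of_nonneg this.le, abs_of_nonneg (by positivity : 0 ≤ (k:ℝ) * α)]

/-- The derivative itself has no role of its own: only its multiple by `α x` is again one of these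
functions. Termwise differentiation is dominated on `|y| < |x| + 1` by the series for `j + 1`. -/
theorem hasDerivAt_mlEuler (hα : 1 ≤ α) (j : ℕ) (x : ℝ) :
    ∃ d : ℝ, HasDerivAt (mlEuler α j) d x ∧ α * x * d = mlEuler α (j + 1) x := by
  have h0 : 0 < α := by linarith
  set R := |x| + 1 with hR
  have hR0 : 0 < R := by positivity
  set d : ℕ → ℝ → ℝ := fun k y => (k * α) ^ j * (k * y ^ (k - 1)) / Real.Gamma (k * α + 1)
  have hu : Summable fun k : ℕ =>
      (α * R)⁻¹ * ((k * α) ^ (j + 1) * |R| ^ k / Real.Gamma (k * α + 1)) :=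
    (summable_mlEuler hα (j + 1) R).mul_left _
  refine ⟨∑' k, d k x, ?_, ?_⟩
  · refine hasDerivAt_tsum_of_isPreconnected hu (t := Set.Ioo (-R) R) isOpen_Ioo
      isPreconnected_Ioo (y₀ := x) (fun k y _ => ?_) (fun k y hy => ?_) ?_
      (summable_mlEuler' hα j x) ?_
    · exact ((hasDerivAt_pow k y).const_mul _).div_const _
    · have hG := Gamma_natCast_mul_add_one_pos h0.le k
      have hyR : |y| ≤ R := (abs_lt.2 hy).le
      simp only [d]
      rw [norm_div, norm_mul, norm_mul, norm_pow, norm_pow, Real.norm_of_nonneg hG.le,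
        Real.norm_of_nonneg (by positivity : 0 ≤ (k:ℝ) * α), Real.norm_natCast, Real.norm_eq_abs,
        abs_of_pos hR0]
      rcases Nat.eq_zero_or_pos k with rfl | hk
      · simp
      have h1 : |y| ^ (k - 1) ≤ R ^ (k - 1) := pow_le_pow_left₀ (abs_nonneg y) hyR _
      have h2 : R ^ k = R * R ^ (k - 1) := by
        rw [← pow_succ', Nat.sub_add_cancel hk]
      calc _ ≤ (k * α) ^ j * (k * R ^ (k - 1)) / Real.Gamma (k * α + 1) := by gcongr
        _ = _ := by
          rw [h2, pow_succ]
          field_simp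
    · rw [hR, Set.mem_Ioo]
      constructor <;> linarith [neg_abs_le x, le_abs_self x]
    · rw [hR, Set.mem_Ioo]
      constructor <;> linarith [neg_abs_le x, le_abs_self x]
  · rw [← tsum_mul_left, mlEuler]
    refine tsum_congr fun k => ?_
    simp only [d]
    rcases Nat.eq_zero_or_pos k with rfl | hk
    · simp
    have h2 : x ^ k = x * x ^ (k - 1) := by rw [← pow_succ', Nat.sub_add_cancel hk]
    rw [h2, pow_succ]
    ring

theorem continuous_mlEuler (hα : 1 ≤ α) (j : ℕ) : Continuous (mlEuler α j) :=
  continuous_iff_continuousAt.2 fun x =>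
    (hasDerivAt_mlEuler hα j x).choose_spec.1.continuousAt

/-- Along `x = -lam t^α` the operator `α x d/dx` becomes `t d/dt`; all time derivatives of the
solution thus reduce to `mlEuler`. -/
theorem hasDerivAt_mlEuler_comp (hα : 1 ≤ α) (j : ℕ) (lam : ℝ) {t : ℝ} (ht : 0 < t) :
    HasDerivAt (fun t => mlEuler α j (-lam * t ^ α)) (mlEuler α (j + 1) (-lam * t ^ α) / t) t := by
  obtain ⟨d, hd, he⟩ := hasDerivAt_mlEuler hα j (-lam * t ^ α)
  have h1 : HasDerivAt (fun t : ℝ => -lam * t ^ α) (-lam * (α * t ^ (α - 1))) t :=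
    (Real.hasDerivAt_rpow_const (Or.inl ht.ne')).const_mul _
  refine (hd.comp t h1).congr_deriv ?_
  rw [← he, Real.rpow_sub_one ht.ne']
  field_simp

/-- The Laplace transform of the derivatives of `E_{α,1}(-t^α)` in the half plane. -/
def mlSymbol (α : ℝ) (i : ℕ) (z : ℂ) : ℂ :=
  -(z ^ (-((α + 1 : ℝ) : ℂ)) / (1 + z ^ (-(α : ℂ))) ^ (i + 1))

/-- In the right half plane the argument of `z^(-α)` is at most `α π / 2 < π` in modulus. With `r =
|z|^(-α)` and `c = cos (α π / 2)` this gives `|1 + z^(-α)|² ≥ 1 + 2 c r + r²`, which exceeds the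
left side by exactly `(1 - c) (1 - r)² / 2`. -/
theorem norm_one_add_cpow_ge (hα₁ : 0 ≤ α) (hα₂ : α < 2) {z : ℂ} (hz : 0 < z.re) :
    (1 + Real.cos (α * (Real.pi / 2))) / 2 * (1 + ‖z‖ ^ (-α)) ^ 2 ≤ ‖1 + z ^ (-(α : ℂ))‖ ^ 2 := by
  have hz0 : z ≠ 0 := by rintro rfl; simp at hz
  have hn : ‖z ^ (-(α : ℂ))‖ = ‖z‖ ^ (-α) := by
    have := Complex.norm_cpow_real z (-α)
    push_cast at this
    exact this
  have hre : (z ^ (-(α : ℂ))).re = ‖z‖ ^ (-α) * Real.cos (α * |z.arg|) := by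
    have := Complex.cpow_ofReal_re z (-α)
    push_cast at this
    rw [this, ← Real.cos_abs, abs_mul, abs_neg, abs_of_nonneg hα₁, mul_comm |z.arg|]
  have harg : |z.arg| ≤ Real.pi / 2 := Complex.abs_arg_le_pi_div_two_iff.2 hz.le
  have hcos : Real.cos (α * (Real.pi / 2)) ≤ Real.cos (α * |z.arg|) := by
    refine Real.cos_le_cos_of_nonneg_of_le_pi (by positivity) ?_ (by gcongr)
    nlinarith [Real.pi_pos]
  have hsq : ‖1 + z ^ (-(α : ℂ))‖ ^ 2
      = 1 + 2 * (z ^ (-(α : ℂ))).re + ‖z ^ (-(α : ℂ))‖ ^ 2 := by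
    rw [← Complex.normSq_eq_norm_sq, ← Complex.normSq_eq_norm_sq, Complex.normSq_add]
    simp
    ring
  rw [hsq, hn, hre]
  set r := ‖z‖ ^ (-α)
  have hr : 0 ≤ r := Real.rpow_nonneg (norm_nonneg _) _
  set c := Real.cos (α * (Real.pi / 2)) with hc
  have hc1 : c ≤ 1 := Real.cos_le_one _
  nlinarith [mul_nonneg (sub_nonneg.2 hc1) (sq_nonneg (1 - r)),
    mul_le_mul_of_nonneg_left hcos hr]

theorem one_add_cos_pos (hα₁ : 0 ≤ α) (hα₂ : α < 2) :
    0 < 1 + Real.cos (α * (Real.pi / 2)) := by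
  have h := Real.cos_lt_cos_of_nonneg_of_le_pi (x := α * (Real.pi / 2)) (y := Real.pi)
    (by positivity) le_rfl (by nlinarith [Real.pi_pos])
  rw [Real.cos_pi] at h
  linarith

theorem one_add_cpow_ne_zero (hα₁ : 0 ≤ α) (hα₂ : α < 2) {z : ℂ} (hz : 0 < z.re) :
    1 + z ^ (-(α : ℂ)) ≠ 0 := by
  intro h
  have h1 := norm_one_add_cpow_ge hα₁ hα₂ hz
  rw [h, norm_zero] at h1
  have h2 := one_add_cos_pos hα₁ hα₂
  have h3 : 0 ≤ ‖z‖ ^ (-α) := Real.rpow_nonneg (norm_nonneg _) _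
  have : 0 < (1 + Real.cos (α * (Real.pi / 2))) / 2 * (1 + ‖z‖ ^ (-α)) ^ 2 := by positivity
  norm_num at h1
  linarith

theorem differentiableOn_mlSymbol (hα₁ : 0 ≤ α) (hα₂ : α < 2) (i : ℕ) :
    DifferentiableOn ℂ (mlSymbol α i) {z | 0 < z.re} := by
  intro z hz
  have hs : z ∈ Complex.slitPlane := Or.inl hz
  have h1 : DifferentiableAt ℂ (fun z : ℂ => z ^ (-((α + 1 : ℝ) : ℂ))) z :=
    differentiableAt_id.cpow_const hs
  have h2 : DifferentiableAt ℂ (fun z : ℂ => z ^ (-(α : ℂ))) z :=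
    differentiableAt_id.cpow_const hs
  exact ((h1.div ((h2.const_add 1).pow (i + 1))
    (pow_ne_zero _ (one_add_cpow_ne_zero hα₁ hα₂ hz))).neg).differentiableWithinAt

/-- Near the origin the numerator `|z|^(-α-1)` is absorbed by two factors `|z|^(-α)` of the
denominator, since `α > 1`; at infinity it is at most `|z|^(-2)`. The condition `i ≥ 1` is
essential, because for `i = 0` the symbol behaves like `1 / z` at the origin. -/
theorem norm_mlSymbol_le (hα₁ : 1 < α) (hα₂ : α < 2) {i : ℕ} (hi : 1 ≤ i) {z : ℂ}
    (hz : 0 < z.re) :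
    ‖mlSymbol α i z‖
      ≤ 2 / √((1 + Real.cos (α * (Real.pi / 2))) / 2) ^ (i + 1) * (1 + z.im ^ 2)⁻¹ := by
  have h0 : 0 ≤ α := by linarith
  set c := √((1 + Real.cos (α * (Real.pi / 2))) / 2) with hc
  have hc0 : 0 < c := Real.sqrt_pos.2 (by linarith [one_add_cos_pos h0 hα₂])
  have hr : 0 < ‖z‖ := norm_pos_iff.2 (by rintro rfl; simp at hz)
  have him : z.im ^ 2 ≤ ‖z‖ ^ 2 := by
    rw [← sq_abs]; exact pow_le_pow_left₀ (abs_nonneg _) (Complex.abs_im_le_norm z) 2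
  set r := ‖z‖ with hrdef
  have hlow : c * (1 + r ^ (-α)) ≤ ‖1 + z ^ (-(α : ℂ))‖ := by
    have h1 := norm_one_add_cpow_ge h0 hα₂ hz
    refine abs_le_of_sq_le_sq' ?_ (norm_nonneg _) |>.2
    rw [mul_pow, hc, Real.sq_sqrt (by linarith [one_add_cos_pos h0 hα₂])]
    exact h1
  have hrα : 0 < r ^ (-α) := Real.rpow_pos_of_pos hr _
  have hnum : ‖z ^ (-((α + 1 : ℝ) : ℂ))‖ = r ^ (-(α + 1)) := by
    have := Complex.norm_cpow_real z (-(α + 1))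
    rw [Complex.ofReal_neg] at this
    exact this
  have hmain : r ^ (-(α + 1)) * (1 + r ^ 2) ≤ 2 * (1 + r ^ (-α)) ^ 2 := by
    have e1 : r ^ (-(α + 1)) = r ^ (-α) * r⁻¹ := by
      rw [show -(α + 1) = -α + -1 by ring, Real.rpow_add hr, Real.rpow_neg_one]
    rcases le_total r 1 with h | h
    · have h1 : r⁻¹ ≤ r ^ (-α) := by
        rw [← Real.rpow_neg_one]
        exact Real.rpow_le_rpow_of_exponent_ge hr h (by linarith)
      have h2 : 1 + r ^ 2 ≤ 2 := by nlinarith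
      calc r ^ (-(α + 1)) * (1 + r ^ 2) ≤ (r ^ (-α) * r ^ (-α)) * 2 := by
            rw [e1]; gcongr
        _ ≤ _ := by nlinarith
    · have h1 : r ^ (-α) ≤ r⁻¹ := by
        rw [← Real.rpow_neg_one]
        exact Real.rpow_le_rpow_of_exponent_le h (by linarith)
      calc r ^ (-(α + 1)) * (1 + r ^ 2) ≤ (r⁻¹ * r⁻¹) * (r ^ 2 + r ^ 2) := by
            rw [e1]; gcongr; nlinarith
        _ = 2 := by field_simp; norm_num
        _ ≤ _ := by nlinarith
  have hden : c ^ (i + 1) * (1 + r ^ (-α)) ^ 2 ≤ ‖1 + z ^ (-(α : ℂ))‖ ^ (i + 1) := by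
    calc c ^ (i + 1) * (1 + r ^ (-α)) ^ 2 ≤ c ^ (i + 1) * (1 + r ^ (-α)) ^ (i + 1) := by
          gcongr
          · linarith
          · omega
      _ = (c * (1 + r ^ (-α))) ^ (i + 1) := (mul_pow _ _ _).symm
      _ ≤ _ := by gcongr
  rw [mlSymbol, norm_neg, norm_div, norm_pow, hnum, ← div_eq_mul_inv,
    div_le_div_iff₀ (lt_of_lt_of_le (by positivity) hden) (by positivity)]
  calc r ^ (-(α + 1)) * (1 + z.im ^ 2) ≤ r ^ (-(α + 1)) * (1 + r ^ 2) := by gcongr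
    _ ≤ 2 * (1 + r ^ (-α)) ^ 2 := hmain
    _ = 2 / c ^ (i + 1) * (c ^ (i + 1) * (1 + r ^ (-α)) ^ 2) := by field_simp
    _ ≤ _ := by gcongr

/-- `∑ₖ C(k+i-1,i) (-t^α)^k / Γ(kα+1)`, indexed by `n = k - 1`. -/
def mlChoose (α : ℝ) (i : ℕ) (t : ℝ) : ℝ :=
  ∑' n : ℕ, ((-1) ^ (n + 1) * ((n + i).choose i : ℝ)) * t ^ ((n + 1) * α)
    / Real.Gamma ((n + 1) * α + 1)

/-- With `k = n + 1` the binomial coefficients are `k`, `k(k+1)/2` and `k(k+1)(k+2)/6`, and `k`,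
`k²`, `k³` are expressed through them. Binomials are preferred to powers because their generating
functions are powers of the geometric series, which makes the Laplace transforms explicit. -/
theorem mlChoose_eq (hα : 1 ≤ α) {t : ℝ} (ht : 0 < t) :
    mlEuler α 1 (-t ^ α) = α * mlChoose α 1 t ∧
    mlEuler α 2 (-t ^ α) = α ^ 2 * (2 * mlChoose α 2 t - mlChoose α 1 t) ∧
    mlEuler α 3 (-t ^ α)
      = α ^ 3 * (6 * mlChoose α 3 t - 6 * mlChoose α 2 t + mlChoose α 1 t) ∧
    ContinuousAt (mlChoose α 1) t ∧ ContinuousAt (mlChoose α 2) t ∧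
    ContinuousAt (mlChoose α 3) t := by
  have h0 : α ≠ 0 := by linarith
  have hpow : ∀ s : ℝ, 0 < s → ∀ n : ℕ, (-s ^ α) ^ (n + 1) = (-1) ^ (n + 1) * s ^ ((n + 1) * α) := by
    intro s hs n
    rw [neg_pow, ← Real.rpow_natCast (s ^ α), ← Real.rpow_mul hs.le]
    push_cast
    ring_nf
  have hshift : ∀ s : ℝ, 0 < s → ∀ j : ℕ, j ≠ 0 → HasSum (fun n : ℕ =>
      (((n:ℝ) + 1) * α) ^ j * ((-1) ^ (n + 1) * s ^ ((n + 1) * α)) / Real.Gamma ((n + 1) * α + 1))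
      (mlEuler α j (-s ^ α)) := by
    intro s hs j hj
    have h1 := (summable_mlEuler' hα j (-s ^ α)).hasSum
    rw [← hasSum_nat_add_iff' 1] at h1
    simp only [Finset.range_one, Finset.sum_singleton, Nat.cast_zero, zero_mul, zero_pow hj,
      zero_div, sub_zero, hpow s hs, Nat.cast_add, Nat.cast_one] at h1
    exact h1
  have hch2 : ∀ n : ℕ, ((n + 2).choose 2 : ℝ) = ((n:ℝ) + 2) * (n + 1) / 2 := by
    intro n
    rw [Nat.cast_choose_two]; push_cast; ring
  have hch3 : ∀ n : ℕ, ((n + 3).choose 3 : ℝ) = ((n:ℝ) + 3) * (n + 2) * (n + 1) / 6 := by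
    intro n
    have h := Nat.add_one_mul_choose_eq (n + 2) 2
    have h' : ((n:ℝ) + 3) * ((n + 2).choose 2 : ℝ) = ((n + 3).choose 3 : ℝ) * 3 := by
      exact_mod_cast h
    rw [hch2] at h'
    linarith
  have e1 : ∀ s : ℝ, 0 < s → mlChoose α 1 s = α⁻¹ * mlEuler α 1 (-s ^ α) := by
    intro s hs
    rw [mlChoose, ← ((hshift s hs 1 one_ne_zero).mul_left α⁻¹).tsum_eq]
    refine tsum_congr fun n => ?_
    rw [Nat.choose_one_right]
    push_cast
    field_simp
  have e2 : ∀ s : ℝ, 0 < s → mlChoose α 2 s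
      = 2⁻¹ * ((α ^ 2)⁻¹ * mlEuler α 2 (-s ^ α) + α⁻¹ * mlEuler α 1 (-s ^ α)) := by
    intro s hs
    rw [mlChoose, ← ((((hshift s hs 2 two_ne_zero).mul_left (α ^ 2)⁻¹).add
      ((hshift s hs 1 one_ne_zero).mul_left α⁻¹)).mul_left 2⁻¹).tsum_eq]
    refine tsum_congr fun n => ?_
    rw [hch2]
    field_simp
    ring
  have e3 : ∀ s : ℝ, 0 < s → mlChoose α 3 s
      = 6⁻¹ * ((α ^ 3)⁻¹ * mlEuler α 3 (-s ^ α) + (3 * (α ^ 2)⁻¹ * mlEuler α 2 (-s ^ α)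
        + 2 * α⁻¹ * mlEuler α 1 (-s ^ α))) := by
    intro s hs
    rw [mlChoose, ← ((((hshift s hs 3 three_ne_zero).mul_left (α ^ 3)⁻¹).add
      (((hshift s hs 2 two_ne_zero).mul_left (3 * (α ^ 2)⁻¹)).add
      ((hshift s hs 1 one_ne_zero).mul_left (2 * α⁻¹)))).mul_left 6⁻¹).tsum_eq]
    refine tsum_congr fun n => ?_
    rw [hch3]
    field_simp
    ring
  have hc : ∀ j, ContinuousAt (fun s : ℝ => mlEuler α j (-s ^ α)) t := fun j =>
    (continuous_mlEuler hα j).continuousAt.comp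
      (Real.continuousAt_rpow_const _ _ (Or.inl ht.ne')).neg
  refine ⟨?_, ?_, ?_, ?_, ?_, ?_⟩
  · rw [e1 t ht]; field_simp
  · rw [e1 t ht, e2 t ht]; field_simp; ring
  · rw [e1 t ht, e2 t ht, e3 t ht]; field_simp; ring
  · refine ContinuousAt.congr (f := fun s => α⁻¹ * mlEuler α 1 (-s ^ α)) ?_ ?_
    · exact continuousAt_const.mul (hc 1)
    · filter_upwards [Ioi_mem_nhds ht] with s hs using (e1 s hs).symm
  · refine ContinuousAt.congr (f := fun s =>
      2⁻¹ * ((α ^ 2)⁻¹ * mlEuler α 2 (-s ^ α) + α⁻¹ * mlEuler α 1 (-s ^ α))) ?_ ?_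
    · exact continuousAt_const.mul ((continuousAt_const.mul (hc 2)).add
        (continuousAt_const.mul (hc 1)))
    · filter_upwards [Ioi_mem_nhds ht] with s hs using (e2 s hs).symm
  · refine ContinuousAt.congr (f := fun s =>
      6⁻¹ * ((α ^ 3)⁻¹ * mlEuler α 3 (-s ^ α) + (3 * (α ^ 2)⁻¹ * mlEuler α 2 (-s ^ α)
        + 2 * α⁻¹ * mlEuler α 1 (-s ^ α)))) ?_ ?_
    · exact continuousAt_const.mul ((continuousAt_const.mul (hc 3)).add
        ((continuousAt_const.mul (hc 2)).add (continuousAt_const.mul (hc 1))))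
    · filter_upwards [Ioi_mem_nhds ht] with s hs using (e3 s hs).symm

/-- On `Re z = 2` one has `|z^(-α)| < 1`, so the transform may be taken termwise and is summed by
the negative binomial series to `mlSymbol`. The bound of the symbol passes to the function by
`abs_le_of_laplace`. -/
theorem abs_mlChoose_le (hα₁ : 1 < α) (hα₂ : α < 2) {i : ℕ} (hi : 1 ≤ i)
    (hcont : ContinuousOn (mlChoose α i) (Set.Ioi 0)) {t : ℝ} (ht : 0 < t) :
    |mlChoose α i t| ≤ 2 / √((1 + Real.cos (α * (Real.pi / 2))) / 2) ^ (i + 1) := by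
  have hq : ‖((2:ℝ) ^ (-α))‖ < 1 := by
    rw [Real.norm_of_nonneg (by positivity)]
    exact Real.rpow_lt_one_of_one_lt_of_neg one_lt_two (by linarith)
  have hs : Summable fun n : ℕ => |((-1) ^ (n + 1) * ((n + i).choose i : ℝ))|
      * (2:ℝ) ^ (-(((n:ℝ) + 1) * α + 1)) := by
    refine ((summable_choose_mul_geometric_of_norm_lt_one i hq).mul_left
      ((2:ℝ) ^ (-(α + 1)))).congr fun n => ?_
    rw [abs_mul, abs_pow, abs_neg, abs_one, one_pow, one_mul, Nat.abs_cast,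
      ← Real.rpow_natCast, ← Real.rpow_mul (by norm_num), mul_left_comm,
      ← Real.rpow_add (by norm_num)]
    congr 2
    ring
  have hL := laplace_tsum_rpow (fun n => (-1) ^ (n + 1) * ((n + i).choose i : ℝ))
    (fun n => ((n:ℝ) + 1) * α) (fun n => by positivity) two_pos hs
  refine abs_le_of_laplace (F := mlSymbol α i) hcont hL.1 (fun z hz => ?_)
    (differentiableOn_mlSymbol (by linarith) hα₂ i)
    (fun z hz _ => norm_mlSymbol_le hα₁ hα₂ hi hz) ht
  refine (hL.2 z hz).trans ?_
  have hz0 : z ≠ 0 := by rintro rfl; simp at hz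
  have hζ : ‖-(z ^ (-(α : ℂ)))‖ < 1 := by
    have h1 := Complex.norm_cpow_real z (-α)
    push_cast at h1
    rw [norm_neg, h1]
    refine Real.rpow_lt_one_of_one_lt_of_neg ?_ (by linarith)
    have := Complex.re_le_norm z
    linarith
  have h2 := tsum_choose_mul_geometric_of_norm_lt_one i hζ
  rw [mlSymbol, div_eq_mul_one_div]
  rw [sub_neg_eq_add] at h2
  rw [← h2, ← mul_neg, ← tsum_neg, ← tsum_mul_left]
  refine tsum_congr fun n => ?_
  have h3 : z ^ (-((((n:ℝ) + 1) * α + 1 : ℝ) : ℂ))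
      = z ^ (-((α + 1 : ℝ) : ℂ)) * (z ^ (-(α : ℂ))) ^ n := by
    rw [← Complex.cpow_nat_mul, ← Complex.cpow_add _ _ hz0]
    congr 1
    push_cast; ring
  rw [h3, neg_pow (z ^ (-(α : ℂ)))]
  push_cast
  ring

/-- The uniform bound comes from `mlChoose` via `x = t^α`. The linear bound follows for `x ≤ 1` from
the power series, whose constant term vanishes for `j ≥ 1`, and for `x ≥ 1` from the uniform one. -/
theorem mlEuler_bounded (hα₁ : 1 < α) (hα₂ : α < 2) :
    ∃ C : ℝ, 0 < C ∧ ∀ x : ℝ, 0 ≤ x → ∀ j : ℕ, 1 ≤ j → j ≤ 3 →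
      |mlEuler α j (-x)| ≤ C ∧ |mlEuler α j (-x)| ≤ C * x := by
  have hα : 1 ≤ α := hα₁.le
  have hb : ∃ M : ℝ, 0 ≤ M ∧ ∀ x : ℝ, 0 ≤ x → ∀ j : ℕ, 1 ≤ j → j ≤ 3 →
      |mlEuler α j (-x)| ≤ M := by
    set c := √((1 + Real.cos (α * (Real.pi / 2))) / 2) with hc
    have hc0 : 0 ≤ c := Real.sqrt_nonneg _
    set M1 := 2 / c ^ 2 with hM1
    set M2 := 2 / c ^ 3
    set M3 := 2 / c ^ 4
    have hM1' : 0 ≤ M1 := by positivity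
    have hM2' : 0 ≤ M2 := by positivity
    have hM3' : 0 ≤ M3 := by positivity
    -- The factor `8` dominates `α ^ j` for `j ≤ 3`; the bracket dominates all three combinations in
    -- `mlChoose_eq`.
    refine ⟨8 * (6 * M3 + 6 * M2 + M1), by positivity, fun x hx j hj1 hj3 => ?_⟩
    rcases eq_or_lt_of_le hx with rfl | hx0
    · have : mlEuler α j (-0) = 0 := by
        rw [mlEuler, neg_zero]
        refine (tsum_congr fun k => ?_).trans tsum_zero
        rcases Nat.eq_zero_or_pos k with rfl | hk
        · simp [show j ≠ 0 by omega]
        · simp [hk.ne']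
      rw [this, abs_zero]
      positivity
    set t := x ^ (1 / α) with ht
    have ht0 : 0 < t := Real.rpow_pos_of_pos hx0 _
    have htx : t ^ α = x := by
      rw [ht, ← Real.rpow_mul hx, one_div_mul_cancel (by linarith), Real.rpow_one]
    obtain ⟨h1, h2, h3, -, -, -⟩ := mlChoose_eq hα ht0
    rw [htx] at h1 h2 h3
    have b1 := abs_mlChoose_le hα₁ hα₂ (i := 1) le_rfl
      (fun s hs => (mlChoose_eq hα hs).2.2.2.1.continuousWithinAt) ht0
    have b2 := abs_mlChoose_le hα₁ hα₂ (i := 2) (by norm_num)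
      (fun s hs => (mlChoose_eq hα hs).2.2.2.2.1.continuousWithinAt) ht0
    have b3 := abs_mlChoose_le hα₁ hα₂ (i := 3) (by norm_num)
      (fun s hs => (mlChoose_eq hα hs).2.2.2.2.2.continuousWithinAt) ht0
    change |mlChoose α 1 t| ≤ M1 at b1
    change |mlChoose α 2 t| ≤ M2 at b2
    change |mlChoose α 3 t| ≤ M3 at b3
    have hα0 : 0 ≤ α := by linarith
    have p1 : α ≤ 8 := by linarith
    have p2 : α ^ 2 ≤ 8 := by nlinarith
    have p3 : α ^ 3 ≤ 8 := by
      have := pow_le_pow_left₀ hα0 hα₂.le 3; norm_num at this; linarith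
    rw [abs_le] at b1 b2 b3
    interval_cases j
    · rw [h1, abs_mul, abs_of_nonneg hα0]
      have : |mlChoose α 1 t| ≤ 6 * M3 + 6 * M2 + M1 := abs_le.2 ⟨by linarith, by linarith⟩
      gcongr
    · rw [h2, abs_mul, abs_of_nonneg (by positivity)]
      have : |2 * mlChoose α 2 t - mlChoose α 1 t| ≤ 6 * M3 + 6 * M2 + M1 :=
        abs_le.2 ⟨by linarith, by linarith⟩
      gcongr
    · rw [h3, abs_mul, abs_of_nonneg (by positivity)]
      have : |6 * mlChoose α 3 t - 6 * mlChoose α 2 t + mlChoose α 1 t|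
          ≤ 6 * M3 + 6 * M2 + M1 := abs_le.2 ⟨by linarith, by linarith⟩
      gcongr
  obtain ⟨M, hM0, hM⟩ := hb
  set S : ℕ → ℝ := fun j => ∑' k : ℕ, (k * α) ^ j * |(1:ℝ)| ^ k / Real.Gamma (k * α + 1) with hS
  have hS0 : ∀ j, 0 ≤ S j := fun j => tsum_nonneg fun k => by
    have := Gamma_natCast_mul_add_one_pos (by linarith : 0 ≤ α) k
    positivity
  have hsmall : ∀ x : ℝ, 0 ≤ x → x ≤ 1 → ∀ j, j ≠ 0 → |mlEuler α j (-x)| ≤ S j * x := by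
    intro x hx hx1 j hj
    rw [hS, ← tsum_mul_right, ← Real.norm_eq_abs, mlEuler]
    refine tsum_of_norm_bounded ((summable_mlEuler hα j 1).mul_right x).hasSum fun k => ?_
    have hG := Gamma_natCast_mul_add_one_pos (by linarith : 0 ≤ α) k
    rw [norm_div, norm_mul, norm_pow, norm_pow, Real.norm_of_nonneg hG.le, norm_neg,
      Real.norm_of_nonneg hx, Real.norm_of_nonneg (by positivity : 0 ≤ (k:ℝ) * α), abs_one,
      one_pow, mul_one, div_mul_eq_mul_div]
    rcases Nat.eq_zero_or_pos k with rfl | hk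
    · simp [hj]
    · have : x ^ k ≤ x := pow_le_of_le_one hx hx1 hk.ne'
      gcongr
  refine ⟨M + S 1 + S 2 + S 3 + 1, by linarith [hS0 1, hS0 2, hS0 3], fun x hx j hj1 hj3 => ?_⟩
  have h1 := hM x hx j hj1 hj3
  refine ⟨by linarith [hS0 1, hS0 2, hS0 3], ?_⟩
  rcases le_total x 1 with hx1 | hx1
  · refine (hsmall x hx hx1 j (by omega)).trans ?_
    gcongr
    have := hS0 1
    have := hS0 2
    have := hS0 3
    interval_cases j <;> linarith
  · nlinarith [hS0 1, hS0 2, hS0 3]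

end

/-! ### The integral equation of the scalar problem -/

theorem integral_rpow_mul_rpow {a b t : ℝ} (ha : 0 < a) (hb : 0 < b) (ht : 0 < t) :
    ∫ s in (0:ℝ)..t, (t - s) ^ (a - 1) * s ^ (b - 1)
      = Real.Gamma a * Real.Gamma b / Real.Gamma (a + b) * t ^ (a + b - 1) := by
  have h1 := Complex.betaIntegral_scaled (b : ℂ) (a : ℂ) ht
  have h2 := Complex.Gamma_mul_Gamma_eq_betaIntegral (s := (b : ℂ)) (t := (a : ℂ))
    (by simpa using hb) (by simpa using ha)
  have hG : Complex.Gamma ((b:ℂ) + a) ≠ 0 := by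
    rw [← Complex.ofReal_add, Complex.Gamma_ofReal]
    exact_mod_cast (Real.Gamma_pos_of_pos (by linarith)).ne'
  have h3 : Complex.betaIntegral b a = Complex.Gamma b * Complex.Gamma a / Complex.Gamma (b + a) := by
    rw [h2]; field_simp
  rw [h3] at h1
  have h4 : ((∫ s in (0:ℝ)..t, (t - s) ^ (a - 1) * s ^ (b - 1) : ℝ) : ℂ)
      = ∫ x in (0:ℝ)..t, (x : ℂ) ^ ((b:ℂ) - 1) * ((t : ℂ) - x) ^ ((a:ℂ) - 1) := by
    rw [← intervalIntegral.integral_ofReal]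
    refine intervalIntegral.integral_congr fun s hs => ?_
    rw [Set.uIcc_of_le ht.le] at hs
    have e1 := Complex.ofReal_cpow hs.1 (b - 1)
    have e2 := Complex.ofReal_cpow (sub_nonneg.2 hs.2) (a - 1)
    push_cast at e1 e2 ⊢
    rw [e1, e2, mul_comm]
  rw [h1] at h4
  have h5 : ((Real.Gamma a * Real.Gamma b / Real.Gamma (a + b) * t ^ (a + b - 1) : ℝ) : ℂ)
      = (t : ℂ) ^ ((b:ℂ) + a - 1) * (Complex.Gamma b * Complex.Gamma a / Complex.Gamma (b + a)) := by
    have e1 := Complex.ofReal_cpow ht.le (a + b - 1)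
    push_cast at e1 ⊢
    rw [e1, ← Complex.Gamma_ofReal, ← Complex.Gamma_ofReal, ← Complex.Gamma_ofReal]
    push_cast
    rw [add_comm (a:ℂ) b]
    ring
  exact_mod_cast h4.trans h5.symm

theorem intervalIntegrable_rpow_mul_rpow {a b t : ℝ} (ha : 0 < a) (hb : 0 < b) (ht : 0 < t) :
    IntervalIntegrable (fun s => (t - s) ^ (a - 1) * s ^ (b - 1)) volume 0 t := by
  -- A function that is not integrable has integral `0` by convention, whereas the Beta integral is
  -- positive.
  by_contra h
  have h1 := integral_rpow_mul_rpow ha hb ht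
  rw [intervalIntegral.integral_undef h] at h1
  have := Real.Gamma_pos_of_pos ha
  have := Real.Gamma_pos_of_pos hb
  have := Real.Gamma_pos_of_pos (add_pos ha hb)
  have : 0 < Real.Gamma a * Real.Gamma b / Real.Gamma (a + b) * t ^ (a + b - 1) := by positivity
  linarith

theorem intervalIntegrable_sub_rpow {p t a b : ℝ} (hp : -1 < p) :
    IntervalIntegrable (fun s => (t - s) ^ p) volume a b := by
  have := (intervalIntegral.intervalIntegrable_rpow' hp (a := t - a) (b := t - b)).comp_sub_left t
  simpa using this

/-- Products of a weakly singular kernel with a bounded function are integrable. -/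
theorem intervalIntegrable_sub_rpow_mul {p t a b M : ℝ} (hp : -1 < p) (ha : 0 ≤ a) (hab : a ≤ b)
    (hbt : b ≤ t) {v : ℝ → ℝ} (hv : ContinuousOn v (Set.Ioi 0))
    (hM : ∀ s, 0 < s → s ≤ b → |v s| ≤ M) :
    IntervalIntegrable (fun s => (t - s) ^ p * v s) volume a b := by
  have h1 := (intervalIntegrable_sub_rpow (t := t) (a := a) (b := b) hp).mul_const M
  rw [intervalIntegrable_iff_integrableOn_Ioc_of_le hab] at h1 ⊢
  have hmeas : AEStronglyMeasurable (fun s => (t - s) ^ p * v s)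
      (volume.restrict (Set.Ioc a b)) := by
    have h2 := ((intervalIntegrable_iff_integrableOn_Ioc_of_le hab).1
      (intervalIntegrable_sub_rpow (t := t) (a := a) (b := b) hp)).aestronglyMeasurable
    exact h2.mul ((hv.mono fun s hs => lt_of_le_of_lt ha hs.1).aestronglyMeasurable
      measurableSet_Ioc)
  refine h1.mono' hmeas ((ae_restrict_iff' measurableSet_Ioc).2 (ae_of_all _ fun s hs => ?_))
  have h3 : 0 ≤ (t - s) ^ p := Real.rpow_nonneg (by linarith [hs.2]) _
  rw [norm_mul, Real.norm_of_nonneg h3]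
  exact mul_le_mul_of_nonneg_left (hM s (lt_of_le_of_lt ha hs.1) hs.2) h3

section

variable {α : ℝ}

/-- The differential equation integrated once: the fractional integral of order `2 - α` of `y'`
equals `-lam ∫ y`. The Beta integral sends the term `k + 1` of the series on the left to the term
`k` of the primitive on the right; summable norms justify both interchanges. -/
theorem mlEuler_integral_equation (hα₁ : 1 < α) (hα₂ : α < 2) (lam : ℝ) {t : ℝ}
    (ht : 0 < t) :
    ∫ s in (0:ℝ)..t, (t - s) ^ (-(α - 1)) * (mlEuler α 1 (-lam * s ^ α) / s)
      = -lam * Real.Gamma (2 - α) * ∫ s in (0:ℝ)..t, mlEuler α 0 (-lam * s ^ α) := by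
  have hα : 1 ≤ α := hα₁.le
  have hα0 : 0 < α := by linarith
  have hGpos := Gamma_natCast_mul_add_one_pos hα0.le
  have hG2 : ∀ k : ℕ, Real.Gamma (k * α + 2) = (k * α + 1) * Real.Gamma (k * α + 1) := by
    intro k
    have : (k:ℝ) * α + 1 ≠ 0 := by positivity
    rw [← Real.Gamma_add_one this]
    ring_nf
  have hG2pos : ∀ k : ℕ, 0 < Real.Gamma (k * α + 2) := fun k =>
    Real.Gamma_pos_of_pos (by positivity)
  have hGα : 0 < Real.Gamma (2 - α) := Real.Gamma_pos_of_pos (by linarith)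
  have hpow : ∀ (l s : ℝ), 0 < s → ∀ k : ℕ, (l * s ^ α) ^ k = l ^ k * s ^ (k * α) := by
    intro l s hs k
    rw [mul_pow, ← Real.rpow_natCast (s ^ α), ← Real.rpow_mul hs.le, mul_comm α]
  have hsumm : Summable fun k : ℕ => |lam| ^ k * t ^ (k * α + 1) / Real.Gamma (k * α + 2) := by
    refine ((summable_mlEuler hα 0 (|lam| * t ^ α)).mul_left t).of_nonneg_of_le (fun k => ?_)
      fun k => ?_
    · have := hG2pos k
      positivity
    · have h1 : Real.Gamma (k * α + 1) ≤ Real.Gamma (k * α + 2) := by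
        rw [hG2]
        have : (0:ℝ) ≤ k * α := by positivity
        nlinarith [hGpos k]
      have h2 := hGpos k
      rw [abs_of_nonneg (by positivity : 0 ≤ |lam| * t ^ α), hpow _ _ ht, pow_zero, one_mul, ← mul_div_assoc,
        Real.rpow_add ht, Real.rpow_one]
      rw [show t * (|lam| ^ k * t ^ ((k:ℝ) * α)) = |lam| ^ k * (t ^ ((k:ℝ) * α) * t) by ring]
      gcongr
  have hI : ∀ f : ℝ → ℝ, ∫ s in (0:ℝ)..t, f s = ∫ s in Set.Ioc 0 t, f s := fun f =>
    intervalIntegral.integral_of_le ht.le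
  set F : ℕ → ℝ → ℝ := fun k s => (t - s) ^ (2 - α - 1) *
    ((-lam) ^ (k + 1) * s ^ ((k + 1) * α - 1) / Real.Gamma ((k + 1) * α)) with hF
  set H : ℕ → ℝ → ℝ := fun k s => (-lam) ^ k * s ^ (k * α) / Real.Gamma (k * α + 1) with hH
  have hb : ∀ k : ℕ, 0 < ((k:ℝ) + 1) * α := fun k => by positivity
  have hFint0 : ∀ k : ℕ, ∫ s in Set.Ioc 0 t, (t - s) ^ (2 - α - 1) * s ^ (((k:ℝ) + 1) * α - 1)
      = Real.Gamma (2 - α) * Real.Gamma ((k + 1) * α) / Real.Gamma (k * α + 2)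
        * t ^ ((k:ℝ) * α + 1) := by
    intro k
    rw [← hI, integral_rpow_mul_rpow (by linarith) (hb k) ht]
    congr 2 <;> ring_nf
  have hFi : ∀ k, Integrable (F k) (volume.restrict (Set.Ioc 0 t)) := by
    intro k
    have := ((intervalIntegrable_iff_integrableOn_Ioc_of_le ht.le).1
      (intervalIntegrable_rpow_mul_rpow (by linarith : 0 < 2 - α) (hb k) ht)).mul_const
      ((-lam) ^ (k + 1) / Real.Gamma ((k + 1) * α))
    refine this.congr (ae_of_all _ fun s => ?_)
    simp only [hF]; ring
  have hFval : ∀ k, ∫ s in Set.Ioc 0 t, F k s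
      = -lam * Real.Gamma (2 - α) * ((-lam) ^ k * t ^ ((k:ℝ) * α + 1) / Real.Gamma (k * α + 2)) := by
    intro k
    have h1 : ∀ s, F k s = ((-lam) ^ (k + 1) / Real.Gamma ((k + 1) * α)) *
        ((t - s) ^ (2 - α - 1) * s ^ (((k:ℝ) + 1) * α - 1)) := fun s => by
      simp only [hF]; ring
    simp only [h1]
    rw [integral_const_mul, hFint0]
    have := (Real.Gamma_pos_of_pos (hb k)).ne'
    rw [pow_succ]
    field_simp
  have hFnorm : Summable fun k => ∫ s in Set.Ioc 0 t, ‖F k s‖ := by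
    refine (hsumm.mul_left (|lam| * Real.Gamma (2 - α))).congr fun k => ?_
    have h1 : ∫ s in Set.Ioc 0 t, ‖F k s‖ = ∫ s in Set.Ioc 0 t,
        (|lam| ^ (k + 1) / Real.Gamma ((k + 1) * α)) *
        ((t - s) ^ (2 - α - 1) * s ^ (((k:ℝ) + 1) * α - 1)) := by
      refine setIntegral_congr_fun measurableSet_Ioc fun s hs => ?_
      simp only [hF]
      rw [norm_mul, norm_div, norm_mul, norm_pow, norm_neg,
        Real.norm_of_nonneg (Real.rpow_nonneg (sub_nonneg.2 hs.2) _),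
        Real.norm_of_nonneg (Real.rpow_nonneg hs.1.le _),
        Real.norm_of_nonneg (Real.Gamma_pos_of_pos (hb k)).le, Real.norm_eq_abs]
      ring
    rw [h1, integral_const_mul, hFint0]
    have := (Real.Gamma_pos_of_pos (hb k)).ne'
    rw [pow_succ]
    field_simp
  have hHint0 : ∀ k : ℕ, ∫ s in Set.Ioc 0 t, s ^ ((k:ℝ) * α)
      = t ^ ((k:ℝ) * α + 1) / (k * α + 1) := by
    intro k
    have h0 : (0:ℝ) ≤ k * α := by positivity
    rw [← hI, integral_rpow (Or.inl (by linarith)), Real.zero_rpow (by positivity), sub_zero]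
  have hHi : ∀ k, Integrable (H k) (volume.restrict (Set.Ioc 0 t)) := by
    intro k
    have h0 : (0:ℝ) ≤ k * α := by positivity
    have := ((intervalIntegrable_iff_integrableOn_Ioc_of_le ht.le).1
      (intervalIntegral.intervalIntegrable_rpow' (a := 0) (b := t)
        (by linarith : -1 < (k:ℝ) * α))).mul_const ((-lam) ^ k / Real.Gamma (k * α + 1))
    refine this.congr (ae_of_all _ fun s => ?_)
    simp only [hH]; ring
  have hHval : ∀ k, ∫ s in Set.Ioc 0 t, H k s
      = (-lam) ^ k * t ^ ((k:ℝ) * α + 1) / Real.Gamma (k * α + 2) := by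
    intro k
    have h1 : ∀ s, H k s = ((-lam) ^ k / Real.Gamma (k * α + 1)) * s ^ ((k:ℝ) * α) := fun s => by
      simp only [hH]; ring
    simp only [h1]
    rw [integral_const_mul, hHint0, hG2]
    have := (hGpos k).ne'
    field_simp
  have hHnorm : Summable fun k => ∫ s in Set.Ioc 0 t, ‖H k s‖ := by
    refine hsumm.congr fun k => ?_
    have h1 : ∫ s in Set.Ioc 0 t, ‖H k s‖ = ∫ s in Set.Ioc 0 t,
        (|lam| ^ k / Real.Gamma (k * α + 1)) * s ^ ((k:ℝ) * α) := by
      refine setIntegral_congr_fun measurableSet_Ioc fun s hs => ?_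
      simp only [hH]
      rw [norm_div, norm_mul, norm_pow, norm_neg,
        Real.norm_of_nonneg (Real.rpow_nonneg hs.1.le _),
        Real.norm_of_nonneg (hGpos k).le, Real.norm_eq_abs]
      ring
    rw [h1, integral_const_mul, hHint0, hG2]
    have := (hGpos k).ne'
    field_simp
  have e1 : ∫ s in (0:ℝ)..t, (t - s) ^ (-(α - 1)) * (mlEuler α 1 (-lam * s ^ α) / s)
      = ∫ s in Set.Ioc 0 t, ∑' k, F k s := by
    rw [hI]
    refine setIntegral_congr_fun measurableSet_Ioc fun s hs => ?_
    have h1 : HasSum _ (mlEuler α 1 (-lam * s ^ α)) :=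
      (summable_mlEuler' hα 1 (-lam * s ^ α)).hasSum
    rw [← hasSum_nat_add_iff' 1] at h1
    simp only [Finset.range_one, Finset.sum_singleton, Nat.cast_zero, zero_mul, pow_one,
      zero_div, sub_zero] at h1
    have h2 := (h1.div_const s).mul_left ((t - s) ^ (-(α - 1)))
    refine (h2.tsum_eq.symm.trans (tsum_congr fun k => ?_))
    simp only [hF]
    have hGa : Real.Gamma (((k + 1 : ℕ) : ℝ) * α + 1)
        = (((k + 1 : ℕ) : ℝ) * α) * Real.Gamma (((k + 1 : ℕ) : ℝ) * α) :=
      Real.Gamma_add_one (by positivity)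
    have := (Real.Gamma_pos_of_pos (hb k)).ne'
    have hs0 := hs.1.ne'
    rw [hGa, hpow _ _ hs.1]
    push_cast
    rw [Real.rpow_sub_one hs0, show -(α - 1) = 2 - α - 1 by ring]
    have := (hb k).ne'
    field_simp
  have e2 : ∫ s in (0:ℝ)..t, mlEuler α 0 (-lam * s ^ α) = ∫ s in Set.Ioc 0 t, ∑' k, H k s := by
    rw [hI]
    refine setIntegral_congr_fun measurableSet_Ioc fun s hs => ?_
    refine tsum_congr fun k => ?_
    simp only [hH]
    rw [hpow _ _ hs.1, pow_zero, one_mul]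
  rw [e1, e2, ← (hasSum_integral_of_summable_integral_norm hFi hFnorm).tsum_eq,
    ← (hasSum_integral_of_summable_integral_norm hHi hHnorm).tsum_eq, ← tsum_mul_left]
  exact tsum_congr fun k => by rw [hFval, hHval]

/-- Everything about the solution `y(t) = E_{α,1}(-lam t^α)` of the scalar problem that the error
analysis uses. -/
structure IsScalarSolution (α lam C : ℝ) (y y₁ y₂ y₃ : ℝ → ℝ) : Prop where
  continuous : Continuous y
  hasDerivAt : ∀ t, 0 < t → HasDerivAt y (y₁ t) t
  hasDerivAt₁ : ∀ t, 0 < t → HasDerivAt y₁ (y₂ t) t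
  hasDerivAt₂ : ∀ t, 0 < t → HasDerivAt y₂ (y₃ t) t
  bound : ∀ t, 0 ≤ t → |y t| ≤ C
  bound₁ : ∀ t, 0 < t → |y₁ t| ≤ C * lam * t ^ (α - 1)
  bound₂ : ∀ t, 0 < t → |y₂ t| ≤ C * lam * t ^ (α - 2)
  bound₃ : ∀ t, 0 < t → |y₃ t| ≤ C * lam * t ^ (α - 3)
  decay₂ : ∀ t, 0 < t → |y₂ t| ≤ C / t ^ 2
  integral_eq : ∀ t, 0 < t → ∫ s in (0:ℝ)..t, (t - s) ^ (-(α - 1)) * y₁ s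
    = -lam * Real.Gamma (2 - α) * ∫ s in (0:ℝ)..t, y s

theorem mlEuler_zero_zero : mlEuler α 0 0 = 1 := by
  rw [mlEuler, tsum_eq_single 0]
  · simp
  · intro k hk
    simp [hk]

theorem exists_isScalarSolution (hα₁ : 1 < α) (hα₂ : α < 2) :
    ∃ C : ℝ, 0 < C ∧ ∀ lam : ℝ, 0 < lam → ∃ y₁ y₂ y₃ : ℝ → ℝ,
      IsScalarSolution α lam C (fun t => mittagLeffler α 1 (-lam * t ^ α)) y₁ y₂ y₃ := by
  obtain ⟨C, hC, hb⟩ := mlEuler_bounded hα₁ hα₂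
  have hα : 1 ≤ α := hα₁.le
  have hGα : 0 < Real.Gamma (2 - α) := Real.Gamma_pos_of_pos (by linarith)
  -- The summands of `D` serve `∫ y`, `∫ s y'` and the value `y 0 = 1`. The factor `6` below covers
  -- `g 3 - 3 g 2 + 2 g 1`.
  set D := C / (Real.Gamma (2 - α) * (2 - α)) + C + 1 with hD
  have h2α : 0 < 2 - α := by linarith
  have hD1 : 0 < C / (Real.Gamma (2 - α) * (2 - α)) := by positivity
  have hDC : C ≤ D := by linarith
  refine ⟨6 * D, by positivity, fun lam hlam => ?_⟩
  simp only [← mlEuler_zero]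
  set g : ℕ → ℝ → ℝ := fun j t => mlEuler α j (-lam * t ^ α) with hg
  have hgd : ∀ j t, 0 < t → HasDerivAt (g j) (g (j + 1) t / t) t := fun j t ht =>
    hasDerivAt_mlEuler_comp hα j lam ht
  have hgc : ∀ j, Continuous (g j) := fun j =>
    (continuous_mlEuler hα j).comp
      (continuous_const.mul (Real.continuous_rpow_const (by linarith)))
  have hgb : ∀ j t, 1 ≤ j → j ≤ 3 → 0 < t → |g j t| ≤ C ∧ |g j t| ≤ C * lam * t ^ α := by
    intro j t h1 h3 ht
    have := hb (lam * t ^ α) (by positivity) j h1 h3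
    simp only [hg, neg_mul]
    exact ⟨this.1, by rw [mul_assoc]; exact this.2⟩
  have hinteq : ∀ t, 0 < t → ∫ s in (0:ℝ)..t, (t - s) ^ (-(α - 1)) * (g 1 s / s)
      = -lam * Real.Gamma (2 - α) * ∫ s in (0:ℝ)..t, g 0 s := fun t ht =>
    mlEuler_integral_equation hα₁ hα₂ lam ht
  have hy1 : ∀ t, 0 < t → |g 1 t / t| ≤ C * lam * t ^ (α - 1) := by
    intro t ht
    rw [abs_div, abs_of_pos ht, div_le_iff₀ ht, mul_assoc, ← Real.rpow_add_one ht.ne']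
    simpa using (hgb 1 t le_rfl (by norm_num) ht).2
  -- The bounds on `mlEuler` do not cover `j = 0`. Instead `t y(t) = ∫ (y + s y')`, and `∫ y` is
  -- controlled by the integral equation, from which `lam` cancels.
  have hy0 : ∀ t, 0 ≤ t → |g 0 t| ≤ D := by
    intro t ht
    rcases eq_or_lt_of_le ht with rfl | ht
    · have : g 0 0 = 1 := by
        simp only [hg]
        rw [Real.zero_rpow (by linarith), mul_zero, mlEuler_zero_zero]
      rw [this, abs_one]
      linarith
    have hint1 : |∫ s in (0:ℝ)..t, g 0 s| ≤ C / (Real.Gamma (2 - α) * (2 - α)) * t := by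
      have h1 : |∫ s in (0:ℝ)..t, (t - s) ^ (-(α - 1)) * (g 1 s / s)|
          ≤ ∫ s in (0:ℝ)..t, C * lam * t ^ (α - 1) * (t - s) ^ (-(α - 1)) := by
        rw [← Real.norm_eq_abs]
        refine intervalIntegral.norm_integral_le_of_norm_le ht.le (ae_of_all _ fun s hs => ?_)
          ((intervalIntegrable_sub_rpow (by linarith)).const_mul _)
        have h2 : 0 ≤ (t - s) ^ (-(α - 1)) := Real.rpow_nonneg (by linarith [hs.2]) _
        rw [norm_mul, Real.norm_of_nonneg h2, mul_comm]
        refine mul_le_mul_of_nonneg_right ((hy1 s hs.1).trans ?_) h2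
        have : s ^ (α - 1) ≤ t ^ (α - 1) := Real.rpow_le_rpow hs.1.le hs.2 (by linarith)
        gcongr
      have h2 : ∫ s in (0:ℝ)..t, (t - s) ^ (-(α - 1)) = t ^ (2 - α) / (2 - α) := by
        rw [intervalIntegral.integral_comp_sub_left (fun x => x ^ (-(α - 1))) t,
          integral_rpow (Or.inl (by linarith)), sub_self, sub_zero, Real.zero_rpow (by linarith)]
        ring_nf
      rw [intervalIntegral.integral_const_mul, h2, hinteq t ht, abs_mul, abs_mul, abs_neg,
        abs_of_pos hlam, abs_of_pos hGα] at h1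
      have h3 : t ^ (α - 1) * t ^ (2 - α) = t := by
        rw [← Real.rpow_add ht, show α - 1 + (2 - α) = 1 by ring, Real.rpow_one]
      rw [show C * lam * t ^ (α - 1) * (t ^ (2 - α) / (2 - α))
        = lam * (C * (t ^ (α - 1) * t ^ (2 - α)) / (2 - α)) by ring, h3, mul_assoc] at h1
      have h4 := le_of_mul_le_mul_left h1 hlam
      rw [div_mul_eq_mul_div, le_div_iff₀ (by positivity)]
      rw [le_div_iff₀ h2α] at h4
      linarith
    have hint2 : |∫ s in (0:ℝ)..t, g 1 s| ≤ C * t := by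
      have := intervalIntegral.norm_integral_le_of_norm_le_const (a := 0) (b := t) (f := g 1)
        (C := C) fun s hs => by
          rw [Set.uIoc_of_le ht.le] at hs
          exact (hgb 1 s le_rfl (by norm_num) hs.1).1
      simpa [abs_of_pos ht] using this
    have hftc : ∫ s in (0:ℝ)..t, (g 0 s + g 1 s) = t * g 0 t := by
      rw [intervalIntegral.integral_eq_sub_of_hasDerivAt_of_le ht.le
        (f := fun s => s * g 0 s) (f' := fun s => g 0 s + g 1 s) (continuous_id.mul (hgc 0)).continuousOn (fun s hs => ?_)
        (((hgc 0).add (hgc 1)).intervalIntegrable _ _)]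
      · simp
      · have h1 := (hasDerivAt_id s).mul (hgd 0 s hs.1)
        refine h1.congr_deriv ?_
        have := hs.1.ne'
        simp only [id]
        field_simp
    replace hftc := (intervalIntegral.integral_add ((hgc 0).intervalIntegrable _ _)
      ((hgc 1).intervalIntegrable _ _)).symm.trans hftc
    have h5 : t * |g 0 t| ≤ t * D := by
      rw [← abs_of_pos ht, ← abs_mul, abs_of_pos ht, ← hftc, hD]
      refine (abs_add_le _ _).trans ?_
      nlinarith
    exact le_of_mul_le_mul_left h5 ht
  have hrp : ∀ (n : ℕ) (t : ℝ), 0 < t → t ^ (α - n) = t ^ α / t ^ n := fun n t ht => by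
    rw [Real.rpow_sub ht, Real.rpow_natCast]
  have h6 : ∀ {x : ℝ}, 0 ≤ x → C * x ≤ 6 * D * x := fun hx => by nlinarith
  refine ⟨fun t => g 1 t / t, fun t => (g 2 t - g 1 t) / t ^ 2,
    fun t => (g 3 t - 3 * g 2 t + 2 * g 1 t) / t ^ 3, hgc 0, hgd 0, fun t ht => ?_, fun t ht => ?_,
    fun t ht => (hy0 t ht).trans (by linarith), fun t ht => (hy1 t ht).trans ?_, fun t ht => ?_,
    fun t ht => ?_, fun t ht => ?_, hinteq⟩
  · refine ((hgd 1 t ht).div (hasDerivAt_id t) ht.ne').congr_deriv ?_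
    simp only [id]
    field_simp
  · refine (((hgd 2 t ht).sub (hgd 1 t ht)).div (hasDerivAt_pow 2 t)
      (pow_ne_zero 2 ht.ne')).congr_deriv ?_
    simp only [Pi.sub_apply]
    field_simp
    norm_num
    ring
  · have : 0 ≤ lam * t ^ (α - 1) := by positivity
    nlinarith
  · obtain ⟨-, h1⟩ := hgb 1 t le_rfl (by norm_num) ht
    obtain ⟨-, h2⟩ := hgb 2 t (by norm_num) (by norm_num) ht
    have h3 := hrp 2 t ht
    push_cast at h3
    rw [abs_div, abs_of_pos (pow_pos ht 2), h3, ← mul_div_assoc]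
    refine div_le_div_of_nonneg_right ?_ (by positivity)
    have hp : 0 ≤ lam * t ^ α := by positivity
    calc |g 2 t - g 1 t| ≤ |g 2 t| + |g 1 t| := abs_sub _ _
      _ ≤ 6 * D * lam * t ^ α := by nlinarith
  · obtain ⟨-, h1⟩ := hgb 1 t le_rfl (by norm_num) ht
    obtain ⟨-, h2⟩ := hgb 2 t (by norm_num) (by norm_num) ht
    obtain ⟨-, h3⟩ := hgb 3 t (by norm_num) (by norm_num) ht
    have h4 := hrp 3 t ht
    push_cast at h4
    rw [abs_div, abs_of_pos (pow_pos ht 3), h4, ← mul_div_assoc]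
    refine div_le_div_of_nonneg_right ?_ (by positivity)
    have hp : 0 ≤ lam * t ^ α := by positivity
    have h5 : C * (lam * t ^ α) ≤ D * (lam * t ^ α) := by gcongr
    rw [abs_le] at h1 h2 h3 ⊢
    constructor <;> nlinarith
  · obtain ⟨h1, -⟩ := hgb 1 t le_rfl (by norm_num) ht
    obtain ⟨h2, -⟩ := hgb 2 t (by norm_num) (by norm_num) ht
    rw [abs_div, abs_of_pos (pow_pos ht 2)]
    refine div_le_div_of_nonneg_right ?_ (by positivity)
    rw [abs_le] at h1 h2 ⊢
    constructor <;> linarith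

end

/-! ### Graded grids -/

/-- The graded grid `τ j^σ`. -/
def grid (τ σ : ℝ) (j : ℕ) : ℝ := τ * (j : ℝ) ^ σ

/-- The `j`-th step size. -/
def gridStep (τ σ : ℝ) (j : ℕ) : ℝ := grid τ σ (j + 1) - grid τ σ j

/-- Constant in the bound for the growth of the step sizes. -/
def gridConst (σ : ℝ) : ℝ := σ ^ 2 * (2 ^ σ + 1)

section Grid

variable {τ σ : ℝ}

theorem grid_zero (hσ : 1 ≤ σ) : grid τ σ 0 = 0 := by
  simp [grid, Real.zero_rpow (by linarith : σ ≠ 0)]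

theorem grid_strictMono (hτ : 0 < τ) (hσ : 1 ≤ σ) : StrictMono (grid τ σ) := by
  intro i j hij
  have : (i:ℝ) < j := by exact_mod_cast hij
  exact mul_lt_mul_of_pos_left (Real.rpow_lt_rpow (Nat.cast_nonneg i) this (by linarith)) hτ

theorem grid_nonneg (hτ : 0 < τ) (j : ℕ) : 0 ≤ grid τ σ j := by
  unfold grid; positivity

theorem grid_succ_pos (hτ : 0 < τ) (j : ℕ) : 0 < grid τ σ (j + 1) := by
  unfold grid; positivity

theorem gridStep_pos (hτ : 0 < τ) (hσ : 1 ≤ σ) (j : ℕ) : 0 < gridStep τ σ j :=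
  sub_pos.2 (grid_strictMono hτ hσ (Nat.lt_succ_self j))

theorem gridConst_pos (hσ : 1 ≤ σ) : 0 < gridConst σ := by
  unfold gridConst; positivity

/-- Bernoulli's inequality. Together with `gridStep_ge` it makes the step comparable to `t_{j+1} /
(j+1)`; the right end is used so that the first cell is included. -/
theorem gridStep_le (hτ : 0 < τ) (hσ : 1 ≤ σ) (j : ℕ) :
    gridStep τ σ j ≤ σ * grid τ σ (j + 1) / (j + 1) := by
  have hj : (0:ℝ) < (j:ℝ) + 1 := by positivity
  have h1 := one_add_mul_self_le_rpow_one_add (s := -1 / ((j:ℝ) + 1)) (p := σ)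
    (by rw [le_div_iff₀ hj]; linarith [(Nat.cast_nonneg j : (0:ℝ) ≤ j)]) hσ
  have h2 : 1 + -1 / ((j:ℝ) + 1) = j / (j + 1) := by field_simp; ring
  rw [h2, Real.div_rpow (Nat.cast_nonneg j) hj.le, le_div_iff₀ (Real.rpow_pos_of_pos hj _)] at h1
  unfold gridStep grid
  push_cast
  rw [le_div_iff₀ hj]
  have h3 : ((j:ℝ) + 1) * ((1 + σ * (-1 / ((j:ℝ) + 1))) * ((j:ℝ) + 1) ^ σ)
      = ((j:ℝ) + 1) * ((j:ℝ) + 1) ^ σ - σ * ((j:ℝ) + 1) ^ σ := by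
    field_simp
    ring
  have h4 := mul_le_mul_of_nonneg_left h1 hj.le
  rw [h3] at h4
  nlinarith

theorem gridStep_ge (hτ : 0 < τ) (hσ : 1 ≤ σ) (j : ℕ) :
    grid τ σ (j + 1) / (j + 1) ≤ gridStep τ σ j := by
  have hj : (0:ℝ) < (j:ℝ) + 1 := by positivity
  have h1 : ((j:ℝ) / (j + 1)) ^ σ ≤ (j:ℝ) / (j + 1) := by
    have h0 : (j:ℝ) / (j + 1) ≤ 1 := by rw [div_le_one hj]; linarith
    simpa using Real.rpow_le_rpow_of_exponent_ge' (by positivity : 0 ≤ (j:ℝ) / (j + 1)) h0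
      zero_le_one hσ
  rw [Real.div_rpow (Nat.cast_nonneg j) hj.le, div_le_div_iff₀ (Real.rpow_pos_of_pos hj _) hj] at h1
  unfold gridStep grid
  push_cast
  rw [div_le_iff₀ hj]
  nlinarith

theorem grid_succ_le (hτ : 0 < τ) (hσ : 1 ≤ σ) {j : ℕ} (hj : 1 ≤ j) :
    grid τ σ (j + 1) ≤ 2 ^ σ * grid τ σ j := by
  have h1 : (1:ℝ) ≤ j := by exact_mod_cast hj
  unfold grid
  push_cast
  rw [mul_left_comm, ← Real.mul_rpow (by norm_num) (by linarith)]
  gcongr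
  linarith

/-- Bernoulli's inequality at `1 / (1 ± x)` bounds each one-sided difference by `σ x` times a power
of exponent `σ - 1`, and these two powers differ by `O(x)`. -/
theorem rpow_second_difference_le (hσ : 1 ≤ σ) {x : ℝ} (hx : 0 ≤ x) (hx1 : x < 1) :
    (1 + x) ^ σ + (1 - x) ^ σ - 2 ≤ gridConst σ * x ^ 2 := by
  have hp : 0 < 1 + x := by linarith
  have hm : 0 < 1 - x := by linarith
  have h1 : (1 + x) ^ σ ≤ 1 + σ * x * (1 + x) ^ (σ - 1) := by
    have h := one_add_mul_self_le_rpow_one_add (s := -x / (1 + x)) (p := σ)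
      (by rw [le_div_iff₀ hp]; linarith) hσ
    have h2 : 1 + -x / (1 + x) = 1 / (1 + x) := by field_simp; ring
    rw [h2, Real.div_rpow zero_le_one hp.le, Real.one_rpow,
      le_div_iff₀ (Real.rpow_pos_of_pos hp _)] at h
    rw [Real.rpow_sub_one hp.ne']
    have h3 : (1 + σ * (-x / (1 + x))) * (1 + x) ^ σ
        = (1 + x) ^ σ - σ * x * ((1 + x) ^ σ / (1 + x)) := by field_simp; ring
    linarith
  have h2 : (1 - x) ^ σ ≤ 1 - σ * x * (1 - x) ^ (σ - 1) := by
    have h := one_add_mul_self_le_rpow_one_add (s := x / (1 - x)) (p := σ)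
      (by have := div_nonneg hx hm.le; linarith) hσ
    have h2 : 1 + x / (1 - x) = 1 / (1 - x) := by field_simp; ring
    rw [h2, Real.div_rpow zero_le_one hm.le, Real.one_rpow,
      le_div_iff₀ (Real.rpow_pos_of_pos hm _)] at h
    rw [Real.rpow_sub_one hm.ne']
    have h3 : (1 + σ * (x / (1 - x))) * (1 - x) ^ σ
        = (1 - x) ^ σ + σ * x * ((1 - x) ^ σ / (1 - x)) := by field_simp
    linarith
  have h3 : 1 - σ * x ≤ (1 - x) ^ (σ - 1) := by
    have h := one_add_mul_self_le_rpow_one_add (s := -x) (p := σ) (by linarith) hσ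
    have h4 : (1 - x) ^ σ ≤ (1 - x) ^ (σ - 1) :=
      Real.rpow_le_rpow_of_exponent_ge hm (by linarith) (by linarith)
    have h5 : (1 + -x) ^ σ = (1 - x) ^ σ := by ring_nf
    linarith
  have h4 : (1 + x) ^ (σ - 1) ≤ 2 ^ σ := by
    calc (1 + x) ^ (σ - 1) ≤ (1 + x) ^ σ :=
          Real.rpow_le_rpow_of_exponent_le (by linarith) (by linarith)
      _ ≤ 2 ^ σ := Real.rpow_le_rpow hp.le (by linarith) (by linarith)
  have h5 : (1 + x) ^ (σ - 1) ≤ 1 + σ * x * 2 ^ σ := by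
    calc (1 + x) ^ (σ - 1) ≤ (1 + x) ^ σ :=
          Real.rpow_le_rpow_of_exponent_le (by linarith) (by linarith)
      _ ≤ 1 + σ * x * (1 + x) ^ (σ - 1) := h1
      _ ≤ _ := by gcongr
  have h6 : 0 ≤ σ * x := by positivity
  have h7 : σ * x * ((1 + x) ^ (σ - 1) - (1 - x) ^ (σ - 1)) ≤ σ * x * (σ * x * 2 ^ σ + σ * x) :=
    mul_le_mul_of_nonneg_left (by linarith) h6
  unfold gridConst
  nlinarith

/-- The graded grid is nearly self-similar: neighbouring steps differ by a relative `O(1/(j+1))`.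
This is the source of the additional power of the index in the consistency error. The case `j = 0`
is separate because it would need `x = 1` in the second difference. -/
theorem gridStep_sub_le (hτ : 0 < τ) (hσ : 1 ≤ σ) (j : ℕ) :
    gridStep τ σ (j + 1) - gridStep τ σ j ≤ gridConst σ / (j + 1) * gridStep τ σ j := by
  have hj : (0:ℝ) < (j:ℝ) + 1 := by positivity
  have hlow := gridStep_ge hτ hσ j
  have hC := gridConst_pos hσ
  have hmain : gridStep τ σ (j + 1) - gridStep τ σ j
      ≤ gridConst σ / (j + 1) * (grid τ σ (j + 1) / (j + 1)) := by
    rcases Nat.eq_zero_or_pos j with rfl | hjpos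
    · have h2 : (0:ℝ) < 2 ^ σ := by positivity
      simp only [gridStep, grid, gridConst]
      norm_num
      rw [Real.zero_rpow (by linarith)]
      have hσ2 : 1 ≤ σ ^ 2 := one_le_pow₀ hσ
      nlinarith [mul_pos hτ h2, mul_le_mul_of_nonneg_right hσ2
        (by positivity : 0 ≤ ((2:ℝ) ^ σ + 1) * τ)]
    · have hj1 : (1:ℝ) ≤ j := by exact_mod_cast hjpos
      have h := rpow_second_difference_le hσ (x := 1 / ((j:ℝ) + 1)) (by positivity)
        (by rw [div_lt_one hj]; linarith)
      have e1 : 1 + 1 / ((j:ℝ) + 1) = (j + 2) / (j + 1) := by field_simp; ring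
      have e2 : 1 - 1 / ((j:ℝ) + 1) = j / (j + 1) := by field_simp; ring
      have hpos : 0 < ((j:ℝ) + 1) ^ σ := by positivity
      rw [e1, e2, Real.div_rpow (by positivity) hj.le, Real.div_rpow (by positivity) hj.le] at h
      have h2 := mul_le_mul_of_nonneg_left h (mul_pos hτ hpos).le
      simp only [gridStep, grid]
      push_cast
      have e3 : (j:ℝ) + 1 + 1 = j + 2 := by ring
      rw [e3]
      have e4 : τ * ((j:ℝ) + 1) ^ σ * (((j:ℝ) + 2) ^ σ / ((j:ℝ) + 1) ^ σ
          + (j:ℝ) ^ σ / ((j:ℝ) + 1) ^ σ - 2)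
          = τ * ((j:ℝ) + 2) ^ σ - τ * ((j:ℝ) + 1) ^ σ - (τ * ((j:ℝ) + 1) ^ σ - τ * (j:ℝ) ^ σ) := by
        field_simp; ring
      have e5 : τ * ((j:ℝ) + 1) ^ σ * (gridConst σ * (1 / ((j:ℝ) + 1)) ^ 2)
          = gridConst σ / (j + 1) * (τ * ((j:ℝ) + 1) ^ σ / (j + 1)) := by
        field_simp
      rw [e4, e5] at h2
      exact h2
  exact hmain.trans (by gcongr)

theorem gridStep_le_succ (hτ : 0 < τ) (hσ : 1 ≤ σ) (j : ℕ) :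
    gridStep τ σ j ≤ gridStep τ σ (j + 1) := by
  have h := (convexOn_rpow hσ).2 (Set.mem_Ici.2 (by positivity : 0 ≤ (j:ℝ)))
    (Set.mem_Ici.2 (by positivity : 0 ≤ (j:ℝ) + 2)) (by norm_num : (0:ℝ) ≤ 1 / 2)
    (by norm_num : (0:ℝ) ≤ 1 / 2) (by norm_num)
  simp only [smul_eq_mul] at h
  have e : 1 / 2 * (j:ℝ) + 1 / 2 * (j + 2) = j + 1 := by ring
  rw [e] at h
  simp only [gridStep, grid]
  push_cast
  have e3 : (j:ℝ) + 1 + 1 = j + 2 := by ring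
  rw [e3]
  nlinarith

theorem gridStep_monotone (hτ : 0 < τ) (hσ : 1 ≤ σ) : Monotone (gridStep τ σ) :=
  monotone_nat_of_le_succ (gridStep_le_succ hτ hσ)

/-- Shifting both nodes by one index stretches their distance by a factor between `1` and `1 +
O(1/(j+1))`, as it does with every step between them. -/
theorem grid_shift (hτ : 0 < τ) (hσ : 1 ≤ σ) {j m : ℕ} (hjm : j ≤ m) :
    grid τ σ m - grid τ σ j ≤ grid τ σ (m + 1) - grid τ σ (j + 1) ∧
    grid τ σ (m + 1) - grid τ σ (j + 1)
      ≤ (1 + gridConst σ / (j + 1)) * (grid τ σ m - grid τ σ j) := by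
  induction m, hjm using Nat.le_induction with
  | base => simp
  | succ m hjm ih =>
    have h1 := gridStep_le_succ hτ hσ m
    have h2 := gridStep_sub_le hτ hσ m
    have h3 : gridConst σ / (m + 1) * gridStep τ σ m ≤ gridConst σ / (j + 1) * gridStep τ σ m := by
      have := (gridStep_pos hτ hσ m).le
      have := (gridConst_pos hσ).le
      gcongr
    simp only [gridStep] at h1 h2 h3
    constructor <;> nlinarith [ih.1, ih.2]

end Grid

/-! ### Singular moments of the quadratic bubble -/

/-- `∫ (t-s)^{-α} (s-a)(b-s) ds` over a cell `[a,b]` with `b ≤ t`, in terms of the cell length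
`h = b - a` and of `D = t - a`. -/
def bubbleMoment (α h D : ℝ) : ℝ :=
  h ^ 3 * ∫ x in (0:ℝ)..1, (D - h * x) ^ (-α) * (x * (1 - x))

section Bubble

variable {α : ℝ}

theorem integral_bubble_eq {a b t : ℝ} (hab : a < b) :
    ∫ s in a..b, (t - s) ^ (-α) * ((s - a) * (b - s)) = bubbleMoment α (b - a) (t - a) := by
  have h := intervalIntegral.integral_comp_add_mul (a := 0) (b := 1)
    (fun s => (t - s) ^ (-α) * ((s - a) * (b - s))) (sub_pos.2 hab).ne' a
  have hba : b - a ≠ 0 := (sub_pos.2 hab).ne'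
  simp only [mul_zero, add_zero, mul_one, add_sub_cancel, smul_eq_mul] at h
  rw [eq_inv_mul_iff_mul_eq₀ hba] at h
  rw [← h, bubbleMoment, ← intervalIntegral.integral_const_mul,
    ← intervalIntegral.integral_const_mul]
  refine intervalIntegral.integral_congr fun x _ => ?_
  have e1 : t - (a + (b - a) * x) = t - a - (b - a) * x := by ring
  rw [e1]
  ring

/-- A function vanishing at the right end of a cell can be integrated against the kernel. -/
theorem intervalIntegrable_singular {a b t M : ℝ} (hα₁ : 1 < α) (hα₂ : α < 2) (hab : a ≤ b)
    (hbt : b ≤ t) {v : ℝ → ℝ} (hv : ContinuousOn v (Set.Icc a b))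
    (hM : ∀ s ∈ Set.Icc a b, |v s| ≤ M * (b - s)) :
    IntervalIntegrable (fun s => (t - s) ^ (-α) * v s) volume a b := by
  have h1 := (intervalIntegrable_sub_rpow (t := b) (a := a) (b := b)
    (by linarith : -1 < 1 - α)).mul_const |M|
  rw [intervalIntegrable_iff_integrableOn_Ioc_of_le hab] at h1 ⊢
  refine h1.mono' ?_ ((ae_restrict_iff' measurableSet_Ioc).2 (ae_of_all _ fun s hs => ?_))
  · have h2 : Measurable fun s : ℝ => (t - s) ^ (-α) :=
      (measurable_const.sub measurable_id).pow_const _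
    exact h2.aestronglyMeasurable.mul
      ((hv.mono Set.Ioc_subset_Icc_self).aestronglyMeasurable measurableSet_Ioc)
  · have h3 := hM s ⟨hs.1.le, hs.2⟩
    rcases eq_or_lt_of_le hs.2 with rfl | hsb
    · have : v s = 0 := by simpa using h3
      rw [this, mul_zero, norm_zero, sub_self]
      positivity
    have h4 : (t - s) ^ (-α) ≤ (b - s) ^ (-α) :=
      Real.rpow_le_rpow_of_nonpos (by linarith) (by linarith) (by linarith)
    have h5 : 0 ≤ (t - s) ^ (-α) := Real.rpow_nonneg (by linarith) _
    have h6 : (b - s) ^ (1 - α) = (b - s) ^ (-α) * (b - s) := by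
      rw [← Real.rpow_add_one (by linarith)]; ring_nf
    rw [norm_mul, Real.norm_of_nonneg h5, h6, Real.norm_eq_abs, mul_assoc]
    have h7 : M * (b - s) ≤ (b - s) * |M| := by
      rw [mul_comm]
      exact mul_le_mul_of_nonneg_left (le_abs_self M) (by linarith)
    exact mul_le_mul h4 (h3.trans h7) (abs_nonneg _) (h5.trans h4)

theorem intervalIntegrable_bubble {a b t : ℝ} (hα₁ : 1 < α) (hα₂ : α < 2) (hab : a ≤ b)
    (hbt : b ≤ t) :
    IntervalIntegrable (fun s => (t - s) ^ (-α) * ((s - a) * (b - s))) volume a b := by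
  refine intervalIntegrable_singular (M := b - a) hα₁ hα₂ hab hbt (by fun_prop) fun s hs => ?_
  rw [abs_of_nonneg (mul_nonneg (by linarith [hs.1]) (by linarith [hs.2]))]
  exact mul_le_mul_of_nonneg_right (by linarith [hs.2]) (by linarith [hs.2])

theorem intervalIntegrable_bubble_unit {h D : ℝ} (hα₁ : 1 < α) (hα₂ : α < 2) (hh : 0 < h)
    (hD : h ≤ D) :
    IntervalIntegrable (fun x => (D - h * x) ^ (-α) * (x * (1 - x))) volume 0 1 := by
  have h1 := (intervalIntegrable_bubble (a := 0) (b := 1) (t := D / h) hα₁ hα₂ zero_le_one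
    (by rw [le_div_iff₀ hh]; linarith)).const_mul (h ^ (-α))
  refine h1.congr fun x hx => ?_
  rw [Set.uIoc_of_le zero_le_one] at hx
  have h2 : D - h * x = h * (D / h - x) := by field_simp
  have h3 : 0 ≤ D / h - x := by
    have : 1 ≤ D / h := by rw [le_div_iff₀ hh]; linarith
    linarith [hx.2]
  rw [h2, Real.mul_rpow hh.le h3]
  ring

theorem bubbleMoment_nonneg {h D : ℝ} (hh : 0 ≤ h) (hD : h ≤ D) : 0 ≤ bubbleMoment α h D := by
  refine mul_nonneg (pow_nonneg hh 3) (intervalIntegral.integral_nonneg zero_le_one fun x hx => ?_)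
  have h1 : h * x ≤ h := mul_le_of_le_one_right hh hx.2
  exact mul_nonneg (Real.rpow_nonneg (by linarith) _)
    (mul_nonneg hx.1 (by linarith [hx.2]))

/-- Since `D - h x = (D - h) + h (1 - x)`, the argument of the kernel is stretched pointwise by a
factor in `[1, 1 + ε]`. The integrand grows at most by `(1 + ε)³`, whence the constant, and the
kernel shrinks at most by `(1 + ε)^(-α) ≥ (1 + ε)^(-2) ≥ 1 - 2 ε`. -/
theorem abs_bubbleMoment_sub_le {h D h' D' ε : ℝ} (hα₁ : 1 < α) (hα₂ : α < 2) (hh : 0 < h)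
    (hD : h ≤ D) (hε : 0 ≤ ε) (h1 : h ≤ h') (h2 : h' ≤ (1 + ε) * h)
    (h3 : D - h ≤ D' - h') (h4 : D' - h' ≤ (1 + ε) * (D - h)) :
    |bubbleMoment α h' D' - bubbleMoment α h D| ≤ ε * (3 + 3 * ε + ε ^ 2) * bubbleMoment α h D := by
  have i1 := intervalIntegrable_bubble_unit hα₁ hα₂ hh hD
  have i2 := intervalIntegrable_bubble_unit hα₁ hα₂ (hh.trans_le h1) (by linarith : h' ≤ D')
  unfold bubbleMoment
  rw [← intervalIntegral.integral_const_mul, ← intervalIntegral.integral_const_mul,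
    ← intervalIntegral.integral_sub (i2.const_mul _) (i1.const_mul _),
    ← intervalIntegral.integral_const_mul, ← Real.norm_eq_abs]
  refine intervalIntegral.norm_integral_le_of_norm_le zero_le_one (ae_of_all _ fun x hx => ?_)
    ((i1.const_mul _).const_mul _)
  rcases eq_or_lt_of_le hx.2 with rfl | hx1
  · simp
  have hx0 : 0 ≤ 1 - x := by linarith
  set q := D - h * x with hq
  set p := D' - h' * x with hp
  have hq0 : 0 < q := by nlinarith
  have hqp : q ≤ p := by nlinarith
  have hpq : p ≤ (1 + ε) * q := by nlinarith
  have hw : 0 ≤ x * (1 - x) := mul_nonneg hx.1.le hx0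
  have hqα : 0 < q ^ (-α) := Real.rpow_pos_of_pos hq0 _
  have hpα : 0 < p ^ (-α) := Real.rpow_pos_of_pos (hq0.trans_le hqp) _
  have hup : p ^ (-α) ≤ q ^ (-α) := Real.rpow_le_rpow_of_nonpos hq0 hqp (by linarith)
  have hlo : (1 - 2 * ε) * q ^ (-α) ≤ p ^ (-α) := by
    have e1 : ((1 + ε) * q) ^ (-α) ≤ p ^ (-α) :=
      Real.rpow_le_rpow_of_nonpos (hq0.trans_le hqp) hpq (by linarith)
    have e2 : (1 + ε) ^ (-(2:ℝ)) ≤ (1 + ε) ^ (-α) :=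
      Real.rpow_le_rpow_of_exponent_le (by linarith) (by linarith)
    have e3 : 1 - 2 * ε ≤ (1 + ε) ^ (-(2:ℝ)) := by
      rw [Real.rpow_neg (by linarith), Real.rpow_two, ← one_div, le_div_iff₀ (by positivity)]
      nlinarith [pow_nonneg hε 3, sq_nonneg ε]
    rw [Real.mul_rpow (by linarith) hq0.le] at e1
    calc (1 - 2 * ε) * q ^ (-α) ≤ (1 + ε) ^ (-α) * q ^ (-α) := by
          gcongr; exact e3.trans e2
      _ ≤ _ := e1
  have hh3 : h ^ 3 ≤ h' ^ 3 := pow_le_pow_left₀ hh.le h1 3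
  have hh3' : h' ^ 3 ≤ (1 + ε) ^ 3 * h ^ 3 := by
    rw [← mul_pow]; exact pow_le_pow_left₀ (by linarith) h2 3
  have hP : h' ^ 3 * p ^ (-α) ≤ (1 + ε) ^ 3 * h ^ 3 * q ^ (-α) := by gcongr
  have hP' : h ^ 3 * ((1 - 2 * ε) * q ^ (-α)) ≤ h' ^ 3 * p ^ (-α) :=
    (mul_le_mul_of_nonneg_left hlo (by positivity)).trans
      (mul_le_mul_of_nonneg_right hh3 hpα.le)
  have hQ : 0 ≤ h ^ 3 * q ^ (-α) := by positivity
  have hkey : |h' ^ 3 * p ^ (-α) - h ^ 3 * q ^ (-α)|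
      ≤ ε * (3 + 3 * ε + ε ^ 2) * (h ^ 3 * q ^ (-α)) := by
    rw [abs_le]
    have hεQ : 0 ≤ ε * (h ^ 3 * q ^ (-α)) := by positivity
    have hεQ2 : 0 ≤ ε ^ 2 * (h ^ 3 * q ^ (-α)) := by positivity
    have hεQ3 : 0 ≤ ε ^ 3 * (h ^ 3 * q ^ (-α)) := by positivity
    constructor <;> nlinarith
  have e : h' ^ 3 * (p ^ (-α) * (x * (1 - x))) - h ^ 3 * (q ^ (-α) * (x * (1 - x)))
      = (h' ^ 3 * p ^ (-α) - h ^ 3 * q ^ (-α)) * (x * (1 - x)) := by ring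
  rw [Real.norm_eq_abs, e, abs_mul, abs_of_nonneg hw]
  calc _ ≤ ε * (3 + 3 * ε + ε ^ 2) * (h ^ 3 * q ^ (-α)) * (x * (1 - x)) := by gcongr
    _ = _ := by ring

theorem bubbleMoment_le_of_far {h D d : ℝ} (hα₁ : 1 < α) (hh : 0 < h) (hd : 0 < d)
    (hD : d ≤ D - h) : bubbleMoment α h D ≤ h ^ 3 * d ^ (-α) := by
  unfold bubbleMoment
  refine mul_le_mul_of_nonneg_left ?_ (by positivity)
  have h1 := intervalIntegral.norm_integral_le_of_norm_le_const (a := 0) (b := 1)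
    (f := fun x => (D - h * x) ^ (-α) * (x * (1 - x))) (C := d ^ (-α)) fun x hx => by
      rw [Set.uIoc_of_le zero_le_one] at hx
      have h2 : d ≤ D - h * x := by nlinarith [hx.2]
      have h3 : (D - h * x) ^ (-α) ≤ d ^ (-α) := Real.rpow_le_rpow_of_nonpos hd h2 (by linarith)
      have h4 : 0 ≤ (D - h * x) ^ (-α) := Real.rpow_nonneg (by linarith) _
      have h5 : 0 ≤ x * (1 - x) := mul_nonneg hx.1.le (by linarith [hx.2])
      rw [Real.norm_of_nonneg (mul_nonneg h4 h5)]
      have h6 : x * (1 - x) ≤ 1 := by nlinarith [hx.1, hx.2]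
      calc _ ≤ d ^ (-α) * 1 := mul_le_mul h3 h6 h5 (h4.trans h3)
        _ = _ := mul_one _
  simp only [sub_zero, abs_one, mul_one] at h1
  exact (le_abs_self _).trans h1

/-- The cell touching the node. One factor of the bubble weakens the singularity to `(1 - x)^(1 -
α)`, which is integrable because `α < 2`. -/
theorem bubbleMoment_self_le {h : ℝ} (hα₁ : 1 < α) (hα₂ : α < 2) (hh : 0 < h) :
    bubbleMoment α h h ≤ h ^ (3 - α) / (2 - α) := by
  have h1 : h ^ (3 - α) = h ^ 3 * h ^ (-α) := by
    rw [sub_eq_add_neg, Real.rpow_add hh]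
    norm_cast
  have h2 : ∫ x in (0:ℝ)..1, h ^ (-α) * (1 - x) ^ (1 - α) = h ^ (-α) * (1 / (2 - α)) := by
    rw [intervalIntegral.integral_const_mul,
      intervalIntegral.integral_comp_sub_left (fun x => x ^ (1 - α)) 1,
      integral_rpow (Or.inl (by linarith)), sub_self, sub_zero, Real.zero_rpow (by linarith),
      Real.one_rpow]
    ring_nf
  have h3 : ∫ x in (0:ℝ)..1, (h - h * x) ^ (-α) * (x * (1 - x))
      ≤ ∫ x in (0:ℝ)..1, h ^ (-α) * (1 - x) ^ (1 - α) := by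
    refine intervalIntegral.integral_mono_on zero_le_one
      (intervalIntegrable_bubble_unit hα₁ hα₂ hh le_rfl)
      ((intervalIntegrable_sub_rpow (by linarith)).const_mul _) fun x hx => ?_
    rcases eq_or_lt_of_le hx.2 with rfl | hx1
    · simp only [sub_self, mul_zero]
      positivity
    have e1 : h - h * x = h * (1 - x) := by ring
    have e2 : (1 - x) ^ (1 - α) = (1 - x) ^ (-α) * (1 - x) := by
      rw [← Real.rpow_add_one (by linarith)]; ring_nf
    have e3 : 0 ≤ (1 - x) ^ (-α) := Real.rpow_nonneg (by linarith) _
    have e4 : 0 ≤ h ^ (-α) := Real.rpow_nonneg hh.le _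
    rw [e1, Real.mul_rpow hh.le (by linarith), e2, mul_assoc]
    gcongr
    nlinarith
  unfold bubbleMoment
  calc _ ≤ h ^ 3 * (h ^ (-α) * (1 / (2 - α))) := by rw [← h2]; gcongr
    _ = _ := by rw [h1]; ring

/-- Away from the node the bubble is estimated by `h²` and the kernel integrated exactly, so that
these bounds telescope over the cells. -/
theorem bubbleMoment_le_sub {a b t h : ℝ} (hα₁ : 1 < α) (hα₂ : α < 2) (hab : a < b) (hbt : b < t)
    (hh : b - a ≤ h) :
    bubbleMoment α (b - a) (t - a)
      ≤ h ^ 2 * (((t - b) ^ (1 - α) - (t - a) ^ (1 - α)) / (α - 1)) := by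
  rw [← integral_bubble_eq hab]
  have hnot : (0:ℝ) ∉ Set.uIcc (t - b) (t - a) := by
    rw [Set.uIcc_of_le (by linarith)]
    intro h
    linarith [h.1]
  have h1 : ∫ s in a..b, (t - s) ^ (-α) = ((t - b) ^ (1 - α) - (t - a) ^ (1 - α)) / (α - 1) := by
    rw [intervalIntegral.integral_comp_sub_left (fun x => x ^ (-α)) t,
      integral_rpow (Or.inr ⟨by linarith, hnot⟩), ← neg_div_neg_eq]
    ring_nf
  have hi : IntervalIntegrable (fun s => (t - s) ^ (-α)) volume a b := by
    have := (intervalIntegral.intervalIntegrable_rpow (μ := volume) (r := -α)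
      (Or.inr (by rwa [Set.uIcc_comm] at hnot) : 0 ≤ -α ∨ (0:ℝ) ∉ Set.uIcc (t - a) (t - b))).comp_sub_left t
    simpa using this
  rw [← h1, ← intervalIntegral.integral_const_mul]
  refine intervalIntegral.integral_mono_on hab.le (intervalIntegrable_bubble hα₁ hα₂ hab.le hbt.le)
    (hi.const_mul _) fun s hs => ?_
  have h2 : 0 ≤ (t - s) ^ (-α) := Real.rpow_nonneg (by linarith [hs.2]) _
  rw [mul_comm]
  refine mul_le_mul_of_nonneg_right ?_ h2
  nlinarith [hs.1, hs.2]

end Bubble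

/-! ### Linear interpolation -/

/-- A function that vanishes at both ends of an interval and whose second derivative is at most
`-ψ''` in absolute value is bounded by `ψ`, if `ψ` vanishes at both ends, too. -/
theorem abs_le_of_abs_second_deriv_le {a b : ℝ} (hab : a ≤ b) {f f₁ f₂ ψ ψ₁ ψ₂ : ℝ → ℝ}
    (hf : ContinuousOn f (Set.Icc a b)) (hψ : ContinuousOn ψ (Set.Icc a b))
    (hf₁ : ∀ s ∈ Set.Ioo a b, HasDerivAt f (f₁ s) s)
    (hf₂ : ∀ s ∈ Set.Ioo a b, HasDerivAt f₁ (f₂ s) s)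
    (hψ₁ : ∀ s ∈ Set.Ioo a b, HasDerivAt ψ (ψ₁ s) s)
    (hψ₂ : ∀ s ∈ Set.Ioo a b, HasDerivAt ψ₁ (ψ₂ s) s)
    (hfa : f a = 0) (hfb : f b = 0) (hψa : ψ a = 0) (hψb : ψ b = 0)
    (h : ∀ s ∈ Set.Ioo a b, |f₂ s| ≤ -ψ₂ s) {s : ℝ} (hs : s ∈ Set.Icc a b) : |f s| ≤ ψ s := by
  have main : ∀ c : ℝ, |c| = 1 → 0 ≤ ψ s + c * f s := by
    intro c hc
    have hconc : ConcaveOn ℝ (Set.Icc a b) (fun s => ψ s + c * f s) := by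
      refine concaveOn_of_hasDerivWithinAt2_nonpos (convex_Icc a b)
        (f' := fun s => ψ₁ s + c * f₁ s) (f'' := fun s => ψ₂ s + c * f₂ s)
        (hψ.add (continuousOn_const.mul hf)) ?_ ?_ ?_ <;> rw [interior_Icc] <;> intro x hx
      · exact ((hψ₁ x hx).add ((hf₁ x hx).const_mul c)).hasDerivWithinAt
      · exact ((hψ₂ x hx).add ((hf₂ x hx).const_mul c)).hasDerivWithinAt
      · have h1 := h x hx
        have h2 : c * f₂ x ≤ |f₂ x| := by
          calc c * f₂ x ≤ |c * f₂ x| := le_abs_self _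
            _ = |f₂ x| := by rw [abs_mul, hc, one_mul]
        linarith
    have := hconc.min_le_of_mem_Icc (Set.left_mem_Icc.2 hab) (Set.right_mem_Icc.2 hab) hs
    simpa [hfa, hfb, hψa, hψb] using this
  have h1 := main 1 (by simp)
  have h2 := main (-1) (by simp)
  exact abs_le.2 ⟨by linarith, by linarith⟩

/-- The error of linear interpolation of `y` at `a` and `b`. -/
def interpError (y : ℝ → ℝ) (a b s : ℝ) : ℝ := y s - (y a + (s - a) * ((y b - y a) / (b - a)))

theorem interpError_left (y : ℝ → ℝ) (a b : ℝ) : interpError y a b a = 0 := by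
  simp [interpError]

theorem interpError_right (y : ℝ → ℝ) {a b : ℝ} (hab : a < b) : interpError y a b b = 0 := by
  have : b - a ≠ 0 := (sub_pos.2 hab).ne'
  simp only [interpError]
  field_simp
  ring

section

variable {α lam C : ℝ} {y y₁ y₂ y₃ : ℝ → ℝ}

theorem IsScalarSolution.continuous_interpError (H : IsScalarSolution α lam C y y₁ y₂ y₃)
    (a b : ℝ) : Continuous (interpError y a b) := by
  have := H.continuous
  unfold interpError
  fun_prop

theorem IsScalarSolution.hasDerivAt_interpError (H : IsScalarSolution α lam C y y₁ y₂ y₃)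
    (a b : ℝ) {s : ℝ} (hs : 0 < s) :
    HasDerivAt (interpError y a b) (y₁ s - (y b - y a) / (b - a)) s := by
  refine ((H.hasDerivAt s hs).sub ((((hasDerivAt_id s).sub_const a).mul_const
    ((y b - y a) / (b - a))).const_add (y a))).congr_deriv ?_
  simp

/-- The bubble has second derivative `-2`, so the function on the left has second derivative `y₂ -
Y` and zero boundary values. A multiple of the bubble is the comparison function. -/
theorem IsScalarSolution.abs_interpError_add_le (H : IsScalarSolution α lam C y y₁ y₂ y₃)
    {a b : ℝ} (ha : 0 ≤ a) (hab : a < b) {Y ε : ℝ} (h : ∀ s ∈ Set.Ioo a b, |y₂ s - Y| ≤ ε) {s : ℝ}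
    (hs : s ∈ Set.Icc a b) :
    |interpError y a b s + Y / 2 * ((s - a) * (b - s))| ≤ ε / 2 * ((s - a) * (b - s)) := by
  have hβ : ∀ s, HasDerivAt (fun s => (s - a) * (b - s)) ((b - s) - (s - a)) s := fun s =>
    (((hasDerivAt_id s).sub_const a).mul ((hasDerivAt_id s).const_sub b)).congr_deriv (by
      simp; ring)
  have hβ' : ∀ s, HasDerivAt (fun s => (b - s) - (s - a)) (-2) s := fun s =>
    (((hasDerivAt_id s).const_sub b).sub ((hasDerivAt_id s).sub_const a)).congr_deriv (by norm_num)
  refine abs_le_of_abs_second_deriv_le hab.le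
    (f := fun s => interpError y a b s + Y / 2 * ((s - a) * (b - s)))
    (f₁ := fun s => (y₁ s - (y b - y a) / (b - a)) + Y / 2 * ((b - s) - (s - a)))
    (f₂ := fun s => y₂ s + Y / 2 * (-2))
    (ψ := fun s => ε / 2 * ((s - a) * (b - s))) (ψ₁ := fun s => ε / 2 * ((b - s) - (s - a)))
    (ψ₂ := fun s => ε / 2 * (-2))
    (((H.continuous_interpError a b).add (by fun_prop)).continuousOn) (by fun_prop)
    (fun s hs => (H.hasDerivAt_interpError a b (lt_of_le_of_lt ha hs.1)).add
      ((hβ s).const_mul _))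
    (fun s hs => ((H.hasDerivAt₁ s (lt_of_le_of_lt ha hs.1)).sub_const _).add
      ((hβ' s).const_mul _))
    (fun s _ => (hβ s).const_mul _) (fun s _ => (hβ' s).const_mul _)
    (by simp [interpError_left]) (by simp [interpError_right y hab]) (by simp) (by simp)
    (fun s hs => ?_) hs
  have := h s hs
  rw [show y₂ s + Y / 2 * (-2) = y₂ s - Y by ring]
  linarith

/-- On the first cell the available bound on `y₂` is singular at the origin. The barrier `b^(α-1) s
- s^α`, suitably scaled, has exactly this bound as the negative of its second derivative, and is
itself estimated by the bubble. -/
theorem IsScalarSolution.abs_interpError_zero_le (hα₁ : 1 < α) (hα₂ : α < 2) (hC : 0 < C)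
    (hlam : 0 < lam) (H : IsScalarSolution α lam C y y₁ y₂ y₃)
    {b : ℝ} (hb : 0 < b) {s : ℝ} (hs : s ∈ Set.Icc 0 b) :
    |interpError y 0 b s| ≤ C * lam * b ^ (α - 2) / (α * (α - 1)) * (s * (b - s)) := by
  have hα0 : α ≠ 0 := by linarith
  have hα10 : α - 1 ≠ 0 := by linarith
  have h1 : |interpError y 0 b s|
      ≤ C * lam / (α * (α - 1)) * (b ^ (α - 1) * s - s ^ α) := by
    refine abs_le_of_abs_second_deriv_le hb.le
      (f₁ := fun s => y₁ s - (y b - y 0) / (b - 0)) (f₂ := y₂)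
      (ψ := fun s => C * lam / (α * (α - 1)) * (b ^ (α - 1) * s - s ^ α))
      (ψ₁ := fun s => C * lam / (α * (α - 1)) * (b ^ (α - 1) - α * s ^ (α - 1)))
      (ψ₂ := fun s => C * lam / (α * (α - 1)) * (0 - α * ((α - 1) * s ^ (α - 1 - 1))))
      (H.continuous_interpError 0 b).continuousOn ?_
      (fun s hs => H.hasDerivAt_interpError 0 b hs.1)
      (fun s hs => (H.hasDerivAt₁ s hs.1).sub_const _)
      (fun s hs => ?_) (fun s hs => ?_)
      (interpError_left y 0 b) (interpError_right y hb) ?_ ?_ (fun s hs => ?_) hs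
    · have : Continuous fun s : ℝ => s ^ α := Real.continuous_rpow_const (by linarith)
      fun_prop
    · refine HasDerivAt.const_mul _ (HasDerivAt.sub ?_
        (Real.hasDerivAt_rpow_const (Or.inl hs.1.ne')))
      simpa using (hasDerivAt_id s).const_mul (b ^ (α - 1))
    · exact HasDerivAt.const_mul _ ((hasDerivAt_const s _).sub
        ((Real.hasDerivAt_rpow_const (Or.inl hs.1.ne')).const_mul α))
    · simp [Real.zero_rpow hα0]
    · rw [← Real.rpow_add_one hb.ne']; simp
    · refine (H.bound₂ s hs.1).trans (le_of_eq ?_)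
      rw [show α - 1 - 1 = α - 2 by ring]
      field_simp
      ring
  refine h1.trans ?_
  rw [show C * lam * b ^ (α - 2) / (α * (α - 1)) * (s * (b - s))
    = C * lam / (α * (α - 1)) * (b ^ (α - 2) * (s * (b - s))) by ring]
  refine mul_le_mul_of_nonneg_left ?_ (by
    have : 0 < α - 1 := by linarith
    positivity)
  rcases eq_or_lt_of_le hs.1 with rfl | hs0
  · simp [Real.zero_rpow hα0]
  have e1 : s ^ α = s * s ^ (α - 1) := by
    rw [mul_comm, ← Real.rpow_add_one hs0.ne']; ring_nf
  have e2 : b ^ (α - 1) = b ^ (α - 2) * b := by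
    rw [← Real.rpow_add_one hb.ne']; ring_nf
  have e3 : s ^ (α - 1) = s ^ (α - 2) * s := by
    rw [← Real.rpow_add_one hs0.ne']; ring_nf
  have e4 : b ^ (α - 2) ≤ s ^ (α - 2) := Real.rpow_le_rpow_of_nonpos hs0 hs.2 (by linarith)
  rw [e1, e2, e3]
  nlinarith [mul_le_mul_of_nonneg_right e4 (mul_nonneg hs0.le hs0.le)]

theorem IsScalarSolution.abs_sub_le (hα₂ : α < 2) (hC : 0 < C) (hlam : 0 < lam)
    (H : IsScalarSolution α lam C y y₁ y₂ y₃) {a r s : ℝ} (ha : 0 < a) (hr : a ≤ r) (hrs : r ≤ s) :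
    |y₂ s - y₂ r| ≤ C * lam * a ^ (α - 3) * (s - r) := by
  have h := Convex.norm_image_sub_le_of_norm_hasDerivWithin_le (f := y₂) (f' := y₃)
    (C := C * lam * a ^ (α - 3)) (s := Set.Ici a) (x := r) (y := s)
    (fun x hx => (H.hasDerivAt₂ x (ha.trans_le hx)).hasDerivWithinAt) (fun x hx => ?_)
    (convex_Ici a) hr (hr.trans hrs)
  · rwa [Real.norm_eq_abs, Real.norm_eq_abs, abs_of_nonneg (sub_nonneg.2 hrs)] at h
  · rw [Real.norm_eq_abs]
    refine (H.bound₃ x (ha.trans_le hx)).trans ?_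
    have := Real.rpow_le_rpow_of_nonpos ha hx (by linarith : α - 3 ≤ 0)
    gcongr

end

/-! ### Weighted sums of bubble moments -/

section Sums

variable {α τ σ : ℝ}

/-- The moment of the bubble on the `j`-th cell, seen from the `m`-th node. -/
def cellMoment (α τ σ : ℝ) (m j : ℕ) : ℝ :=
  bubbleMoment α (gridStep τ σ j) (grid τ σ m - grid τ σ j)

theorem gridStep_le_sub (hτ : 0 < τ) (hσ : 1 ≤ σ) {m j : ℕ} (hj : j < m) :
    gridStep τ σ j ≤ grid τ σ m - grid τ σ j :=
  sub_le_sub_right ((grid_strictMono hτ hσ).monotone hj) _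

theorem cellMoment_nonneg (hτ : 0 < τ) (hσ : 1 ≤ σ) {m j : ℕ} (hj : j < m) :
    0 ≤ cellMoment α τ σ m j :=
  bubbleMoment_nonneg (gridStep_pos hτ hσ j).le (gridStep_le_sub hτ hσ hj)

/-- Constant in the comparison of bubble moments of neighbouring cells. -/
def shiftConst (σ : ℝ) : ℝ := gridConst σ * (3 + 3 * gridConst σ + gridConst σ ^ 2)

theorem shiftConst_pos (hσ : 1 ≤ σ) : 0 < shiftConst σ := by
  have := gridConst_pos hσ
  unfold shiftConst; positivity

theorem abs_cellMoment_shift_le (hα₁ : 1 < α) (hα₂ : α < 2) (hτ : 0 < τ) (hσ : 1 ≤ σ) {m j : ℕ}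
    (hj : j < m) :
    |cellMoment α τ σ (m + 1) (j + 1) - cellMoment α τ σ m j|
      ≤ shiftConst σ / (j + 1) * cellMoment α τ σ m j := by
  have hc := gridConst_pos hσ
  have hj1 : (1:ℝ) ≤ (j:ℝ) + 1 := by linarith [(Nat.cast_nonneg j : (0:ℝ) ≤ j)]
  set ε := gridConst σ / ((j:ℝ) + 1) with hε
  have hε0 : 0 ≤ ε := by positivity
  have hεc : ε ≤ gridConst σ := div_le_self hc.le hj1
  have hs := grid_shift hτ hσ (Nat.succ_le_of_lt hj)
  have hs2 : gridConst σ / (((j + 1 : ℕ) : ℝ) + 1) ≤ ε := by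
    rw [hε]; push_cast
    exact div_le_div_of_nonneg_left hc.le (by linarith) (by linarith)
  have hge : 0 ≤ grid τ σ m - grid τ σ (j + 1) :=
    sub_nonneg.2 ((grid_strictMono hτ hσ).monotone hj)
  have h := abs_bubbleMoment_sub_le (α := α) (h := gridStep τ σ j)
    (D := grid τ σ m - grid τ σ j) (h' := gridStep τ σ (j + 1))
    (D' := grid τ σ (m + 1) - grid τ σ (j + 1)) (ε := ε) hα₁ hα₂ (gridStep_pos hτ hσ j)
    (gridStep_le_sub hτ hσ hj) hε0 (gridStep_le_succ hτ hσ j)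
    (by have := gridStep_sub_le hτ hσ j; rw [← hε] at this; linarith)
    (by simp only [gridStep]; linarith [hs.1])
    (by
      simp only [gridStep]
      have h1 := hs.2
      have h2 := mul_le_mul_of_nonneg_right hs2 hge
      simp only [Nat.succ_eq_add_one] at h1
      rw [show grid τ σ m - grid τ σ j - (grid τ σ (j + 1) - grid τ σ j)
        = grid τ σ m - grid τ σ (j + 1) by ring]
      linarith)
  refine h.trans (mul_le_mul_of_nonneg_right ?_ (cellMoment_nonneg hτ hσ hj))
  rw [shiftConst, mul_div_right_comm, ← hε]
  gcongr

/-- The weighted sum of bubble moments that controls the consistency error. -/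
def momentSum (α τ σ : ℝ) (m : ℕ) : ℝ :=
  ∑ j ∈ Finset.range m, ((j:ℝ) + 1)⁻¹ * grid τ σ (j + 1) ^ (α - 2) * cellMoment α τ σ m j

/-- The steps increase, so the last one may replace all others in the far cells, whose bounds
telescope to the kernel at distance one step. The last cell touches the node and is treated by
`bubbleMoment_self_le`. -/
theorem sum_cellMoment_le (hα₁ : 1 < α) (hα₂ : α < 2) (hτ : 0 < τ) (hσ : 1 ≤ σ) (m : ℕ) :
    ∑ j ∈ Finset.range (m + 1), cellMoment α τ σ (m + 1) j
      ≤ (1 / (2 - α) + 1 / (α - 1)) * gridStep τ σ m ^ (3 - α) := by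
  have hmono := grid_strictMono hτ hσ
  have hh := gridStep_pos hτ hσ m
  have h2α : 0 < 2 - α := by linarith
  have hα1 : 0 < α - 1 := by linarith
  rw [Finset.sum_range_succ]
  have hlast : cellMoment α τ σ (m + 1) m ≤ gridStep τ σ m ^ (3 - α) / (2 - α) :=
    bubbleMoment_self_le hα₁ hα₂ hh
  set f : ℕ → ℝ := fun j => (grid τ σ (m + 1) - grid τ σ j) ^ (1 - α) with hf
  have hrest : ∑ j ∈ Finset.range m, cellMoment α τ σ (m + 1) j
      ≤ ∑ j ∈ Finset.range m, gridStep τ σ m ^ 2 / (α - 1) * (f (j + 1) - f j) := by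
    refine Finset.sum_le_sum fun j hj => ?_
    have hjm := Finset.mem_range.1 hj
    refine (bubbleMoment_le_sub hα₁ hα₂ (hmono (Nat.lt_succ_self j))
      (hmono (Nat.succ_lt_succ hjm)) (gridStep_monotone hτ hσ hjm.le)).trans (le_of_eq ?_)
    simp only [hf]
    ring
  rw [← Finset.mul_sum, Finset.sum_range_sub] at hrest
  have hf0 : 0 ≤ f 0 :=
    Real.rpow_nonneg (sub_nonneg.2 (hmono.monotone (Nat.zero_le _))) _
  have hfm : f m = gridStep τ σ m ^ (1 - α) := rfl
  have hpow : gridStep τ σ m ^ (3 - α) = gridStep τ σ m ^ 2 * gridStep τ σ m ^ (1 - α) := by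
    rw [show 3 - α = (2:ℕ) + (1 - α) by push_cast; ring, Real.rpow_add hh, Real.rpow_natCast]
  have h3 : gridStep τ σ m ^ 2 / (α - 1) * (f m - f 0)
      ≤ gridStep τ σ m ^ 2 / (α - 1) * f m := by
    gcongr; linarith
  rw [hfm] at h3 hrest
  have e1 : 1 / (α - 1) * (gridStep τ σ m ^ 2 * gridStep τ σ m ^ (1 - α))
    = gridStep τ σ m ^ 2 / (α - 1) * gridStep τ σ m ^ (1 - α) := by ring
  have e2 : 1 / (2 - α) * (gridStep τ σ m ^ 2 * gridStep τ σ m ^ (1 - α))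
    = gridStep τ σ m ^ 2 * gridStep τ σ m ^ (1 - α) / (2 - α) := by ring
  rw [add_mul, hpow, e1, e2]
  rw [hpow] at hlast
  linarith

/-- The cells are split at half the index. In the near half the weight is comparable to its value at
the last cell and `sum_cellMoment_le` applies. In the far half the kernel is comparable to `G^(-α)`,
and the grading leaves the convergent series `∑ (j+1)^(-α)`. -/
theorem momentSum_le (hα₁ : 1 < α) (hα₂ : α < 2) (hσ : 1 ≤ σ)
    (hσα : 4 - α ≤ σ * (α + 1)) :
    ∃ K : ℝ, 0 < K ∧ ∀ τ : ℝ, 0 < τ → ∀ m : ℕ,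
      momentSum α τ σ (m + 1) ≤ K * (grid τ σ (m + 1) * ((m:ℝ) + 1) ^ (α - 4)) := by
  have h2α : 0 < 2 - α := by linarith
  have hα1 : 0 < α - 1 := by linarith
  have hsum : Summable fun j : ℕ => ((j:ℝ) + 1) ^ (-α) := by
    have := (summable_nat_add_iff 1).2 (Real.summable_nat_rpow.2 (by linarith : -α < -1))
    simpa using this
  set S := ∑' j : ℕ, ((j:ℝ) + 1) ^ (-α) with hS
  have hS0 : 0 ≤ S := tsum_nonneg fun j => by positivity
  set K₁ := σ ^ 3 * 2 ^ α with hK₁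
  set K₂ := 2 * (2 ^ σ) ^ (2 - α) * ((1 / (2 - α) + 1 / (α - 1)) * σ ^ (3 - α)) with hK₂
  have hK₁0 : 0 < K₁ := by positivity
  have hK₂0 : 0 < K₂ := by positivity
  refine ⟨K₁ * S + K₂, by positivity, fun τ hτ m => ?_⟩
  have hmono := grid_strictMono hτ hσ
  set G := grid τ σ (m + 1) with hG
  have hG0 : 0 < G := grid_succ_pos hτ m
  have hm1 : (0:ℝ) < (m:ℝ) + 1 := by positivity
  have hpt : ∀ j ∈ Finset.range (m + 1),
      ((j:ℝ) + 1)⁻¹ * grid τ σ (j + 1) ^ (α - 2) * cellMoment α τ σ (m + 1) j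
        ≤ K₁ * (G * ((m:ℝ) + 1) ^ (α - 4)) * ((j:ℝ) + 1) ^ (-α)
          + 2 * (2 ^ σ) ^ (2 - α) * G ^ (α - 2) / (m + 1) * cellMoment α τ σ (m + 1) j := by
    intro j hj
    have hjm : j < m + 1 := Finset.mem_range.1 hj
    have hj1 : (0:ℝ) < (j:ℝ) + 1 := by positivity
    have hg0 : 0 < grid τ σ (j + 1) := grid_succ_pos hτ j
    have hB := cellMoment_nonneg (α := α) hτ hσ hjm
    have hratio : grid τ σ (j + 1) = G * (((j:ℝ) + 1) / (m + 1)) ^ σ := by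
      rw [hG]; simp only [grid]; push_cast
      rw [Real.div_rpow hj1.le hm1.le]
      field_simp
    rcases le_total (2 * ((j:ℝ) + 1)) ((m:ℝ) + 1) with hfar | hnear
    · have hx : ((j:ℝ) + 1) / (m + 1) ≤ 1 / 2 := by
        rw [div_le_div_iff₀ hm1 two_pos]; linarith
      have hx0 : 0 < ((j:ℝ) + 1) / (m + 1) := by positivity
      set x := ((j:ℝ) + 1) / (m + 1) with hxdef
      have hxσ : x ^ σ ≤ 1 / 2 := by
        calc x ^ σ ≤ x ^ (1:ℝ) :=
              Real.rpow_le_rpow_of_exponent_ge hx0 (by linarith) hσ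
          _ ≤ 1 / 2 := by rw [Real.rpow_one]; exact hx
      have hd : G / 2 ≤ (G - grid τ σ j) - gridStep τ σ j := by
        simp only [gridStep]
        rw [hratio]
        nlinarith
      have h1 : cellMoment α τ σ (m + 1) j ≤ gridStep τ σ j ^ 3 * (G / 2) ^ (-α) :=
        bubbleMoment_le_of_far hα₁ (gridStep_pos hτ hσ j) (by positivity) hd
      have h2 : gridStep τ σ j ^ 3 ≤ (σ * grid τ σ (j + 1) / (j + 1)) ^ 3 :=
        pow_le_pow_left₀ (gridStep_pos hτ hσ j).le (gridStep_le hτ hσ j) 3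
      have h3 : (G / 2) ^ (-α) = 2 ^ α * G ^ (-α) := by
        rw [Real.div_rpow hG0.le two_pos.le, Real.rpow_neg two_pos.le, div_inv_eq_mul, mul_comm]
      have h4 : grid τ σ (j + 1) ^ (α - 2) * grid τ σ (j + 1) ^ 3
          = grid τ σ (j + 1) ^ (α + 1) := by
        rw [← Real.rpow_natCast, ← Real.rpow_add hg0]; norm_num; ring_nf
      -- The condition on the grading enters here: the exponent `σ (α + 1)` of `x ≤ 1 / 2` may be
      -- lowered to `4 - α`.
      have h5 : grid τ σ (j + 1) ^ (α + 1) ≤ G ^ (α + 1) * x ^ (4 - α) := by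
        rw [hratio, Real.mul_rpow hG0.le (by positivity), ← Real.rpow_mul hx0.le]
        exact mul_le_mul_of_nonneg_left
          (Real.rpow_le_rpow_of_exponent_ge hx0 (by linarith) hσα) (by positivity)
      have h6 : G ^ (α + 1) * G ^ (-α) = G := by
        rw [← Real.rpow_add hG0, show α + 1 + -α = 1 by ring, Real.rpow_one]
      have h7 : x ^ (4 - α) = ((j:ℝ) + 1) ^ 4 * ((j:ℝ) + 1) ^ (-α) * ((m:ℝ) + 1) ^ (α - 4) := by
        rw [hxdef, Real.div_rpow hj1.le hm1.le, div_eq_mul_inv, ← Real.rpow_neg hm1.le,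
          show -(4 - α) = α - 4 by ring, show 4 - α = ((4:ℕ):ℝ) + -α by push_cast; ring,
          Real.rpow_add hj1, Real.rpow_natCast]
      have hGα : 0 ≤ G ^ (-α) := by positivity
      have hgα : 0 ≤ grid τ σ (j + 1) ^ (α - 2) := by positivity
      refine le_add_of_le_of_nonneg ?_ (by positivity)
      calc ((j:ℝ) + 1)⁻¹ * grid τ σ (j + 1) ^ (α - 2) * cellMoment α τ σ (m + 1) j
          ≤ ((j:ℝ) + 1)⁻¹ * grid τ σ (j + 1) ^ (α - 2)
            * ((σ * grid τ σ (j + 1) / (j + 1)) ^ 3 * (2 ^ α * G ^ (-α))) := by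
            rw [h3] at h1
            gcongr
            exact h1.trans (by gcongr)
        _ = K₁ * (((j:ℝ) + 1) ^ 4)⁻¹
            * (grid τ σ (j + 1) ^ (α - 2) * grid τ σ (j + 1) ^ 3) * G ^ (-α) := by
            rw [hK₁]; field_simp
        _ ≤ K₁ * (((j:ℝ) + 1) ^ 4)⁻¹ * (G ^ (α + 1) * x ^ (4 - α)) * G ^ (-α) := by
            rw [h4]; gcongr
        _ = K₁ * (((j:ℝ) + 1) ^ 4)⁻¹ * (G ^ (α + 1) * G ^ (-α)) * x ^ (4 - α) := by ring
        _ = _ := by rw [h6, h7]; field_simp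
    · refine le_add_of_nonneg_of_le (by positivity) ?_
      refine mul_le_mul_of_nonneg_right ?_ hB
      have h1 : ((j:ℝ) + 1)⁻¹ ≤ 2 / (m + 1) := by
        rw [inv_eq_one_div, div_le_div_iff₀ hj1 hm1]; linarith
      have h2 : G * (2 ^ σ)⁻¹ ≤ grid τ σ (j + 1) := by
        rw [hratio, ← Real.inv_rpow two_pos.le]
        gcongr
        rw [inv_eq_one_div, div_le_div_iff₀ two_pos hm1]; linarith
      have h3 : grid τ σ (j + 1) ^ (α - 2) ≤ (G * (2 ^ σ)⁻¹) ^ (α - 2) :=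
        Real.rpow_le_rpow_of_nonpos (by positivity) h2 (by linarith)
      have h4 : (G * (2 ^ σ)⁻¹) ^ (α - 2) = G ^ (α - 2) * (2 ^ σ) ^ (2 - α) := by
        rw [Real.mul_rpow hG0.le (by positivity), Real.inv_rpow (by positivity),
          ← Real.rpow_neg (by positivity)]
        ring_nf
      rw [h4] at h3
      calc ((j:ℝ) + 1)⁻¹ * grid τ σ (j + 1) ^ (α - 2)
          ≤ 2 / (m + 1) * (G ^ (α - 2) * (2 ^ σ) ^ (2 - α)) := by gcongr
        _ = _ := by ring
  have htot := Finset.sum_le_sum hpt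
  rw [Finset.sum_add_distrib, ← Finset.mul_sum, ← Finset.mul_sum] at htot
  have hS1 : ∑ j ∈ Finset.range (m + 1), ((j:ℝ) + 1) ^ (-α) ≤ S :=
    hsum.sum_le_tsum _ fun j _ => by positivity
  have hB1 := sum_cellMoment_le hα₁ hα₂ hτ hσ m
  have hstep : gridStep τ σ m ^ (3 - α) ≤ σ ^ (3 - α) * (G ^ (3 - α) / ((m:ℝ) + 1) ^ (3 - α)) := by
    rw [← Real.div_rpow hG0.le hm1.le, ← Real.mul_rpow (by linarith) (by positivity),
      ← mul_div_assoc]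
    exact Real.rpow_le_rpow (gridStep_pos hτ hσ m).le (gridStep_le hτ hσ m) (by linarith)
  have e1 : G ^ (α - 2) * G ^ (3 - α) = G := by
    rw [← Real.rpow_add hG0, show α - 2 + (3 - α) = 1 by ring, Real.rpow_one]
  have e2 : ((m:ℝ) + 1)⁻¹ * (((m:ℝ) + 1) ^ (3 - α))⁻¹ = ((m:ℝ) + 1) ^ (α - 4) := by
    rw [← Real.rpow_neg_one, ← Real.rpow_neg hm1.le, ← Real.rpow_add hm1]
    ring_nf
  have hfirst : K₁ * (G * ((m:ℝ) + 1) ^ (α - 4)) * ∑ j ∈ Finset.range (m + 1), ((j:ℝ) + 1) ^ (-α)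
      ≤ K₁ * (G * ((m:ℝ) + 1) ^ (α - 4)) * S := by gcongr
  have hsecond : 2 * (2 ^ σ) ^ (2 - α) * G ^ (α - 2) / (m + 1) *
      ∑ j ∈ Finset.range (m + 1), cellMoment α τ σ (m + 1) j
      ≤ K₂ * (G * ((m:ℝ) + 1) ^ (α - 4)) := by
    calc _ ≤ 2 * (2 ^ σ) ^ (2 - α) * G ^ (α - 2) / (m + 1) *
          ((1 / (2 - α) + 1 / (α - 1)) *
            (σ ^ (3 - α) * (G ^ (3 - α) / ((m:ℝ) + 1) ^ (3 - α)))) := by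
          gcongr
          exact hB1.trans (by gcongr)
      _ = K₂ * ((G ^ (α - 2) * G ^ (3 - α)) * (((m:ℝ) + 1)⁻¹ * (((m:ℝ) + 1) ^ (3 - α))⁻¹)) := by
          rw [hK₂]; ring
      _ = _ := by rw [e1, e2]
  rw [momentSum]
  calc _ ≤ _ := htot
    _ ≤ K₁ * (G * ((m:ℝ) + 1) ^ (α - 4)) * S + K₂ * (G * ((m:ℝ) + 1) ^ (α - 4)) :=
        add_le_add hfirst hsecond
    _ = _ := by ring

end Sums

/-! ### The consistency error -/

section Consistency

variable {α τ σ lam C : ℝ} {y y₁ y₂ y₃ : ℝ → ℝ}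

/-- The contribution of the `j`-th cell to the consistency error at the `m`-th node. -/
def interpMoment (α τ σ : ℝ) (y : ℝ → ℝ) (m j : ℕ) : ℝ :=
  ∫ s in grid τ σ j..grid τ σ (j + 1),
    (grid τ σ m - s) ^ (-α) * interpError y (grid τ σ j) (grid τ σ (j + 1)) s

/-- The sum of the contributions of all cells to the consistency error at the `m`-th node. -/
def interpSum (α τ σ : ℝ) (y : ℝ → ℝ) (m : ℕ) : ℝ :=
  ∑ j ∈ Finset.range m, interpMoment α τ σ y m j

/-- The weight in `momentSum`. -/
def cellScale (α τ σ : ℝ) (j : ℕ) : ℝ := ((j:ℝ) + 1)⁻¹ * grid τ σ (j + 1) ^ (α - 2)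

theorem cellScale_nonneg (hτ : 0 < τ) (j : ℕ) : 0 ≤ cellScale α τ σ j := by
  have := grid_succ_pos (σ := σ) hτ j
  unfold cellScale
  positivity

/-- Constant in the expansion of the interpolation error on a cell. -/
def cellConst (α σ : ℝ) : ℝ := 1 / (α * (α - 1)) + 1 / 2 + σ * (2 ^ σ) ^ (3 - α)

theorem cellConst_pos (hα₁ : 1 < α) (hσ : 1 ≤ σ) : 0 < cellConst α σ := by
  have : 0 < α - 1 := by linarith
  unfold cellConst
  positivity

/-- Up to `C lam` the left side bounds the variation of `y₂` over the cell. The origin is excluded,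
where the bound on `y₃` is useless. -/
theorem gridStep_mul_rpow_le (hα₂ : α < 2) (hτ : 0 < τ) (hσ : 1 ≤ σ) {j : ℕ} (hj : 1 ≤ j) :
    gridStep τ σ j * grid τ σ j ^ (α - 3) ≤ σ * (2 ^ σ) ^ (3 - α) * cellScale α τ σ j := by
  set b := grid τ σ (j + 1) with hb
  have hb0 : 0 < b := grid_succ_pos hτ j
  have h2 := grid_succ_le hτ hσ hj
  have h2σ : (0:ℝ) < 2 ^ σ := by positivity
  have hle : b / 2 ^ σ ≤ grid τ σ j := by rw [div_le_iff₀ h2σ]; linarith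
  have h3 : grid τ σ j ^ (α - 3) ≤ (b / 2 ^ σ) ^ (α - 3) :=
    Real.rpow_le_rpow_of_nonpos (by positivity) hle (by linarith)
  have h4 : (b / 2 ^ σ) ^ (α - 3) = b ^ (α - 3) * (2 ^ σ) ^ (3 - α) := by
    rw [Real.div_rpow hb0.le h2σ.le, div_eq_mul_inv, ← Real.rpow_neg h2σ.le]
    ring_nf
  have h5 : b ^ (α - 2) = b ^ (α - 3) * b := by
    rw [← Real.rpow_add_one hb0.ne']; ring_nf
  calc gridStep τ σ j * grid τ σ j ^ (α - 3)
      ≤ (σ * b / (j + 1)) * (b ^ (α - 3) * (2 ^ σ) ^ (3 - α)) := by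
        refine mul_le_mul (gridStep_le hτ hσ j) (h3.trans_eq h4)
          (Real.rpow_nonneg (grid_nonneg hτ j) _) (by positivity)
    _ = _ := by rw [cellScale, ← hb, h5]; ring

/-- The leading part is a bubble with a constant coefficient; freezing `y₂` at the right end costs
its variation, which gains the factor `1/(j+1)` in `cellScale`. On the first cell nothing is gained,
but this factor is then `1` and size bounds suffice. -/
theorem IsScalarSolution.abs_interpError_cell_le (hα₁ : 1 < α) (hα₂ : α < 2) (hC : 0 < C)
    (hlam : 0 < lam) (H : IsScalarSolution α lam C y y₁ y₂ y₃) (hτ : 0 < τ) (hσ : 1 ≤ σ) (j : ℕ)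
    {s : ℝ} (hs : s ∈ Set.Icc (grid τ σ j) (grid τ σ (j + 1))) :
    |interpError y (grid τ σ j) (grid τ σ (j + 1)) s
        + y₂ (grid τ σ (j + 1)) / 2 * ((s - grid τ σ j) * (grid τ σ (j + 1) - s))|
      ≤ cellConst α σ * (C * lam) * cellScale α τ σ j
        * ((s - grid τ σ j) * (grid τ σ (j + 1) - s)) := by
  have hα1 : 0 < α - 1 := by linarith
  have hβ : 0 ≤ (s - grid τ σ j) * (grid τ σ (j + 1) - s) :=
    mul_nonneg (by linarith [hs.1]) (by linarith [hs.2])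
  have hb0 : 0 < grid τ σ (j + 1) := grid_succ_pos hτ j
  rcases Nat.eq_zero_or_pos j with rfl | hj
  · rw [grid_zero hσ] at hs hβ ⊢
    simp only [zero_add, sub_zero] at *
    set b := grid τ σ 1
    have h1 := H.abs_interpError_zero_le hα₁ hα₂ hC hlam hb0 hs
    have h2 := H.bound₂ b hb0
    have h3 : |y₂ b / 2 * (s * (b - s))| ≤ C * lam * b ^ (α - 2) / 2 * (s * (b - s)) := by
      rw [abs_mul, abs_of_nonneg hβ, abs_div, abs_two]
      gcongr
    refine (abs_add_le _ _).trans ((add_le_add h1 h3).trans ?_)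
    have h4 : cellScale α τ σ 0 = b ^ (α - 2) := by simp [cellScale, b]
    rw [h4, ← add_mul]
    refine mul_le_mul_of_nonneg_right ?_ hβ
    have h5 : 0 ≤ σ * (2 ^ σ) ^ (3 - α) * (C * lam * b ^ (α - 2)) := by positivity
    rw [cellConst]
    calc _ ≤ C * lam * b ^ (α - 2) / (α * (α - 1)) + C * lam * b ^ (α - 2) / 2
          + σ * (2 ^ σ) ^ (3 - α) * (C * lam * b ^ (α - 2)) := by linarith
      _ = _ := by ring
  · have hmono := grid_strictMono hτ hσ
    have ha0 : 0 < grid τ σ j := by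
      have := hmono hj
      rwa [grid_zero hσ] at this
    refine (H.abs_interpError_add_le ha0.le (hmono (Nat.lt_succ_self j))
      (ε := C * lam * (gridStep τ σ j * grid τ σ j ^ (α - 3))) (fun r hr => ?_) hs).trans ?_
    · rw [abs_sub_comm]
      refine (H.abs_sub_le hα₂ hC hlam ha0 hr.1.le hr.2.le).trans ?_
      rw [show C * lam * (gridStep τ σ j * grid τ σ j ^ (α - 3))
        = C * lam * grid τ σ j ^ (α - 3) * gridStep τ σ j by ring]
      have : grid τ σ (j + 1) - r ≤ gridStep τ σ j := by
        simp only [gridStep]; linarith [hr.1]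
      gcongr
    · refine mul_le_mul_of_nonneg_right ?_ hβ
      have h1 := gridStep_mul_rpow_le hα₂ hτ hσ hj
      have h0 : 0 ≤ C * lam * (gridStep τ σ j * grid τ σ j ^ (α - 3)) := by
        have := (gridStep_pos hτ hσ j).le
        positivity
      have hsc := cellScale_nonneg (α := α) (σ := σ) hτ j
      calc _ ≤ C * lam * (gridStep τ σ j * grid τ σ j ^ (α - 3)) := by linarith
        _ ≤ C * lam * (σ * (2 ^ σ) ^ (3 - α) * cellScale α τ σ j) := by gcongr
        _ = σ * (2 ^ σ) ^ (3 - α) * (C * lam) * cellScale α τ σ j := by ring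
        _ ≤ _ := by
          gcongr
          rw [cellConst]
          have : 0 < 1 / (α * (α - 1)) := by positivity
          linarith

theorem IsScalarSolution.exists_abs_interpError_le (hα₁ : 1 < α) (hα₂ : α < 2) (hC : 0 < C)
    (hlam : 0 < lam) (H : IsScalarSolution α lam C y y₁ y₂ y₃) (hτ : 0 < τ) (hσ : 1 ≤ σ) (j : ℕ) :
    ∃ M : ℝ, ∀ s ∈ Set.Icc (grid τ σ j) (grid τ σ (j + 1)),
      |interpError y (grid τ σ j) (grid τ σ (j + 1)) s| ≤ M * (grid τ σ (j + 1) - s) := by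
  set M := cellConst α σ * (C * lam) * cellScale α τ σ j + |y₂ (grid τ σ (j + 1)) / 2|
  refine ⟨M * gridStep τ σ j, fun s hs => ?_⟩
  have hs1 : 0 ≤ s - grid τ σ j := by linarith [hs.1]
  have hs2 : 0 ≤ grid τ σ (j + 1) - s := by linarith [hs.2]
  have hs3 : s - grid τ σ j ≤ gridStep τ σ j := by simp only [gridStep]; linarith [hs.2]
  have h := H.abs_interpError_cell_le hα₁ hα₂ hC hlam hτ hσ j hs
  have hsc := cellScale_nonneg (α := α) (σ := σ) hτ j
  have hcc := cellConst_pos hα₁ hσ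
  have hM : 0 ≤ M := by positivity
  set β := (s - grid τ σ j) * (grid τ σ (j + 1) - s) with hβ
  have hβ0 : 0 ≤ β := mul_nonneg hs1 hs2
  have h1 : |interpError y (grid τ σ j) (grid τ σ (j + 1)) s| ≤ M * β := by
    have h2 := abs_add_le (interpError y (grid τ σ j) (grid τ σ (j + 1)) s
      + y₂ (grid τ σ (j + 1)) / 2 * β) (-(y₂ (grid τ σ (j + 1)) / 2 * β))
    rw [add_neg_cancel_right, abs_neg, abs_mul (y₂ _ / 2), abs_of_nonneg hβ0] at h2
    simp only [M, add_mul]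
    linarith
  refine h1.trans ?_
  rw [mul_assoc]
  exact mul_le_mul_of_nonneg_left (mul_le_mul_of_nonneg_right hs3 hs2) hM

theorem IsScalarSolution.intervalIntegrable_interpError (hα₁ : 1 < α) (hα₂ : α < 2) (hC : 0 < C)
    (hlam : 0 < lam) (H : IsScalarSolution α lam C y y₁ y₂ y₃) (hτ : 0 < τ) (hσ : 1 ≤ σ)
    {m j : ℕ} (hj : j < m) :
    IntervalIntegrable (fun s => (grid τ σ m - s) ^ (-α)
      * interpError y (grid τ σ j) (grid τ σ (j + 1)) s) volume (grid τ σ j)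
      (grid τ σ (j + 1)) := by
  have hmono := grid_strictMono hτ hσ
  obtain ⟨M, hM⟩ := H.exists_abs_interpError_le hα₁ hα₂ hC hlam hτ hσ j
  exact intervalIntegrable_singular hα₁ hα₂ (hmono.monotone j.le_succ) (hmono.monotone hj)
    (H.continuous_interpError _ _).continuousOn hM

theorem IsScalarSolution.abs_interpMoment_add_le (hα₁ : 1 < α) (hα₂ : α < 2) (hC : 0 < C)
    (hlam : 0 < lam) (H : IsScalarSolution α lam C y y₁ y₂ y₃) (hτ : 0 < τ) (hσ : 1 ≤ σ)
    {m j : ℕ} (hj : j < m) :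
    |interpMoment α τ σ y m j + y₂ (grid τ σ (j + 1)) / 2 * cellMoment α τ σ m j|
      ≤ cellConst α σ * (C * lam) * (cellScale α τ σ j * cellMoment α τ σ m j) := by
  have hmono := grid_strictMono hτ hσ
  have hlt := hmono (Nat.lt_succ_self j)
  have i1 := H.intervalIntegrable_interpError hα₁ hα₂ hC hlam hτ hσ hj
  have i2 := intervalIntegrable_bubble hα₁ hα₂ hlt.le (hmono.monotone hj)
  rw [cellMoment, gridStep, ← integral_bubble_eq hlt, interpMoment,
    ← intervalIntegral.integral_const_mul, ← intervalIntegral.integral_add i1 (i2.const_mul _),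
    ← mul_assoc, ← intervalIntegral.integral_const_mul, ← Real.norm_eq_abs]
  refine intervalIntegral.norm_integral_le_of_norm_le hlt.le (ae_of_all _ fun s hs => ?_)
    (i2.const_mul _)
  have h := H.abs_interpError_cell_le hα₁ hα₂ hC hlam hτ hσ j ⟨hs.1.le, hs.2⟩
  have h0 : 0 ≤ (grid τ σ m - s) ^ (-α) :=
    Real.rpow_nonneg (sub_nonneg.2 (hs.2.trans (hmono.monotone hj))) _
  rw [Real.norm_eq_abs, show ∀ k r v β : ℝ, k * r + v * (k * β) = k * (r + v * β) by
    intros; ring, abs_mul, abs_of_nonneg h0]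
  calc _ ≤ (grid τ σ m - s) ^ (-α) * _ := mul_le_mul_of_nonneg_left h h0
    _ = _ := by simp only [Nat.succ_eq_add_one]; ring

theorem IsScalarSolution.abs_second_deriv_sub_le (hα₂ : α < 2) (hC : 0 < C)
    (hlam : 0 < lam) (H : IsScalarSolution α lam C y y₁ y₂ y₃) (hτ : 0 < τ) (hσ : 1 ≤ σ) (j : ℕ) :
    |y₂ (grid τ σ (j + 2)) - y₂ (grid τ σ (j + 1))|
      ≤ (1 + gridConst σ) * σ * (C * lam) * cellScale α τ σ j := by
  have hmono := grid_strictMono hτ hσ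
  set b := grid τ σ (j + 1) with hb
  have hb0 : 0 < b := grid_succ_pos hτ j
  have hc := gridConst_pos hσ
  have h := H.abs_sub_le hα₂ hC hlam hb0 le_rfl (hmono (Nat.lt_succ_self (j + 1))).le
  have hj1 : (1:ℝ) ≤ (j:ℝ) + 1 := by linarith [(Nat.cast_nonneg j : (0:ℝ) ≤ j)]
  have h1 : grid τ σ (j + 2) - b ≤ (1 + gridConst σ) * (σ * b / (j + 1)) := by
    have h2 := gridStep_sub_le hτ hσ j
    have h3 : gridConst σ / ((j:ℝ) + 1) * gridStep τ σ j ≤ gridConst σ * gridStep τ σ j :=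
      mul_le_mul_of_nonneg_right (div_le_self hc.le hj1) (gridStep_pos hτ hσ j).le
    calc grid τ σ (j + 2) - b = gridStep τ σ (j + 1) := rfl
      _ ≤ (1 + gridConst σ) * gridStep τ σ j := by linarith
      _ ≤ _ := by gcongr; exact gridStep_le hτ hσ j
  have h5 : b ^ (α - 2) = b ^ (α - 3) * b := by
    rw [← Real.rpow_add_one hb0.ne']; ring_nf
  calc _ ≤ C * lam * b ^ (α - 3) * (grid τ σ (j + 2) - b) := h
    _ ≤ C * lam * b ^ (α - 3) * ((1 + gridConst σ) * (σ * b / (j + 1))) := by gcongr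
    _ = _ := by rw [cellScale, ← hb, h5]; ring

/-- The difference consists of the two remainders of the bubble expansion, the change of the bubble
moment and the change of `y₂`. Each of them carries the factor `1/(j+1)` contained in `cellScale`.
-/
theorem IsScalarSolution.abs_interpMoment_shift_le (hα₁ : 1 < α) (hα₂ : α < 2) (hC : 0 < C)
    (hlam : 0 < lam) (H : IsScalarSolution α lam C y y₁ y₂ y₃) (hτ : 0 < τ) (hσ : 1 ≤ σ)
    {m j : ℕ} (hj : j < m) :
    |interpMoment α τ σ y (m + 1) (j + 1) - interpMoment α τ σ y m j|
      ≤ cellConst α σ * (C * lam) * (cellScale α τ σ (j + 1) * cellMoment α τ σ (m + 1) (j + 1))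
        + (cellConst α σ + shiftConst σ + (1 + gridConst σ) * σ) * (C * lam)
          * (cellScale α τ σ j * cellMoment α τ σ m j) := by
  have h1 := H.abs_interpMoment_add_le hα₁ hα₂ hC hlam hτ hσ hj
  have h2 := H.abs_interpMoment_add_le hα₁ hα₂ hC hlam hτ hσ (Nat.succ_lt_succ hj)
  have h3 := H.abs_second_deriv_sub_le hα₂ hC hlam hτ hσ j
  have h4 := abs_cellMoment_shift_le hα₁ hα₂ hτ hσ hj
  simp only [Nat.succ_eq_add_one] at h2
  rw [show j + 1 + 1 = j + 2 from rfl] at h2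
  have hmono := grid_strictMono hτ hσ
  have hb0 : 0 < grid τ σ (j + 1) := grid_succ_pos hτ j
  have h5 : |y₂ (grid τ σ (j + 2))| ≤ C * lam * grid τ σ (j + 1) ^ (α - 2) := by
    refine (H.bound₂ _ (grid_succ_pos hτ (j + 1))).trans ?_
    have := Real.rpow_le_rpow_of_nonpos hb0 (hmono (Nat.lt_succ_self (j + 1))).le
      (by linarith : α - 2 ≤ 0)
    gcongr
  have hB := cellMoment_nonneg (α := α) hτ hσ hj
  have hsc := cellScale_nonneg (α := α) (σ := σ) hτ j
  have hgc := gridConst_pos hσ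
  have hshc := shiftConst_pos hσ
  set I' := interpMoment α τ σ y (m + 1) (j + 1)
  set I := interpMoment α τ σ y m j
  set B' := cellMoment α τ σ (m + 1) (j + 1)
  set B := cellMoment α τ σ m j
  set Y' := y₂ (grid τ σ (j + 2))
  set Y := y₂ (grid τ σ (j + 1))
  have h6 : |Y' / 2 * (B' - B)| ≤ shiftConst σ * (C * lam) * (cellScale α τ σ j * B) := by
    rw [abs_mul, abs_div, abs_two]
    calc |Y'| / 2 * |B' - B|
        ≤ C * lam * grid τ σ (j + 1) ^ (α - 2) * (shiftConst σ / (j + 1) * B) := by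
          gcongr
          linarith [abs_nonneg Y']
      _ = _ := by rw [cellScale]; ring
  have h7 : |(Y' - Y) / 2 * B| ≤ (1 + gridConst σ) * σ * (C * lam) * (cellScale α τ σ j * B) := by
    rw [abs_mul, abs_of_nonneg hB, abs_div, abs_two, ← mul_assoc]
    gcongr
    linarith [abs_nonneg (Y' - Y)]
  have e : I' - I = (I' + Y' / 2 * B') - (I + Y / 2 * B) - Y' / 2 * (B' - B) - (Y' - Y) / 2 * B := by
    ring
  rw [e]
  have t1 := abs_sub (I' + Y' / 2 * B' - (I + Y / 2 * B) - Y' / 2 * (B' - B)) ((Y' - Y) / 2 * B)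
  have t2 := abs_sub (I' + Y' / 2 * B' - (I + Y / 2 * B)) (Y' / 2 * (B' - B))
  have t3 := abs_sub (I' + Y' / 2 * B') (I + Y / 2 * B)
  linarith

/-- Cell `j` at node `m` is paired with cell `j + 1` at node `m + 1`. The first cell at node `m + 1`
has no partner; there `cellScale` carries no gain, so its full size fits the same bound. -/
theorem IsScalarSolution.abs_interpSum_sub_le (hα₁ : 1 < α) (hα₂ : α < 2) (hC : 0 < C)
    (hlam : 0 < lam) (H : IsScalarSolution α lam C y y₁ y₂ y₃) (hτ : 0 < τ) (hσ : 1 ≤ σ) (m : ℕ) :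
    |interpSum α τ σ y (m + 1) - interpSum α τ σ y m|
      ≤ (cellConst α σ + shiftConst σ + (1 + gridConst σ) * σ + 1) * (C * lam)
        * (momentSum α τ σ (m + 1) + momentSum α τ σ m) := by
  have hm0 := Nat.succ_pos m
  have h0 := H.abs_interpMoment_add_le hα₁ hα₂ hC hlam hτ hσ hm0
  have hb0 : 0 < grid τ σ (0 + 1) := grid_succ_pos hτ 0
  have hB0 := cellMoment_nonneg (α := α) hτ hσ hm0
  have hgc := gridConst_pos hσ
  have hshc := shiftConst_pos hσ
  have hcc := cellConst_pos hα₁ hσ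
  have hsc0 : cellScale α τ σ 0 = grid τ σ (0 + 1) ^ (α - 2) := by simp [cellScale]
  have hsn := cellScale_nonneg (α := α) (σ := σ) hτ 0
  simp only [Nat.succ_eq_add_one] at h0 hB0
  set K := cellConst α σ + shiftConst σ + (1 + gridConst σ) * σ + 1 with hK
  have hσ0 : 0 < (1 + gridConst σ) * σ := by positivity
  have hfirst : |interpMoment α τ σ y (m + 1) 0|
      ≤ K * (C * lam) * (cellScale α τ σ 0 * cellMoment α τ σ (m + 1) 0) := by
    have h1 := H.bound₂ _ hb0
    have h2 : |y₂ (grid τ σ (0 + 1)) / 2 * cellMoment α τ σ (m + 1) 0|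
        ≤ C * lam * (cellScale α τ σ 0 * cellMoment α τ σ (m + 1) 0) := by
      rw [abs_mul, abs_of_nonneg hB0, abs_div, abs_two, hsc0, ← mul_assoc]
      gcongr
      linarith [abs_nonneg (y₂ (grid τ σ (0 + 1)))]
    have h3 := abs_sub (interpMoment α τ σ y (m + 1) 0
      + y₂ (grid τ σ (0 + 1)) / 2 * cellMoment α τ σ (m + 1) 0)
      (y₂ (grid τ σ (0 + 1)) / 2 * cellMoment α τ σ (m + 1) 0)
    rw [add_sub_cancel_right] at h3
    have h4 : (cellConst α σ + 1) * (C * lam) * (cellScale α τ σ 0 * cellMoment α τ σ (m + 1) 0)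
        ≤ K * (C * lam) * (cellScale α τ σ 0 * cellMoment α τ σ (m + 1) 0) := by
      gcongr
      linarith
    linarith
  have hsum : ∑ j ∈ Finset.range m,
      |interpMoment α τ σ y (m + 1) (j + 1) - interpMoment α τ σ y m j|
      ≤ ∑ j ∈ Finset.range m, (K * (C * lam)
          * (cellScale α τ σ (j + 1) * cellMoment α τ σ (m + 1) (j + 1))
        + K * (C * lam) * (cellScale α τ σ j * cellMoment α τ σ m j)) := by
    refine Finset.sum_le_sum fun j hj => ?_
    have hjm := Finset.mem_range.1 hj
    have a1 := cellMoment_nonneg (α := α) hτ hσ hjm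
    have a2 := cellMoment_nonneg (α := α) hτ hσ (Nat.succ_lt_succ hjm)
    have a3 := cellScale_nonneg (α := α) (σ := σ) hτ j
    have a4 := cellScale_nonneg (α := α) (σ := σ) hτ (j + 1)
    simp only [Nat.succ_eq_add_one] at a2
    refine (H.abs_interpMoment_shift_le hα₁ hα₂ hC hlam hτ hσ hjm).trans ?_
    gcongr <;> linarith
  rw [Finset.sum_add_distrib, ← Finset.mul_sum, ← Finset.mul_sum] at hsum
  have e1 : momentSum α τ σ (m + 1) = ∑ j ∈ Finset.range m,
      cellScale α τ σ (j + 1) * cellMoment α τ σ (m + 1) (j + 1)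
      + cellScale α τ σ 0 * cellMoment α τ σ (m + 1) 0 := by
    rw [momentSum, Finset.sum_range_succ']
    rfl
  have e2 : momentSum α τ σ m = ∑ j ∈ Finset.range m, cellScale α τ σ j * cellMoment α τ σ m j :=
    rfl
  have e3 : interpSum α τ σ y (m + 1) - interpSum α τ σ y m
      = ∑ j ∈ Finset.range m, (interpMoment α τ σ y (m + 1) (j + 1) - interpMoment α τ σ y m j)
        + interpMoment α τ σ y (m + 1) 0 := by
    rw [interpSum, interpSum, Finset.sum_range_succ', Finset.sum_sub_distrib]
    ring
  rw [e1, e2, e3]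
  refine (abs_add_le _ _).trans ?_
  have h8 := Finset.abs_sum_le_sum_abs
    (fun j => interpMoment α τ σ y (m + 1) (j + 1) - interpMoment α τ σ y m j) (Finset.range m)
  rw [mul_add, mul_add]
  linarith

theorem exists_abs_interpSum_sub_le (hα₁ : 1 < α) (hα₂ : α < 2) (hσ : 1 ≤ σ)
    (hσα : 4 - α ≤ σ * (α + 1)) :
    ∃ K : ℝ, 0 < K ∧ ∀ τ lam C : ℝ, ∀ y y₁ y₂ y₃ : ℝ → ℝ, 0 < τ → 0 < lam → 0 < C →
      IsScalarSolution α lam C y y₁ y₂ y₃ → ∀ m : ℕ,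
        |interpSum α τ σ y (m + 1) - interpSum α τ σ y m|
          ≤ K * (C * lam) * (grid τ σ (m + 1) * ((m:ℝ) + 1) ^ (α - 4)) := by
  obtain ⟨K, hK, hKm⟩ := momentSum_le hα₁ hα₂ hσ hσα
  have hgc := gridConst_pos hσ
  have hshc := shiftConst_pos hσ
  have hcc := cellConst_pos hα₁ hσ
  set K' := cellConst α σ + shiftConst σ + (1 + gridConst σ) * σ + 1 with hK'
  have hK'0 : 0 < K' := by positivity
  refine ⟨K' * (K + K * 2 ^ (4 - α)), by positivity,
    fun τ lam C y y₁ y₂ y₃ hτ hlam hC H m => ?_⟩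
  refine (H.abs_interpSum_sub_le hα₁ hα₂ hC hlam hτ hσ m).trans ?_
  have h1 := hKm τ hτ m
  have hg : 0 < grid τ σ (m + 1) := grid_succ_pos hτ m
  -- Rewriting the bound for node `m` in terms of the next index costs `2 ^ (4 - α)`; for `m = 0`
  -- the sum is empty.
  have h2 : momentSum α τ σ m
      ≤ K * 2 ^ (4 - α) * (grid τ σ (m + 1) * ((m:ℝ) + 1) ^ (α - 4)) := by
    rcases m with _ | m
    · simp only [momentSum, Finset.range_zero, Finset.sum_empty]
      positivity
    · have hm1 : (0:ℝ) < (m:ℝ) + 1 := by positivity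
      have h3 : ((m:ℝ) + 1) ^ (α - 4)
          ≤ 2 ^ (4 - α) * (((m + 1 : ℕ):ℝ) + 1) ^ (α - 4) := by
        have h4 : (2:ℝ) ^ (4 - α) = (1 / 2) ^ (α - 4) := by
          rw [one_div, Real.inv_rpow two_pos.le, ← Real.rpow_neg two_pos.le]
          ring_nf
        rw [h4, ← Real.mul_rpow (by norm_num) (by positivity)]
        refine Real.rpow_le_rpow_of_nonpos (by positivity) ?_ (by linarith)
        push_cast
        linarith
      have h5 := (grid_strictMono (σ := σ) hτ hσ).monotone (Nat.le_succ (m + 1))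
      have h6 : 0 < grid τ σ (m + 1) := grid_succ_pos hτ m
      calc _ ≤ _ := hKm τ hτ m
        _ ≤ K * (grid τ σ (m + 1 + 1) * (2 ^ (4 - α) * (((m + 1 : ℕ):ℝ) + 1) ^ (α - 4))) := by
            gcongr
        _ = _ := by ring
  calc _ ≤ K' * (C * lam) * (K * (grid τ σ (m + 1) * ((m:ℝ) + 1) ^ (α - 4))
        + K * 2 ^ (4 - α) * (grid τ σ (m + 1) * ((m:ℝ) + 1) ^ (α - 4))) := by gcongr
    _ = _ := by ring

/-- In the defect this term is multiplied by `lam`, so its bound must be free of `lam`. Hence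
`decay₂` replaces `bound₂`, and on the first cell only the boundedness of `y` is used. For `m ≥ 1`
the natural rate is `(m+1)^(-3)`, which suffices as `α > 1`. -/
theorem IsScalarSolution.abs_integral_interpError_le (hα₁ : 1 < α) (hC : 0 < C)
    (H : IsScalarSolution α lam C y y₁ y₂ y₃) (hτ : 0 < τ) (hσ : 1 ≤ σ) (m : ℕ) :
    |∫ s in grid τ σ m..grid τ σ (m + 1), interpError y (grid τ σ m) (grid τ σ (m + 1)) s|
      ≤ (2 + σ ^ 3 * (2 ^ σ) ^ 2) * C * (grid τ σ (m + 1) * ((m:ℝ) + 1) ^ (α - 4)) := by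
  have hmono := grid_strictMono hτ hσ
  have hlt := hmono (Nat.lt_succ_self m)
  have hb0 : 0 < grid τ σ (m + 1) := grid_succ_pos hτ m
  rcases Nat.eq_zero_or_pos m with rfl | hm
  · simp only [grid_zero hσ, zero_add, CharP.cast_eq_zero, Real.one_rpow, mul_one] at *
    set b := grid τ σ 1
    have h1 : ∀ s ∈ Set.uIoc 0 b, ‖interpError y 0 b s‖ ≤ 2 * C := by
      intro s hs
      rw [Set.uIoc_of_le hb0.le] at hs
      have hx : 0 ≤ s / b := div_nonneg hs.1.le hb0.le
      have hx1 : s / b ≤ 1 := (div_le_one hb0).2 hs.2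
      have e : interpError y 0 b s = y s - ((1 - s / b) * y 0 + s / b * y b) := by
        simp only [interpError]
        field_simp
        ring
      have a1 := H.bound s hs.1.le
      have a2 := abs_le.1 (H.bound 0 le_rfl)
      have a3 := abs_le.1 (H.bound b hb0.le)
      rw [Real.norm_eq_abs, e]
      have a4 : |(1 - s / b) * y 0 + s / b * y b| ≤ C := by
        rw [abs_le]
        constructor <;> nlinarith
      exact (abs_sub _ _).trans (by linarith)
    have h2 := intervalIntegral.norm_integral_le_of_norm_le_const h1
    rw [Real.norm_eq_abs, sub_zero, abs_of_pos hb0] at h2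
    have h3 : 0 ≤ σ ^ 3 * (2 ^ σ) ^ 2 * C * b := by positivity
    linarith
  · have ha0 : 0 < grid τ σ m := by
      have := hmono hm
      rwa [grid_zero hσ] at this
    set a := grid τ σ m with ha
    set b := grid τ σ (m + 1) with hb
    have hstep : b - a = gridStep τ σ m := rfl
    have hh := gridStep_pos hτ hσ m
    have h1 : ∀ s ∈ Set.uIoc a b, ‖interpError y a b s‖ ≤ C / a ^ 2 / 2 * gridStep τ σ m ^ 2 := by
      intro s hs
      rw [Set.uIoc_of_le hlt.le] at hs
      have h := H.abs_interpError_add_le ha0.le hlt (Y := 0) (ε := C / a ^ 2) (fun r hr => by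
        rw [sub_zero]
        have hr0 : 0 < r := ha0.trans hr.1
        refine (H.decay₂ r hr0).trans ?_
        have := hr.1.le
        gcongr) ⟨hs.1.le, hs.2⟩
      rw [zero_div, zero_mul, add_zero] at h
      refine h.trans ?_
      rw [← hstep, sq (b - a)]
      have := hs.1.le
      have := hs.2
      refine mul_le_mul_of_nonneg_left (mul_le_mul (by linarith) ?_ ?_ ?_) (by positivity)
      · linarith
      · exact sub_nonneg.2 hs.2
      · linarith
    have h2 := intervalIntegral.norm_integral_le_of_norm_le_const h1
    rw [Real.norm_eq_abs, hstep, abs_of_pos hh] at h2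
    have h3 : gridStep τ σ m ≤ σ * b / (m + 1) := gridStep_le hτ hσ m
    have h4 : b ≤ 2 ^ σ * a := grid_succ_le hτ hσ hm
    have hm1 : (0:ℝ) < (m:ℝ) + 1 := by positivity
    have h5 : gridStep τ σ m / a ≤ σ * 2 ^ σ / (m + 1) := by
      rw [div_le_div_iff₀ ha0 hm1]
      rw [le_div_iff₀ hm1] at h3
      refine h3.trans ?_
      rw [mul_assoc]
      gcongr
    have h6 : (((m:ℝ) + 1) ^ 3)⁻¹ ≤ ((m:ℝ) + 1) ^ (α - 4) := by
      rw [← Real.rpow_natCast, ← Real.rpow_neg hm1.le]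
      exact Real.rpow_le_rpow_of_exponent_le (by linarith [(Nat.cast_nonneg m : (0:ℝ) ≤ m)])
        (by push_cast; linarith)
    calc _ ≤ _ := h2
      _ = C / 2 * (gridStep τ σ m / a) ^ 2 * gridStep τ σ m := by ring
      _ ≤ C / 2 * (σ * 2 ^ σ / (m + 1)) ^ 2 * (σ * b / (m + 1)) := by gcongr
      _ = σ ^ 3 * (2 ^ σ) ^ 2 * C * (b * (((m:ℝ) + 1) ^ 3)⁻¹) / 2 := by
          field_simp
      _ ≤ σ ^ 3 * (2 ^ σ) ^ 2 * C * (b * (((m:ℝ) + 1) ^ 3)⁻¹) := half_le_self (by positivity)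
      _ ≤ (2 + σ ^ 3 * (2 ^ σ) ^ 2) * C * (b * ((m:ℝ) + 1) ^ (α - 4)) := by
          gcongr
          linarith

end Consistency

/-! ### The error for a single eigenvalue -/

section ScalarError

variable {α τ σ lam C : ℝ} {y y₁ y₂ y₃ : ℝ → ℝ}

theorem cellWeight_eq_integral {γ : ℝ} (hγ : γ < 1) {t : ℕ → ℝ} (ht : StrictMono t) {m i : ℕ}
    (hi : i < m) :
    cellWeight γ t m i = (Real.Gamma (1 - γ))⁻¹ * ∫ s in t i..t (i + 1), (t m - s) ^ (-γ) := by
  have h1 : t (i + 1) ≤ t m := ht.monotone hi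
  have h2 : t i ≤ t m := ht.monotone hi.le
  have hG := Real.Gamma_pos_of_pos (by linarith : 0 < 1 - γ)
  have hG2 : Real.Gamma (2 - γ) = (1 - γ) * Real.Gamma (1 - γ) := by
    rw [← Real.Gamma_add_one (by linarith : (1 - γ) ≠ 0)]; ring_nf
  have hγ' : 1 - γ ≠ 0 := by linarith
  rw [cellWeight, kernelPrim_of_nonneg (by linarith), kernelPrim_of_nonneg (by linarith),
    intervalIntegral.integral_comp_sub_left (fun x => x ^ (-γ)),
    integral_rpow (Or.inl (by linarith)), hG2, show -γ + 1 = 1 - γ by ring]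
  field_simp

/-- Continuity is in doubt only at a right end that is the node itself. There the interpolation
error vanishes linearly, and the product is of order `(b - s)^(2 - α)`. -/
theorem IsScalarSolution.continuousOn_rpow_mul_interpError (hα₁ : 1 < α) (hα₂ : α < 2) (hC : 0 < C)
    (hlam : 0 < lam) (H : IsScalarSolution α lam C y y₁ y₂ y₃) (hτ : 0 < τ) (hσ : 1 ≤ σ)
    {m j : ℕ} (hj : j < m) :
    ContinuousOn (fun s => (grid τ σ m - s) ^ (-(α - 1))
      * interpError y (grid τ σ j) (grid τ σ (j + 1)) s)
      (Set.Icc (grid τ σ j) (grid τ σ (j + 1))) := by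
  have hmono := grid_strictMono hτ hσ
  have hlt := hmono (Nat.lt_succ_self j)
  have hbm : grid τ σ (j + 1) ≤ grid τ σ m := hmono.monotone hj
  obtain ⟨M, hM⟩ := H.exists_abs_interpError_le hα₁ hα₂ hC hlam hτ hσ j
  have hcont := H.continuous_interpError (grid τ σ j) (grid τ σ (j + 1))
  have hend := interpError_right y hlt
  simp only [Nat.succ_eq_add_one] at hend hlt
  set a := grid τ σ j
  set b := grid τ σ (j + 1)
  set t := grid τ σ m
  intro s hs
  rcases eq_or_lt_of_le hs.2 with rfl | hsb
  · rw [ContinuousWithinAt, hend, mul_zero]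
    have hlim : Tendsto (fun r => M * (b - r) ^ (2 - α)) (𝓝[Set.Icc a b] b) (𝓝 0) := by
      have h1 : Continuous fun r : ℝ => M * (b - r) ^ (2 - α) :=
        continuous_const.mul ((continuous_const.sub continuous_id).rpow_const
          fun _ => Or.inr (by linarith))
      have h2 := (h1.tendsto b).mono_left (nhdsWithin_le_nhds (s := Set.Icc a b))
      simpa [Real.zero_rpow (by linarith : 2 - α ≠ 0)] using h2
    refine squeeze_zero_norm' ?_ hlim
    filter_upwards [self_mem_nhdsWithin] with r hr
    rcases eq_or_lt_of_le hr.2 with rfl | hrs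
    · rw [hend, mul_zero, norm_zero, sub_self, Real.zero_rpow (by linarith), mul_zero]
    · have h0 : 0 < b - r := sub_pos.2 hrs
      have h1 : (t - r) ^ (-(α - 1)) ≤ (b - r) ^ (-(α - 1)) :=
        Real.rpow_le_rpow_of_nonpos h0 (by linarith) (by linarith)
      have h2 : 0 ≤ (t - r) ^ (-(α - 1)) := Real.rpow_nonneg (by linarith) _
      have h3 : (b - r) ^ (2 - α) = (b - r) ^ (-(α - 1)) * (b - r) := by
        rw [← Real.rpow_add_one h0.ne']; ring_nf
      rw [norm_mul, Real.norm_eq_abs, Real.norm_eq_abs, abs_of_nonneg h2, h3]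
      calc _ ≤ (b - r) ^ (-(α - 1)) * (M * (b - r)) :=
            mul_le_mul h1 (hM r hr) (abs_nonneg _) (h2.trans h1)
        _ = _ := by ring
  · have h0 : t - s ≠ 0 := by linarith
    exact ((continuousAt_const.sub continuousAt_id).rpow_const (Or.inl h0)).continuousWithinAt.mul
      hcont.continuousWithinAt

/-- Integration by parts: the interpolation error has derivative `y₁` minus the slope and vanishes
at both ends, so no boundary terms arise. The slope contributes the cell weight, the derivative of
the kernel contributes `interpMoment`. -/
theorem IsScalarSolution.integral_cell_eq (hα₁ : 1 < α) (hα₂ : α < 2) (hC : 0 < C)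
    (hlam : 0 < lam) (H : IsScalarSolution α lam C y y₁ y₂ y₃) (hτ : 0 < τ) (hσ : 1 ≤ σ)
    {m j : ℕ} (hj : j < m) :
    IntervalIntegrable (fun s => (grid τ σ m - s) ^ (-(α - 1)) * y₁ s) volume
      (grid τ σ j) (grid τ σ (j + 1)) ∧
    ∫ s in grid τ σ j..grid τ σ (j + 1), (grid τ σ m - s) ^ (-(α - 1)) * y₁ s
      = Real.Gamma (2 - α) * ((y (grid τ σ (j + 1)) - y (grid τ σ j))
          / (grid τ σ (j + 1) - grid τ σ j) * cellWeight (α - 1) (grid τ σ) m j)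
        - (α - 1) * interpMoment α τ σ y m j := by
  have hmono := grid_strictMono hτ hσ
  have hlt := hmono (Nat.lt_succ_self j)
  have hbm : grid τ σ (j + 1) ≤ grid τ σ m := hmono.monotone hj
  have hcw := cellWeight_eq_integral (by linarith : α - 1 < 1) hmono hj
  have hcont := H.continuousOn_rpow_mul_interpError hα₁ hα₂ hC hlam hτ hσ hj
  have hint := H.intervalIntegrable_interpError hα₁ hα₂ hC hlam hτ hσ hj
  have hG := Real.Gamma_pos_of_pos (by linarith : 0 < 2 - α)
  rw [show 1 - (α - 1) = 2 - α by ring] at hcw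
  rw [interpMoment, hcw]
  have hend := interpError_right y hlt
  have hbeg := interpError_left y (grid τ σ j) (grid τ σ (j + 1))
  have ha0 := grid_nonneg (σ := σ) hτ j
  simp only [Nat.succ_eq_add_one] at hend hlt
  set a := grid τ σ j
  set b := grid τ σ (j + 1)
  set t := grid τ σ m
  set d := (y b - y a) / (b - a) with hd
  have i1 : IntervalIntegrable (fun s => (t - s) ^ (-(α - 1))) volume a b :=
    intervalIntegrable_sub_rpow (by linarith)
  have i2 : IntervalIntegrable (fun s => (t - s) ^ (-(α - 1)) * y₁ s) volume a b := by
    refine intervalIntegrable_sub_rpow_mul (M := C * lam * b ^ (α - 1)) (by linarith) ha0 hlt.le hbm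
      (fun s hs => (H.hasDerivAt₁ s hs).continuousAt.continuousWithinAt) fun s hs hsb => ?_
    refine (H.bound₁ s hs).trans ?_
    have := Real.rpow_le_rpow hs.le hsb (by linarith : 0 ≤ α - 1)
    gcongr
  refine ⟨i2, ?_⟩
  have hftc := intervalIntegral.integral_eq_sub_of_hasDerivAt_of_le hlt.le hcont
    (f' := fun s => (α - 1) * ((t - s) ^ (-α) * interpError y a b s)
      + ((t - s) ^ (-(α - 1)) * y₁ s - d * (t - s) ^ (-(α - 1)))) (fun s hs => ?_)
    ((hint.const_mul _).add (i2.sub (i1.const_mul _)))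
  · rw [intervalIntegral.integral_add (hint.const_mul _) (i2.sub (i1.const_mul _)),
      intervalIntegral.integral_sub i2 (i1.const_mul _), intervalIntegral.integral_const_mul,
      intervalIntegral.integral_const_mul, hend, hbeg] at hftc
    field_simp
    linarith
  · have h0 : t - s ≠ 0 := by linarith [hs.2]
    have h1 : HasDerivAt (fun s => (t - s) ^ (-(α - 1))) ((α - 1) * (t - s) ^ (-α)) s := by
      refine (((hasDerivAt_id s).const_sub t).rpow_const (p := -(α - 1)) (Or.inl h0)).congr_deriv ?_
      rw [show -(α - 1) - 1 = -α by ring]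
      simp
    refine (h1.mul (H.hasDerivAt_interpError a b (ha0.trans_lt hs.1))).congr_deriv ?_
    rw [← hd]
    ring

theorem IsScalarSolution.stepIntegral_eq (hα₁ : 1 < α) (hα₂ : α < 2) (hC : 0 < C)
    (hlam : 0 < lam) (H : IsScalarSolution α lam C y y₁ y₂ y₃) (hτ : 0 < τ) (hσ : 1 ≤ σ) (m : ℕ) :
    stepIntegral (α - 1) (grid τ σ) (fun i => (y (grid τ σ (i + 1)) - y (grid τ σ i))
        / (grid τ σ (i + 1) - grid τ σ i)) m
      = -lam * (∫ s in (0:ℝ)..grid τ σ m, y s)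
        + (α - 1) / Real.Gamma (2 - α) * interpSum α τ σ y m := by
  have hG := Real.Gamma_pos_of_pos (by linarith : 0 < 2 - α)
  rcases Nat.eq_zero_or_pos m with rfl | hm
  · simp [stepIntegral, interpSum, grid_zero hσ]
  have hmono := grid_strictMono hτ hσ
  have h1 := H.integral_eq (grid τ σ m) (by have := hmono hm; rwa [grid_zero hσ] at this)
  have h2 := intervalIntegral.sum_integral_adjacent_intervals (μ := volume) (n := m)
    (a := grid τ σ) (f := fun s => (grid τ σ m - s) ^ (-(α - 1)) * y₁ s)
    fun j hj => (H.integral_cell_eq hα₁ hα₂ hC hlam hτ hσ hj).1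
  rw [Finset.sum_congr rfl fun j hj =>
    (H.integral_cell_eq hα₁ hα₂ hC hlam hτ hσ (Finset.mem_range.1 hj)).2,
    Finset.sum_sub_distrib, ← Finset.mul_sum, ← Finset.mul_sum, grid_zero hσ, h1] at h2
  rw [stepIntegral, interpSum]
  refine mul_left_cancel₀ hG.ne' ?_
  rw [mul_add, ← mul_assoc (Real.Gamma (2 - α)) ((α - 1) / _), mul_div_cancel₀ _ hG.ne']
  linarith

/-- For negative `p` each term is at most an increment of `x^(p+1) / (p+1)`, again by Bernoulli's
inequality. -/
theorem sum_rpow_le {p : ℝ} (hp : -1 < p) :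
    ∃ K : ℝ, 0 < K ∧ ∀ m : ℕ, ∑ j ∈ Finset.range m, ((j:ℝ) + 1) ^ p ≤ K * (m:ℝ) ^ (p + 1) := by
  rcases le_or_gt 0 p with h0 | h0
  · refine ⟨1, one_pos, fun m => ?_⟩
    have h1 : ∀ j ∈ Finset.range m, ((j:ℝ) + 1) ^ p ≤ (m:ℝ) ^ p := fun j hj =>
      Real.rpow_le_rpow (by positivity) (by exact_mod_cast Finset.mem_range.1 hj) h0
    have h2 := Finset.sum_le_card_nsmul _ _ _ h1
    rw [Finset.card_range, nsmul_eq_mul] at h2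
    rw [one_mul, Real.rpow_add_one' (by positivity) (by linarith), mul_comm]
    exact h2
  · have hp1 : 0 < p + 1 := by linarith
    refine ⟨1 / (p + 1), by positivity, fun m => ?_⟩
    have h1 : ∀ j ∈ Finset.range m, ((j:ℝ) + 1) ^ p
        ≤ 1 / (p + 1) * ((((j + 1 : ℕ):ℝ)) ^ (p + 1) - (j:ℝ) ^ (p + 1)) := by
      intro j _
      have hj : (0:ℝ) < (j:ℝ) + 1 := by positivity
      have h3 := rpow_one_add_le_one_add_mul_self (s := -1 / ((j:ℝ) + 1)) (p := p + 1)
        (by rw [le_div_iff₀ hj]; linarith [(Nat.cast_nonneg j : (0:ℝ) ≤ j)]) hp1.le (by linarith)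
      rw [show 1 + -1 / ((j:ℝ) + 1) = j / (j + 1) by field_simp; ring,
        Real.div_rpow (Nat.cast_nonneg j) hj.le, div_le_iff₀ (Real.rpow_pos_of_pos hj _)] at h3
      rw [one_div, ← div_eq_inv_mul, le_div_iff₀ hp1]
      push_cast
      have h4 : ((j:ℝ) + 1) ^ (p + 1) = ((j:ℝ) + 1) ^ p * (j + 1) := Real.rpow_add_one hj.ne' p
      have h5 : (1 + (p + 1) * (-1 / ((j:ℝ) + 1))) * ((j:ℝ) + 1) ^ (p + 1)
          = ((j:ℝ) + 1) ^ (p + 1) - ((j:ℝ) + 1) ^ p * (p + 1) := by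
        rw [h4]; field_simp; ring
      linarith
    refine (Finset.sum_le_sum h1).trans ?_
    rw [← Finset.mul_sum, Finset.sum_range_sub (fun j : ℕ => (j:ℝ) ^ (p + 1))]
    simp [Real.zero_rpow hp1.ne']

/-- The trapezoidal rule integrates the interpolant exactly. Hence the defect of the exact nodal
values is a multiple of the increment of `interpSum`, minus `lam` times the integral of the
interpolation error. The bound is linear in `lam`, as the final choice of `lam ^ ν` requires. -/
theorem exists_scalar_defect_le (hα₁ : 1 < α) (hα₂ : α < 2) (hσ : 1 ≤ σ)
    (hσα : 4 - α ≤ σ * (α + 1)) :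
    ∃ K : ℝ, 0 < K ∧ ∀ lam : ℝ, 0 < lam → ∀ τ : ℝ, 0 < τ → ∀ j : ℕ,
      |stepIntegral (α - 1) (grid τ σ) (fun i => (mittagLeffler α 1 (-lam * grid τ σ (i + 1) ^ α)
            - mittagLeffler α 1 (-lam * grid τ σ i ^ α)) / (grid τ σ (i + 1) - grid τ σ i)) (j + 1)
        - stepIntegral (α - 1) (grid τ σ) (fun i => (mittagLeffler α 1 (-lam * grid τ σ (i + 1) ^ α)
            - mittagLeffler α 1 (-lam * grid τ σ i ^ α)) / (grid τ σ (i + 1) - grid τ σ i)) j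
        + lam * ((grid τ σ (j + 1) - grid τ σ j) * (mittagLeffler α 1 (-lam * grid τ σ j ^ α)
            + mittagLeffler α 1 (-lam * grid τ σ (j + 1) ^ α)) / 2)|
      ≤ K * lam * (grid τ σ (j + 1) * ((j:ℝ) + 1) ^ (α - 4)) := by
  obtain ⟨C, hC, hsol⟩ := exists_isScalarSolution hα₁ hα₂
  obtain ⟨K, hK, hZ⟩ := exists_abs_interpSum_sub_le hα₁ hα₂ hσ hσα
  have hG := Real.Gamma_pos_of_pos (by linarith : 0 < 2 - α)
  have hα1 : 0 < α - 1 := by linarith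
  refine ⟨(α - 1) / Real.Gamma (2 - α) * (K * C) + (2 + σ ^ 3 * (2 ^ σ) ^ 2) * C, by positivity,
    fun lam hlam τ hτ j => ?_⟩
  obtain ⟨y₁, y₂, y₃, H⟩ := hsol lam hlam
  set y : ℝ → ℝ := fun t => mittagLeffler α 1 (-lam * t ^ α) with hy
  have h1 := H.stepIntegral_eq hα₁ hα₂ hC hlam hτ hσ (j + 1)
  have h2 := H.stepIntegral_eq hα₁ hα₂ hC hlam hτ hσ j
  have h3 := hZ τ lam C y y₁ y₂ y₃ hτ hlam hC H j
  have h4 := H.abs_integral_interpError_le hα₁ hC hτ hσ j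
  have hab := (grid_strictMono hτ hσ) (Nat.lt_succ_self j)
  simp only [Nat.succ_eq_add_one] at hab
  change |stepIntegral (α - 1) (grid τ σ) (fun i => (y (grid τ σ (i + 1)) - y (grid τ σ i))
        / (grid τ σ (i + 1) - grid τ σ i)) (j + 1)
      - stepIntegral (α - 1) (grid τ σ) (fun i => (y (grid τ σ (i + 1)) - y (grid τ σ i))
        / (grid τ σ (i + 1) - grid τ σ i)) j
      + lam * ((grid τ σ (j + 1) - grid τ σ j) * (y (grid τ σ j) + y (grid τ σ (j + 1))) / 2)| ≤ _
  rw [h1, h2]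
  have hyi : ∀ a b, IntervalIntegrable y volume a b := fun a b => H.continuous.intervalIntegrable a b
  have h5 : (∫ s in (0:ℝ)..grid τ σ (j + 1), y s) - (∫ s in (0:ℝ)..grid τ σ j, y s)
      = ∫ s in grid τ σ j..grid τ σ (j + 1), y s :=
    intervalIntegral.integral_interval_sub_left (hyi _ _) (hyi _ _)
  set a := grid τ σ j
  set b := grid τ σ (j + 1)
  have h6 : ∫ s in a..b, interpError y a b s
      = (∫ s in a..b, y s) - (b - a) * (y a + y b) / 2 := by
    have e : ∀ s, interpError y a b s
        = y s - (y a - a * ((y b - y a) / (b - a)) + (y b - y a) / (b - a) * s) := fun s => by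
      simp only [interpError]; ring
    have hba : b - a ≠ 0 := (sub_pos.2 hab).ne'
    simp only [e]
    rw [intervalIntegral.integral_sub (hyi _ _)
        (Continuous.intervalIntegrable (by fun_prop) _ _),
      intervalIntegral.integral_add (Continuous.intervalIntegrable (by fun_prop) _ _)
        (Continuous.intervalIntegrable (by fun_prop) _ _),
      intervalIntegral.integral_const_mul, integral_id, intervalIntegral.integral_const,
      smul_eq_mul]
    field_simp
    ring
  set Z' := interpSum α τ σ y (j + 1)
  set Z := interpSum α τ σ y j
  set R := ∫ s in a..b, interpError y a b s
  have e : -lam * (∫ s in (0:ℝ)..b, y s) + (α - 1) / Real.Gamma (2 - α) * Z'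
      - (-lam * (∫ s in (0:ℝ)..a, y s) + (α - 1) / Real.Gamma (2 - α) * Z)
      + lam * ((b - a) * (y a + y b) / 2)
      = (α - 1) / Real.Gamma (2 - α) * (Z' - Z) - lam * R := by
    rw [h6, ← h5]; ring
  rw [e]
  refine (abs_sub _ _).trans ?_
  rw [abs_mul, abs_mul, abs_of_pos hlam, abs_of_pos (by positivity)]
  calc _ ≤ (α - 1) / Real.Gamma (2 - α) * (K * (C * lam) * (b * ((j:ℝ) + 1) ^ (α - 4)))
        + lam * ((2 + σ ^ 3 * (2 ^ σ) ^ 2) * C * (b * ((j:ℝ) + 1) ^ (α - 4))) := by gcongr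
    _ = _ := by ring

end ScalarError

theorem stepIntegral_sub_mul (γ c : ℝ) (t v w : ℕ → ℝ) (m : ℕ) :
    stepIntegral γ t (fun i => v i - c * w i) m
      = stepIntegral γ t v m - c * stepIntegral γ t w m := by
  simp only [stepIntegral, Finset.mul_sum, ← Finset.sum_sub_distrib]
  exact Finset.sum_congr rfl fun i _ => by ring

/-- The error estimate for a single eigenvalue. -/
theorem exists_scalar_error_le {α σ T : ℝ} (hα₁ : 1 < α) (hα₂ : α < 2) (hσ : 1 ≤ σ) (hT : 0 < T)
    (hσα : 2 * (3 - α) < σ * α) :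
    ∃ K : ℝ, 0 < K ∧ ∀ lam : ℝ, 0 < lam → ∀ J : ℕ, 1 ≤ J → ∀ Y : ℕ → ℝ,
      (∀ j < J, stepIntegral (α - 1) (grid (T / (J:ℝ) ^ σ) σ) (fun i => (Y (i + 1) - Y i)
            / (grid (T / (J:ℝ) ^ σ) σ (i + 1) - grid (T / (J:ℝ) ^ σ) σ i)) (j + 1)
          - stepIntegral (α - 1) (grid (T / (J:ℝ) ^ σ) σ) (fun i => (Y (i + 1) - Y i)
            / (grid (T / (J:ℝ) ^ σ) σ (i + 1) - grid (T / (J:ℝ) ^ σ) σ i)) j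
          + lam * ((grid (T / (J:ℝ) ^ σ) σ (j + 1) - grid (T / (J:ℝ) ^ σ) σ j)
            * (Y j + Y (j + 1)) / 2) = 0) →
      ∀ m ≤ J, ∀ ν : ℝ, 1 / 2 ≤ ν → ν ≤ 1 →
        |Y m - mittagLeffler α 1 (-lam * grid (T / (J:ℝ) ^ σ) σ m ^ α) * Y 0|
          ≤ K * (J:ℝ) ^ (α - 3) * (lam ^ ν * |Y 0|) := by
  obtain ⟨K, hK, hdef⟩ := exists_scalar_defect_le hα₁ hα₂ hσ (by nlinarith)
  -- This exponent results from `δ_j² t_{j+1}^(α-1) / h_j`; it exceeds `-1` precisely by `hσα`.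
  obtain ⟨S, hS, hsum⟩ := sum_rpow_le (p := σ * α + 2 * α - 7) (by linarith)
  have hG := Real.Gamma_pos_of_pos (by linarith : 0 < 2 - α)
  set G := Real.Gamma (2 - α) with hGdef
  set E := K ^ 2 * T ^ α * S with hE
  have hE0 : 0 < E := by positivity
  set B := G * E + (2 * G) ^ 2 * T ^ α * E with hB
  have hB0 : 0 < B := by positivity
  refine ⟨√B, Real.sqrt_pos.2 hB0, fun lam hlam J hJ Y hY m hm ν hν₁ hν₂ => ?_⟩
  have hJ0 : (0:ℝ) < J := by exact_mod_cast hJ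
  set τ := T / (J:ℝ) ^ σ with hτdef
  have hτ : 0 < τ := by positivity
  have hmono := grid_strictMono hτ hσ
  set g := grid τ σ with hg
  set y : ℕ → ℝ := fun j => mittagLeffler α 1 (-lam * g j ^ α) with hy
  set c := Y 0 with hc
  set θ : ℕ → ℝ := fun j => Y j - c * y j with hθ
  have hg0 : g 0 = 0 := grid_zero hσ
  have hy0 : y 0 = 1 := by
    simp only [hy, hg0, Real.zero_rpow (by linarith : α ≠ 0), mul_zero]
    rw [← mlEuler_zero, mlEuler_zero_zero]
  have hθ0 : θ 0 = 0 := by simp [hθ, hy0, hc]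
  set δ : ℕ → ℝ := fun j =>
    stepIntegral (α - 1) g (fun i => (θ (i + 1) - θ i) / (g (i + 1) - g i)) (j + 1)
      - stepIntegral (α - 1) g (fun i => (θ (i + 1) - θ i) / (g (i + 1) - g i)) j
      + lam * ((g (j + 1) - g j) * (θ j + θ (j + 1)) / 2) with hδ
  have hstep : ∀ k, stepIntegral (α - 1) g (fun i => (θ (i + 1) - θ i) / (g (i + 1) - g i)) k
      = stepIntegral (α - 1) g (fun i => (Y (i + 1) - Y i) / (g (i + 1) - g i)) k
        - c * stepIntegral (α - 1) g (fun i => (y (i + 1) - y i) / (g (i + 1) - g i)) k := by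
    intro k
    rw [← stepIntegral_sub_mul]
    congr 1
    funext i
    simp only [hθ]
    ring
  have hδle : ∀ j < J, |δ j| ≤ |c| * (K * lam * (g (j + 1) * ((j:ℝ) + 1) ^ (α - 4))) := by
    intro j hj
    have h1 := hY j hj
    have h2 := hdef lam hlam τ hτ j
    have e : δ j = -c * (stepIntegral (α - 1) g
          (fun i => (y (i + 1) - y i) / (g (i + 1) - g i)) (j + 1)
        - stepIntegral (α - 1) g (fun i => (y (i + 1) - y i) / (g (i + 1) - g i)) j
        + lam * ((g (j + 1) - g j) * (y j + y (j + 1)) / 2)) := by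
      simp only [hδ, hstep]
      simp only [hθ]
      linear_combination h1
    rw [e, abs_mul, abs_neg]
    exact mul_le_mul_of_nonneg_left h2 (abs_nonneg _)
  have hterm : ∀ j ∈ Finset.range m, δ j ^ 2 * g (j + 1) ^ (α - 1) / (g (j + 1) - g j)
      ≤ c ^ 2 * K ^ 2 * lam ^ 2 * τ ^ α * ((j:ℝ) + 1) ^ (σ * α + 2 * α - 7) := by
    intro j hj
    have hjJ : j < J := (Finset.mem_range.1 hj).trans_le hm
    have hj1 : (0:ℝ) < (j:ℝ) + 1 := by positivity
    have hgp : 0 < g (j + 1) := grid_succ_pos hτ j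
    have h1 : δ j ^ 2 ≤ (|c| * (K * lam * (g (j + 1) * ((j:ℝ) + 1) ^ (α - 4)))) ^ 2 := by
      rw [← sq_abs (δ j)]
      exact pow_le_pow_left₀ (abs_nonneg _) (hδle j hjJ) 2
    have h2 : g (j + 1) / (j + 1) ≤ g (j + 1) - g j := gridStep_ge hτ hσ j
    have h3 : g (j + 1) ^ α = τ ^ α * ((j:ℝ) + 1) ^ (σ * α) := by
      simp only [hg, grid]
      push_cast
      rw [Real.mul_rpow hτ.le (by positivity), ← Real.rpow_mul hj1.le]
    have h4 : g (j + 1) * g (j + 1) ^ (α - 1) = g (j + 1) ^ α := by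
      rw [mul_comm, ← Real.rpow_add_one hgp.ne']; ring_nf
    have h5 : ((j:ℝ) + 1) ^ (σ * α) * (((j:ℝ) + 1) ^ (α - 4)) ^ 2 * ((j:ℝ) + 1)
        = ((j:ℝ) + 1) ^ (σ * α + 2 * α - 7) := by
      rw [← Real.rpow_natCast, ← Real.rpow_mul hj1.le, ← Real.rpow_add hj1,
        ← Real.rpow_add_one hj1.ne']
      congr 1
      push_cast
      ring
    calc _ ≤ (|c| * (K * lam * (g (j + 1) * ((j:ℝ) + 1) ^ (α - 4)))) ^ 2 * g (j + 1) ^ (α - 1)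
          / (g (j + 1) / (j + 1)) := by gcongr
      _ = |c| ^ 2 * K ^ 2 * lam ^ 2 * (g (j + 1) * g (j + 1) ^ (α - 1))
          * ((((j:ℝ) + 1) ^ (α - 4)) ^ 2 * ((j:ℝ) + 1)) := by
        field_simp
      _ = c ^ 2 * K ^ 2 * lam ^ 2 * τ ^ α * (((j:ℝ) + 1) ^ (σ * α) * (((j:ℝ) + 1) ^ (α - 4)) ^ 2
          * ((j:ℝ) + 1)) := by
        rw [h4, h3, sq_abs]; ring
      _ = _ := by rw [h5]
  set N := ∑ j ∈ Finset.range m, δ j ^ 2 * g (j + 1) ^ (α - 1) / (g (j + 1) - g j) with hN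
  -- The power `J^(-σα)` from `τ ^ α` cancels the dependence of the sum on the grading and leaves
  -- `J^(2(α-3))`.
  have hNle : N ≤ c ^ 2 * lam ^ 2 * E * ((J:ℝ) ^ (α - 3)) ^ 2 := by
    have h1 := Finset.sum_le_sum hterm
    rw [← Finset.mul_sum] at h1
    have h2 : ∑ j ∈ Finset.range m, ((j:ℝ) + 1) ^ (σ * α + 2 * α - 7)
        ≤ S * (J:ℝ) ^ (σ * α + 2 * α - 7 + 1) := by
      refine (hsum m).trans ?_
      have : (m:ℝ) ^ (σ * α + 2 * α - 7 + 1) ≤ (J:ℝ) ^ (σ * α + 2 * α - 7 + 1) :=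
        Real.rpow_le_rpow (Nat.cast_nonneg m) (by exact_mod_cast hm) (by linarith)
      gcongr
    have h3 : τ ^ α = T ^ α * (J:ℝ) ^ (-(σ * α)) := by
      rw [hτdef, Real.div_rpow hT.le (by positivity), ← Real.rpow_mul hJ0.le, Real.rpow_neg hJ0.le,
        div_eq_mul_inv]
    have h4 : (J:ℝ) ^ (-(σ * α)) * (J:ℝ) ^ (σ * α + 2 * α - 7 + 1) = ((J:ℝ) ^ (α - 3)) ^ 2 := by
      rw [← Real.rpow_add hJ0, ← Real.rpow_natCast, ← Real.rpow_mul hJ0.le]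
      congr 1
      push_cast
      ring
    calc N ≤ _ := h1
      _ ≤ c ^ 2 * K ^ 2 * lam ^ 2 * τ ^ α * (S * (J:ℝ) ^ (σ * α + 2 * α - 7 + 1)) := by gcongr
      _ = c ^ 2 * lam ^ 2 * E * ((J:ℝ) ^ (-(σ * α)) * (J:ℝ) ^ (σ * α + 2 * α - 7 + 1)) := by
        rw [h3, hE]; ring
      _ = _ := by rw [h4]
  obtain ⟨hs1, hs2⟩ := scheme_stability (by linarith : 0 < α - 1) (by linarith) hmono hg0 hlam θ δ
    hθ0 m fun j _ => rfl
  rw [show 1 - (α - 1) = 2 - α by ring, ← hN, ← hGdef] at hs1 hs2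
  rw [show 1 + (α - 1) = α by ring] at hs2
  have hgT : g m ^ α ≤ T ^ α := by
    refine Real.rpow_le_rpow (grid_nonneg hτ m) ?_ (by linarith)
    simp only [hg, grid, hτdef]
    rw [div_mul_eq_mul_div, div_le_iff₀ (by positivity)]
    have : (m:ℝ) ^ σ ≤ (J:ℝ) ^ σ :=
      Real.rpow_le_rpow (Nat.cast_nonneg m) (by exact_mod_cast hm) (by linarith)
    gcongr
  set P := (J:ℝ) ^ (α - 3) with hP
  have hP0 : 0 < P := by positivity
  have hgm := grid_nonneg (σ := σ) hτ m
  have b1 : θ m ^ 2 ≤ lam * (G * E * c ^ 2 * P ^ 2) := by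
    refine le_of_mul_le_mul_left ?_ hlam
    calc lam * θ m ^ 2 ≤ G * N := hs1
      _ ≤ G * (c ^ 2 * lam ^ 2 * E * P ^ 2) := by gcongr
      _ = _ := by ring
  have b2 : θ m ^ 2 ≤ lam ^ 2 * ((2 * G) ^ 2 * T ^ α * E * c ^ 2 * P ^ 2) := by
    have hN0 : 0 ≤ c ^ 2 * lam ^ 2 * E * P ^ 2 := by positivity
    calc θ m ^ 2 ≤ (2 * G) ^ 2 * g m ^ α * N := hs2
      _ ≤ (2 * G) ^ 2 * g m ^ α * (c ^ 2 * lam ^ 2 * E * P ^ 2) := by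
        have : 0 ≤ g m ^ α := Real.rpow_nonneg hgm _
        gcongr
      _ ≤ (2 * G) ^ 2 * T ^ α * (c ^ 2 * lam ^ 2 * E * P ^ 2) := by gcongr
      _ = _ := by ring
  have hB1 : G * E ≤ B := le_add_of_nonneg_right (by positivity)
  have hB2 : (2 * G) ^ 2 * T ^ α * E ≤ B := le_add_of_nonneg_left (by positivity)
  -- The bounds `b1` and `b2` are linear and quadratic in `lam`. As `1 ≤ 2 ν ≤ 2`, the quadratic one
  -- serves `lam ≤ 1` and the linear one `lam ≥ 1`, so the constant does not depend on `ν`.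
  have b3 : θ m ^ 2 ≤ lam ^ (2 * ν) * (B * c ^ 2 * P ^ 2) := by
    rcases le_total lam 1 with h | h
    · have h1 : lam ^ 2 ≤ lam ^ (2 * ν) := by
        rw [← Real.rpow_natCast]
        exact Real.rpow_le_rpow_of_exponent_ge hlam h (by push_cast; linarith)
      refine b2.trans ?_
      gcongr
    · have h1 : lam ≤ lam ^ (2 * ν) := by
        nth_rewrite 1 [← Real.rpow_one lam]
        exact Real.rpow_le_rpow_of_exponent_le h (by linarith)
      refine b1.trans ?_
      gcongr
  rw [show Y m - y m * c = θ m by simp only [hθ]; ring]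
  refine abs_le_of_sq_le_sq (b3.trans_eq ?_) (by positivity)
  rw [mul_pow, mul_pow, mul_pow, Real.sq_sqrt hB0.le, sq_abs,
    show lam ^ (2 * ν) = (lam ^ ν) ^ 2 by
      rw [← Real.rpow_natCast, ← Real.rpow_mul hlam.le]; congr 1; push_cast; ring]
  ring

/-! ### Fractional derivatives of step functions -/

section StepFunctions

/-- The kernel of the fractional integral of order `1 - γ`. -/
def fracKernel (γ x : ℝ) : ℝ := (max x 0) ^ (-γ) / Real.Gamma (1 - γ)

variable {γ : ℝ}

theorem fracKernel_of_nonpos (hγ₀ : 0 < γ) {x : ℝ} (hx : x ≤ 0) : fracKernel γ x = 0 := by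
  rw [fracKernel, max_eq_right hx, Real.zero_rpow (by linarith), zero_div]

theorem fracKernel_of_nonneg {x : ℝ} (hx : 0 ≤ x) :
    fracKernel γ x = x ^ (-γ) / Real.Gamma (1 - γ) := by
  rw [fracKernel, max_eq_left hx]

theorem continuous_kernelPrim (hγ : γ < 1) : Continuous (kernelPrim γ) := by
  unfold kernelPrim
  exact ((continuous_id.max continuous_const).rpow_const fun _ =>
    Or.inr (by linarith)).div_const _

theorem hasDerivAt_kernelPrim (hγ₀ : 0 < γ) (hγ : γ < 1) {x : ℝ} (hx : x ≠ 0) :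
    HasDerivAt (kernelPrim γ) (fracKernel γ x) x := by
  rcases lt_or_gt_of_ne hx with h | h
  · rw [fracKernel_of_nonpos hγ₀ h.le]
    refine (hasDerivAt_const x (0:ℝ)).congr_of_eventuallyEq ?_
    filter_upwards [gt_mem_nhds h] with z hz
    exact kernelPrim_of_nonpos hγ hz.le
  · have hG := Real.Gamma_pos_of_pos (by linarith : 0 < 1 - γ)
    have hG2 : Real.Gamma (2 - γ) = (1 - γ) * Real.Gamma (1 - γ) := by
      rw [← Real.Gamma_add_one (by linarith : (1 - γ) ≠ 0)]; ring_nf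
    have hγ' : 1 - γ ≠ 0 := by linarith
    rw [fracKernel_of_nonneg h.le]
    have h1 := (Real.hasDerivAt_rpow_const (x := x) (p := 1 - γ) (Or.inl hx)).div_const
      (Real.Gamma (2 - γ))
    refine (h1.congr_of_eventuallyEq ?_).congr_deriv ?_
    · filter_upwards [lt_mem_nhds h] with z hz
      exact kernelPrim_of_nonneg hz.le
    · rw [show 1 - γ - 1 = -γ by ring, hG2]
      field_simp

theorem intervalIntegrable_fracKernel (hγ₀ : 0 < γ) (hγ : γ < 1) (a b : ℝ) :
    IntervalIntegrable (fracKernel γ) volume a b := by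
  have h1 : IntervalIntegrable (fun x : ℝ => x ^ (-γ) / Real.Gamma (1 - γ)) volume a b :=
    (intervalIntegral.intervalIntegrable_rpow' (by linarith)).div_const _
  have h2 : fracKernel γ = (Set.Ioi (0:ℝ)).indicator
      (fun x : ℝ => x ^ (-γ) / Real.Gamma (1 - γ)) := by
    funext x
    by_cases hx : 0 < x
    · rw [Set.indicator_of_mem (Set.mem_Ioi.2 hx), fracKernel_of_nonneg hx.le]
    · rw [Set.indicator_of_notMem (by simpa using hx), fracKernel_of_nonpos hγ₀ (not_lt.1 hx)]
  rw [h2]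
  rw [intervalIntegrable_iff] at h1 ⊢
  exact h1.indicator measurableSet_Ioi

theorem integral_fracKernel (hγ₀ : 0 < γ) (hγ : γ < 1) (a b : ℝ) :
    ∫ x in a..b, fracKernel γ x = kernelPrim γ b - kernelPrim γ a :=
  integral_eq_of_hasDerivAt_off_countable (kernelPrim γ) (fracKernel γ)
    (Set.countable_singleton 0) (continuous_kernelPrim hγ).continuousOn
    (fun _ hx => hasDerivAt_kernelPrim hγ₀ hγ hx.2) (intervalIntegrable_fracKernel hγ₀ hγ a b)

variable {X : Type*} [NormedAddCommGroup X] [InnerProductSpace ℝ X] [CompleteSpace X] {t : ℕ → ℝ} {v : ℝ → X}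
  {w : ℕ → X} {J : ℕ}

/-- The kernel vanishes on negative arguments, so the integral up to `r` may be extended over all
cells; those beyond `r` contribute nothing. The number of summands is thus independent of `r`, which
permits termwise differentiation. -/
theorem fracIntegral_step (hγ₀ : 0 < γ) (hγ : γ < 1) (ht : StrictMono t) (ht0 : t 0 = 0)
    (hv : ∀ i < J, ∀ s ∈ Set.Ioo (t i) (t (i + 1)), v s = w i) {r : ℝ}
    (hr : r ∈ Set.Icc 0 (t J)) :
    fracIntegral (1 - γ) v r
      = ∑ i ∈ Finset.range J, (kernelPrim γ (r - t i) - kernelPrim γ (r - t (i + 1))) • w i := by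
  have hker : ∀ a b, IntervalIntegrable (fun s => fracKernel γ (r - s)) volume a b := fun a b => by
    have := (intervalIntegrable_fracKernel hγ₀ hγ (r - a) (r - b)).comp_sub_left r
    simpa using this
  have hcell : ∀ i < J, IntervalIntegrable (fun s => fracKernel γ (r - s) • v s) volume (t i)
        (t (i + 1)) ∧
      ∫ s in t i..t (i + 1), fracKernel γ (r - s) • v s
        = (kernelPrim γ (r - t i) - kernelPrim γ (r - t (i + 1))) • w i := by
    intro i hi
    have hle : t i ≤ t (i + 1) := (ht (Nat.lt_succ_self i)).le
    have heq : Set.EqOn (fun s => fracKernel γ (r - s) • v s) (fun s => fracKernel γ (r - s) • w i)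
        (Set.Ioo (t i) (t (i + 1))) := fun s hs => by simp only [hv i hi s hs]
    constructor
    · have h1 : IntervalIntegrable (fun s => fracKernel γ (r - s) • w i) volume (t i) (t (i + 1)) :=
        ⟨(hker _ _).1.smul_const _, (hker _ _).2.smul_const _⟩
      rw [intervalIntegrable_iff_integrableOn_Ioo_of_le hle] at h1 ⊢
      exact h1.congr_fun heq.symm measurableSet_Ioo
    · rw [intervalIntegral.integral_of_le hle, integral_Ioc_eq_integral_Ioo,
        setIntegral_congr_fun measurableSet_Ioo heq, ← integral_Ioc_eq_integral_Ioo,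
        ← intervalIntegral.integral_of_le hle, intervalIntegral.integral_smul_const,
        intervalIntegral.integral_comp_sub_left (fun x => fracKernel γ x),
        integral_fracKernel hγ₀ hγ]
  have hint : IntervalIntegrable (fun s => fracKernel γ (r - s) • v s) volume 0 (t J) := by
    rw [← ht0]
    exact IntervalIntegrable.trans_iterate fun i hi => (hcell i hi).1
  have hsum := intervalIntegral.sum_integral_adjacent_intervals (n := J) (a := t) (μ := volume)
    (f := fun s => fracKernel γ (r - s) • v s) fun i hi => (hcell i hi).1
  rw [ht0, Finset.sum_congr rfl fun i hi => (hcell i (Finset.mem_range.1 hi)).2] at hsum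
  rw [hsum, ← intervalIntegral.integral_add_adjacent_intervals (b := r)
    (hint.mono_set (by
      rw [Set.uIcc_of_le hr.1, Set.uIcc_of_le (hr.1.trans hr.2)]
      exact Set.Icc_subset_Icc le_rfl hr.2))
    (hint.mono_set (by
      rw [Set.uIcc_of_le hr.2, Set.uIcc_of_le (hr.1.trans hr.2)]
      exact Set.Icc_subset_Icc hr.1 le_rfl))]
  have hzero : ∫ s in r..t J, fracKernel γ (r - s) • v s = 0 := by
    refine intervalIntegral.integral_zero_ae (ae_of_all _ fun s hs => ?_)
    rw [Set.uIoc_of_le hr.2] at hs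
    rw [fracKernel_of_nonpos hγ₀ (by linarith [hs.1]), zero_smul]
  rw [hzero, add_zero, fracIntegral, ← intervalIntegral.integral_smul]
  refine intervalIntegral.integral_congr fun s hs => ?_
  rw [Set.uIcc_of_le hr.1] at hs
  rw [fracKernel_of_nonneg (by linarith [hs.2]), smul_smul, div_eq_inv_mul,
    show 1 - γ - 1 = -γ by ring]

/-- Grid points are excluded because the primitive of the kernel has infinite one-sided slope at
zero. They form a null set for the Galerkin integral. -/
theorem fracDeriv_step (hγ₀ : 0 < γ) (hγ : γ < 1) (ht : StrictMono t) (ht0 : t 0 = 0)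
    (hv : ∀ i < J, ∀ s ∈ Set.Ioo (t i) (t (i + 1)), v s = w i) {r : ℝ}
    (hr : r ∈ Set.Ioo 0 (t J)) (hrt : ∀ i, r ≠ t i) :
    fracDeriv γ v r
      = ∑ i ∈ Finset.range J, (fracKernel γ (r - t i) - fracKernel γ (r - t (i + 1))) • w i := by
  refine HasDerivAt.deriv ?_
  have h1 : ∀ i, HasDerivAt (fun r => kernelPrim γ (r - t i)) (fracKernel γ (r - t i)) r := fun i =>
    (hasDerivAt_kernelPrim hγ₀ hγ (sub_ne_zero.2 (hrt i))).comp_sub_const r (t i)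
  refine (HasDerivAt.fun_sum fun i _ =>
    ((h1 i).sub (h1 (i + 1))).smul_const (w i)).congr_of_eventuallyEq ?_
  filter_upwards [Ioo_mem_nhds hr.1 hr.2] with z hz
  exact fracIntegral_step hγ₀ hγ ht ht0 hv ⟨hz.1.le, hz.2.le⟩

end StepFunctions

/-! ### Reduction of the scheme to scalar schemes -/

section Reduction

theorem gridPoint_eq_grid {σ T : ℝ} (J j : ℕ) :
    gridPoint σ T J j = grid (T / (J:ℝ) ^ σ) σ j := by
  rw [gridPoint, grid, Real.div_rpow (Nat.cast_nonneg j) (Nat.cast_nonneg J)]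
  ring

theorem cellWeight_of_le {γ : ℝ} (hγ : γ < 1) {t : ℕ → ℝ} (ht : StrictMono t) {m i : ℕ}
    (hi : m ≤ i) : cellWeight γ t m i = 0 := by
  have h1 := ht.monotone hi
  have h2 := ht.monotone (hi.trans i.le_succ)
  rw [cellWeight, kernelPrim_of_nonpos hγ (by linarith),
    kernelPrim_of_nonpos hγ (by simp only [Nat.succ_eq_add_one] at h2; linarith), sub_zero]

theorem stepIntegral_eq_sum {γ : ℝ} (hγ : γ < 1) {t : ℕ → ℝ} (ht : StrictMono t) (w : ℕ → ℝ)
    {m J : ℕ} (hm : m ≤ J) :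
    stepIntegral γ t w m = ∑ i ∈ Finset.range J, w i * cellWeight γ t m i := by
  refine Finset.sum_subset (Finset.range_mono hm) fun i _ hi => ?_
  rw [cellWeight_of_le hγ ht (by simpa using hi), mul_zero]

variable {X : Type*} [NormedAddCommGroup X] [InnerProductSpace ℝ X] (φ : HilbertBasis ℕ ℝ X)
  (lam : ℕ → ℝ)

theorem inner_basis_eq_zero {n k : ℕ} (h : k ≠ n) : ⟪φ k, φ n⟫_ℝ = 0 := φ.orthonormal.2 h

theorem basis_mem_powDomain (n : ℕ) (ν : ℝ) : φ n ∈ powDomain φ lam ν := by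
  refine summable_of_ne_finset_zero (s := {n}) fun k hk => ?_
  rw [inner_basis_eq_zero φ (by simpa using hk)]
  simp

theorem zero_mem_powDomain (ν : ℝ) : (0 : X) ∈ powDomain φ lam ν := by
  simp [powDomain, summable_zero]

theorem energyForm_basis (v : X) (n : ℕ) : energyForm φ lam v (φ n) = lam n * ⟪φ n, v⟫_ℝ := by
  rw [energyForm, tsum_eq_single n]
  · rw [real_inner_self_eq_norm_sq, φ.orthonormal.1 n]; ring
  · intro k hk
    rw [inner_basis_eq_zero φ hk, mul_zero]

theorem energyForm_zero_right (v : X) : energyForm φ lam v 0 = 0 := by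
  simp [energyForm]

variable {φ lam}

/-- The test function is `φ n` on one cell and zero elsewhere. The kernels in the fractional
derivative integrate to differences of cell weights, and the energy form selects `lam n` times a
linear function, whose integral is the trapezoidal rule. -/
theorem IsPetrovGalerkin.scalar_scheme [CompleteSpace X] {α σ T : ℝ} {J : ℕ} {u₀ : X} {U : ℝ → X} (hα₁ : 1 < α)
    (hα₂ : α < 2) (hσ : 1 ≤ σ) (hT : 0 < T) (hJ : 1 ≤ J)
    (hU : IsPetrovGalerkin φ lam α σ T J u₀ U) (n : ℕ) {g : ℕ → ℝ}
    (hg : g = grid (T / (J:ℝ) ^ σ) σ) {Y : ℕ → ℝ} (hY : Y = fun j => ⟪φ n, U (g j)⟫_ℝ) {j : ℕ}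
    (hj : j < J) :
    stepIntegral (α - 1) g (fun i => (Y (i + 1) - Y i) / (g (i + 1) - g i)) (j + 1)
      - stepIntegral (α - 1) g (fun i => (Y (i + 1) - Y i) / (g (i + 1) - g i)) j
      + lam n * ((g (j + 1) - g j) * (Y j + Y (j + 1)) / 2) = 0 := by
  have hJ0 : (0:ℝ) < J := by exact_mod_cast hJ
  have hτ : 0 < T / (J:ℝ) ^ σ := by positivity
  have hgp : gridPoint σ T J = g := by rw [hg]; exact funext fun j => gridPoint_eq_grid J j
  have hmono : StrictMono g := hg ▸ grid_strictMono hτ hσ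
  have hg0 : g 0 = 0 := hg ▸ grid_zero hσ
  have hgJ : g J = T := by
    rw [hg, grid]; field_simp
  obtain ⟨⟨-, hlin⟩, -, hgal⟩ := hU
  rw [hgp] at hlin
  have hγ₀ : 0 < α - 1 := by linarith
  have hγ : α - 1 < 1 := by linarith
  set w : ℕ → X := fun i => (g (i + 1) - g i)⁻¹ • (U (g (i + 1)) - U (g i)) with hw
  have hderiv : ∀ i < J, ∀ s ∈ Set.Ioo (g i) (g (i + 1)), deriv U s = w i := by
    intro i hi s hs
    have h1 : HasDerivAt (fun t => ((g (i + 1) - t) / (g (i + 1) - g i)) • U (g i)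
        + ((t - g i) / (g (i + 1) - g i)) • U (g (i + 1)))
        ((-1 / (g (i + 1) - g i)) • U (g i) + (1 / (g (i + 1) - g i)) • U (g (i + 1))) s :=
      ((((hasDerivAt_id s).const_sub _).div_const _).smul_const _).add
        ((((hasDerivAt_id s).sub_const _).div_const _).smul_const _)
    have h2 : U =ᶠ[𝓝 s] fun t => ((g (i + 1) - t) / (g (i + 1) - g i)) • U (g i)
        + ((t - g i) / (g (i + 1) - g i)) • U (g (i + 1)) := by
      filter_upwards [Ioo_mem_nhds hs.1 hs.2] with z hz
      exact hlin i hi z ⟨hz.1.le, hz.2.le⟩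
    rw [(h1.congr_of_eventuallyEq h2).deriv, hw]
    simp only [smul_sub, neg_div, one_div, neg_smul]
    abel
  have hlt : g j < g (j + 1) := hmono (Nat.lt_succ_self j)
  have hIoo : Set.Ioo (g j) (g (j + 1)) ⊆ Set.Ioc 0 T := fun s hs =>
    ⟨(hg0 ▸ hmono.monotone (Nat.zero_le j) : (0:ℝ) ≤ g j).trans_lt hs.1,
      hs.2.le.trans (hgJ ▸ hmono.monotone hj)⟩
  have hsep : ∀ i, ∀ s ∈ Set.Ioo (g j) (g (j + 1)), s ≠ g i := by
    rintro i s hs rfl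
    have h1 := hmono.lt_iff_lt.1 hs.1
    have h2 := hmono.lt_iff_lt.1 hs.2
    omega
  classical
  have hV := hgal (fun s => if s ∈ Set.Ioo (g j) (g (j + 1)) then φ n else 0) (by
    intro i hi
    rw [hgp]
    by_cases hij : i = j
    · subst hij
      exact ⟨φ n, basis_mem_powDomain φ lam n _, fun s hs => if_pos hs⟩
    · refine ⟨0, zero_mem_powDomain φ lam _, fun s hs => if_neg fun hs' => hij ?_⟩
      have h1 := hmono.lt_iff_lt.1 (hs.1.trans hs'.2)
      have h2 := hmono.lt_iff_lt.1 (hs'.1.trans hs.2)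
      omega)
  set ww : ℕ → ℝ := fun i => (Y (i + 1) - Y i) / (g (i + 1) - g i) with hww
  have hwn : ∀ i, ⟪w i, φ n⟫_ℝ = ww i := by
    intro i
    simp only [hw, hww, hY]
    rw [real_inner_smul_left, real_inner_comm, inner_sub_right, div_eq_inv_mul]
  set F : ℝ → ℝ := fun s => ∑ i ∈ Finset.range J,
      (fracKernel (α - 1) (s - g i) - fracKernel (α - 1) (s - g (i + 1))) * ww i
    + lam n * ((g (j + 1) - s) / (g (j + 1) - g j) * Y j
      + (s - g j) / (g (j + 1) - g j) * Y (j + 1)) with hF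
  have hind : ∀ s, ⟪fracDeriv (α - 1) (deriv U) s,
        if s ∈ Set.Ioo (g j) (g (j + 1)) then φ n else 0⟫_ℝ
      + energyForm φ lam (U s) (if s ∈ Set.Ioo (g j) (g (j + 1)) then φ n else 0)
      = (Set.Ioo (g j) (g (j + 1))).indicator F s := by
    intro s
    by_cases hs : s ∈ Set.Ioo (g j) (g (j + 1))
    · rw [if_pos hs, Set.indicator_of_mem hs, energyForm_basis, hlin j hj s ⟨hs.1.le, hs.2.le⟩,
        fracDeriv_step hγ₀ hγ hmono hg0 hderiv
          ⟨(hIoo hs).1, hs.2.trans_le (hmono.monotone hj)⟩ (fun i => hsep i s hs),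
        sum_inner, inner_add_right, real_inner_smul_right, real_inner_smul_right]
      simp only [real_inner_smul_left, hwn, hF, hY]
    · rw [if_neg hs, Set.indicator_of_notMem hs, energyForm_zero_right, inner_zero_right, add_zero]
  simp only [hind] at hV
  rw [intervalIntegral.integral_of_le hT.le, setIntegral_indicator measurableSet_Ioo,
    Set.inter_eq_self_of_subset_right hIoo, ← integral_Ioc_eq_integral_Ioo,
    ← intervalIntegral.integral_of_le hlt.le] at hV
  have hker : ∀ c a b, IntervalIntegrable (fun s => fracKernel (α - 1) (s - c)) volume a b :=
    fun c a b => by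
      have := (intervalIntegrable_fracKernel hγ₀ hγ (a - c) (b - c)).comp_sub_right c
      simpa using this
  rw [hF, intervalIntegral.integral_add, intervalIntegral.integral_finsetSum] at hV
  rotate_left
  · exact fun i _ => ((hker _ _ _).sub (hker _ _ _)).mul_const _
  · have h := IntervalIntegrable.sum (Finset.range J) (f := fun i s =>
      (fracKernel (α - 1) (s - g i) - fracKernel (α - 1) (s - g (i + 1))) * ww i) (μ := volume)
      (a := g j) (b := g (j + 1)) fun i _ => ((hker _ _ _).sub (hker _ _ _)).mul_const _
    simpa only [Finset.sum_fn] using h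
  · exact Continuous.intervalIntegrable (by fun_prop) _ _
  have hsumint : ∀ i, ∫ s in g j..g (j + 1),
      (fracKernel (α - 1) (s - g i) - fracKernel (α - 1) (s - g (i + 1))) * ww i
      = ww i * cellWeight (α - 1) g (j + 1) i - ww i * cellWeight (α - 1) g j i := by
    intro i
    rw [intervalIntegral.integral_mul_const,
      intervalIntegral.integral_sub (hker _ _ _) (hker _ _ _),
      intervalIntegral.integral_comp_sub_right (fun s => fracKernel (α - 1) s),
      intervalIntegral.integral_comp_sub_right (fun s => fracKernel (α - 1) s),
      integral_fracKernel hγ₀ hγ, integral_fracKernel hγ₀ hγ, cellWeight, cellWeight]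
    ring
  have hlinint : ∫ s in g j..g (j + 1), lam n * ((g (j + 1) - s) / (g (j + 1) - g j) * Y j
      + (s - g j) / (g (j + 1) - g j) * Y (j + 1))
      = lam n * ((g (j + 1) - g j) * (Y j + Y (j + 1)) / 2) := by
    have hne : g (j + 1) - g j ≠ 0 := (sub_pos.2 hlt).ne'
    have e : ∀ s, lam n * ((g (j + 1) - s) / (g (j + 1) - g j) * Y j
        + (s - g j) / (g (j + 1) - g j) * Y (j + 1))
        = lam n * ((g (j + 1) * Y j - g j * Y (j + 1)) / (g (j + 1) - g j))
          + lam n * ((Y (j + 1) - Y j) / (g (j + 1) - g j)) * s := fun s => by ring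
    simp only [e]
    rw [intervalIntegral.integral_add (Continuous.intervalIntegrable (by fun_prop) _ _)
        (Continuous.intervalIntegrable (by fun_prop) _ _),
      intervalIntegral.integral_const, intervalIntegral.integral_const_mul, integral_id,
      smul_eq_mul]
    field_simp
    ring
  rw [Finset.sum_congr rfl fun i _ => hsumint i, Finset.sum_sub_distrib, hlinint,
    ← stepIntegral_eq_sum hγ hmono ww hj, ← stepIntegral_eq_sum hγ hmono ww hj.le] at hV
  exact hV

theorem hasSum_sq_inner (v : X) :
    HasSum (fun n => ⟪φ n, v⟫_ℝ ^ 2) (‖v‖ ^ 2) := by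
  have h := φ.hasSum_inner_mul_inner v v
  rw [real_inner_self_eq_norm_sq] at h
  refine h.congr_fun fun n => ?_
  rw [real_inner_comm v, sq]

/-- The uniform bound on the Mittag-Leffler function makes the coefficients square summable. Without
convergence the series defining the solution would be `0` by convention. -/
theorem inner_exactSolution {α : ℝ} (hα₁ : 1 < α) (hα₂ : α < 2) (hlam : ∀ n, 0 < lam n) (u₀ : X)
    {t : ℝ} (ht : 0 ≤ t) (n : ℕ) :
    ⟪φ n, exactSolution φ lam α u₀ t⟫_ℝ = mittagLeffler α 1 (-(lam n) * t ^ α) * ⟪φ n, u₀⟫_ℝ := by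
  obtain ⟨C, hC, hsol⟩ := exists_isScalarSolution hα₁ hα₂
  have hb : ∀ k, |mittagLeffler α 1 (-(lam k) * t ^ α)| ≤ C := fun k => by
    obtain ⟨y₁, y₂, y₃, H⟩ := hsol (lam k) (hlam k)
    exact H.bound t ht
  set f : ℕ → ℝ := fun k => mittagLeffler α 1 (-(lam k) * t ^ α) * ⟪φ k, u₀⟫_ℝ with hf
  have hmem : Memℓp f 2 := by
    refine memℓp_gen ?_
    have h1 := ((hasSum_sq_inner (φ := φ) u₀).summable).mul_left (C ^ 2)
    refine h1.of_nonneg_of_le (fun k => by positivity) fun k => ?_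
    rw [ENNReal.toReal_ofNat, Real.rpow_ofNat, Real.norm_eq_abs, hf, abs_mul, mul_pow,
      sq_abs ⟪φ k, u₀⟫_ℝ]
    have := hb k
    gcongr
  have h2 := φ.hasSum_repr_symm ⟨f, hmem⟩
  have h3 : exactSolution φ lam α u₀ t = φ.repr.symm ⟨f, hmem⟩ := h2.tsum_eq
  rw [h3, ← φ.repr_apply_apply, LinearIsometryEquiv.apply_symm_apply]

end Reduction

end FracWave

end

/-! ### Summation over the eigenvalues -/

theorem theorem4p1 (α σ T : ℝ) (hα₁ : 1 < α) (hα₂ : α < 2) (hσ : 1 ≤ σ) (hT : 0 < T) :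
    ∃ C : ℝ, 0 < C ∧
      ∀ (X : Type*) [NormedAddCommGroup X] [InnerProductSpace ℝ X] [CompleteSpace X]
        [TopologicalSpace.SeparableSpace X], ¬ FiniteDimensional ℝ X →
      ∀ A : X →ₗ.[ℝ] X, FracWave.IsAdmissibleOperator A →
      ∀ (φ : HilbertBasis ℕ ℝ X) (lam : ℕ → ℝ), FracWave.IsEigenbasis A φ lam →
      ∀ ν : ℝ, 1 / 2 < ν → ν ≤ 1 → (3 - α) / (α * (ν - 1 / 2)) < σ →
      ∀ u₀ ∈ FracWave.powDomain φ lam ν,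
      ∀ J : ℕ, 1 ≤ J →
      ∀ U : ℝ → X, FracWave.IsPetrovGalerkin φ lam α σ T J u₀ U →
      ∀ m : ℕ, 1 ≤ m → m ≤ J →
        ‖FracWave.exactSolution φ lam α u₀ (FracWave.gridPoint σ T J m) -
            U (FracWave.gridPoint σ T J m)‖
          ≤ C * (J : ℝ) ^ (α - 3) * FracWave.powNorm φ lam ν u₀ := by
  -- The constant is chosen before `ν`. Since `ν ≤ 1`, the grading condition implies this
  -- inequality, which involves only `α` and `σ`; where it fails, the claim is vacuous and any
  -- constant works.
  by_cases hσα : 2 * (3 - α) < σ * α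
  · obtain ⟨K, hK, herr⟩ := FracWave.exists_scalar_error_le hα₁ hα₂ hσ hT hσα
    refine ⟨K, hK, ?_⟩
    intro X _ _ _ _ _ A _ φ lam hlam ν hν₁ hν₂ _ u₀ hu₀ J hJ U hU m _ hm
    have hgp := FracWave.gridPoint_eq_grid (σ := σ) (T := T) J
    have hg0 : 0 ≤ FracWave.gridPoint σ T J m := by
      unfold FracWave.gridPoint
      positivity
    set e := FracWave.exactSolution φ lam α u₀ (FracWave.gridPoint σ T J m) -
      U (FracWave.gridPoint σ T J m) with he
    have hcoef : ∀ n, ⟪φ n, e⟫_ℝ ^ 2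
        ≤ (K * (J:ℝ) ^ (α - 3)) ^ 2 * (lam n ^ (2 * ν) * ⟪φ n, u₀⟫_ℝ ^ 2) := by
      intro n
      have h1 := herr (lam n) (hlam.pos n) J hJ
        (fun j => ⟪φ n, U (FracWave.grid (T / (J:ℝ) ^ σ) σ j)⟫_ℝ)
        (fun j hj => hU.scalar_scheme hα₁ hα₂ hσ hT hJ n rfl rfl hj) m hm ν hν₁.le hν₂
      have h2 : FracWave.grid (T / (J:ℝ) ^ σ) σ 0 = 0 := FracWave.grid_zero hσ
      simp only [h2, hU.initial, ← hgp m] at h1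
      rw [he, inner_sub_right, FracWave.inner_exactSolution hα₁ hα₂ hlam.pos u₀ hg0, ← sq_abs,
        abs_sub_comm]
      refine (pow_le_pow_left₀ (abs_nonneg _) h1 2).trans_eq ?_
      have h3 : lam n ^ (2 * ν) = (lam n ^ ν) ^ 2 := by
        rw [← Real.rpow_natCast, ← Real.rpow_mul (hlam.pos n).le]
        congr 1
        push_cast
        ring
      rw [h3, mul_pow, mul_pow (lam n ^ ν), sq_abs]
    have hsum : ‖e‖ ^ 2 ≤ (K * (J:ℝ) ^ (α - 3)) ^ 2
        * ∑' n, lam n ^ (2 * ν) * ⟪φ n, u₀⟫_ℝ ^ 2 := by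
      have hs : Summable fun n => lam n ^ (2 * ν) * ⟪φ n, u₀⟫_ℝ ^ 2 := hu₀
      exact hasSum_le hcoef (FracWave.hasSum_sq_inner e) (hs.hasSum.mul_left _)
    have hpos : 0 ≤ ∑' n, lam n ^ (2 * ν) * ⟪φ n, u₀⟫_ℝ ^ 2 :=
      tsum_nonneg fun n => mul_nonneg (Real.rpow_nonneg (hlam.pos n).le _) (sq_nonneg _)
    refine le_of_sq_le_sq ?_ (by unfold FracWave.powNorm; positivity)
    rw [FracWave.powNorm, mul_pow, Real.sq_sqrt hpos]
    exact hsum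
  · refine ⟨1, one_pos, ?_⟩
    intro X _ _ _ _ _ A _ φ lam _ ν hν₁ hν₂ hσν
    exfalso
    have h1 : 0 < ν - 1 / 2 := by linarith
    have hα0 : 0 < α := by linarith
    rw [div_lt_iff₀ (by positivity)] at hσν
    have h2 : σ * (α * (ν - 1 / 2)) ≤ σ * (α * (1 / 2)) := by gcongr; linarith
    exact hσα (by linarith)
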